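/- Let $\mathbb K$ be a number field with $r\ge 1$ real embeddings $\sigma_1,\dots,\sigma_r$ and $2s\ge 2$ complex embeddings $\tau_1,\dots,\tau_s,\bar\tau_1,\dots,\bar\tau_s$, let $U$ be a free group of rank $r$ of units of $\mathcal O_{\mathbb K}$ with $\sigma_k(u)>0$ for all $k$ and $u\in U$, such that $\{(\log\sigma_1(u),\dots,\log\sigma_r(u)) : u\in U\}$ is a lattice of rank $r$ in $\mathbb R^r$, and let $M=(\mathbb H^r\times\mathbb C^s)/(U\ltimes\mathcal O_{\mathbb K})$ be the corresponding Oeljeklaus-Toma manifold. Let $b_{ki},c_{ki}\in\mathbb R$ satisfy $\tau_i(u)=\chi_i(\sigma_1(u),\dots,\sigma_r(u))$ for all $u\in U$ and all $i$, where $\chi_i(y)=\prod_{k} y_k^{b_{ki}/2}\,e^{\sqrt{-1}\sum_k c_{ki}\log y_k}$, and let $G$ be the solvable Lie group $\mathbb H^r\times\mathbb C^s$ with product $(x+\sqrt{-1}\,y,v)\cdot(z,w)=(x+yz,\;v+\chi(y)w)$ (componentwise); $U\ltimes\mathcal O_{\mathbb K}$ acts on $G$ by left translations, and the standard complex structure $J$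 is left-invariant. A left-invariant metric on $M$ is one whose lift to $G$ is left-invariant. A Hermitian metric $g$ is identified with its fundamental form $\omega$, where $g(u,v)=\omega(u,Jv)$, and it is pluriclosed if $\partial\bar\partial\omega=0$. The pluriclosed flow is $\partial_t\omega_t=-\rho_B^{1,1}(\omega_t)$, where $\rho_B(u,v)=\sqrt{-1}\sum_i g(R_B(u,v)X_i,\bar X_i)$, $\{X_i\}$ is a unitary frame and $R_B$ is the curvature of the Bismut connection, i.e. of the connection preserving $g$ and $J$ whose torsion $\Theta$ makes $\omega(\Theta(\cdot,\cdot),J\cdot)$ a $3$-form. For $T\in(0,\infty]$, a left-invariant pluriclosed metric $\omega$ on $G$ is called an algebraic expanding soliton of the pluriclosed flow on $[0,T)$ if there are a positive, strictly increasing scaling $a_t$ and a family $\varphi_t$ of automorphisms of the Lie group $G$ preserving $J$ ($t\in[0,T)$), with $a_0=1$ and $\varphi_0=\mathrm{id}$, such that $\omega_t=a_t\varphi_t^*\omega$ solves the pluriclosed flow on $[0,T)$. An adapted coframe is a left-invariant $(1,0)$-coframe $\{\omega^1,\dots,\omega^s,\gamma^1,\dots,\gamma^s\}$ of $G$ such that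 $$d\omega^k=\tfrac{\sqrt{-1}}2\,\omega^k\wedge\bar\omega^k,\qquad d\gamma^i=\sum_{k=1}^s\lambda_{ki}\,\omega^k\wedge\gamma^i-\sum_{k=1}^s\lambda_{ki}\,\bar\omega^k\wedge\gamma^i$$ for some constants $\lambda_{ki}\in\mathbb C$ with $\operatorname{Im}\lambda_{ki}=-\tfrac14\delta_{ki}$. Let $\omega$ be (the lift to $G$ of) a left-invariant pluriclosed Hermitian metric on $M$, and let $T\in(0,\infty]$. Then adapted coframes exist (in particular $r=s$), and for every adapted coframe the following are equivalent: (i) $\omega$ is an algebraic expanding soliton of the pluriclosed flow on $[0,T)$; (ii) there are $A>0$ and $B_1,\dots,B_s>0$ with $$\omega=\sqrt{-1}\sum_{i=1}^s\left(A\,\omega^i\wedge\bar\omega^i+B_i\,\gamma^i\wedge\bar\gamma^i\right).$$ In particular $\omega$ lifts to an algebraic expanding soliton if and only if it has the form (ii) with respect to some adapted coframe. -/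

import Mathlib

open scoped NumberField

namespace OeljeklausToma

noncomputable section

/-! ### Number-theoretic data -/

/-- The data defining an Oeljeklaus-Toma manifold of type `(r, s)`: a number field `K` whose
complex embeddings are the `r` real embeddings `σ k`, and the `2 s` embeddings `τ i` and
`conj ∘ τ i`; and a free group `U` of rank `r` of totally positive units whose image under
`u ↦ (log σ_1(u), …, log σ_r(u))` is a lattice of rank `r` in `ℝ^r`.
The manifold is the quotient of `ℍ^r × ℂ^s` by the group `U ⋉ 𝓞 K` acting by `deck` below. -/
structure OTData (K : Type*) [Field K] [NumberField K] (r s : ℕ) where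
  one_le_r : 1 ≤ r
  one_le_s : 1 ≤ s
  σ : Fin r → K →+* ℝ
  τ : Fin s → K →+* ℂ
  /-- `σ_1, …, σ_r, τ_1, …, τ_s, conj τ_1, …, conj τ_s` lists every embedding `K → ℂ` once;
  in particular `[K : ℚ] = r + 2 s` and no `τ i` is real. -/
  embeddings_bijective : Function.Bijective
    (Sum.elim (fun k => Complex.ofRealHom.comp (σ k))
      (Sum.elim τ (fun i => (starRingEnd ℂ).comp (τ i))) :
        Fin r ⊕ (Fin s ⊕ Fin s) → (K →+* ℂ))
  U : Subgroup (𝓞 K)ˣ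
  totally_positive : ∀ u ∈ U, ∀ k, 0 < σ k ((u : 𝓞 K) : K)
  free : Module.Free ℤ (Additive U)
  rank_eq : Module.finrank ℤ (Additive U) = r
  log_discrete : DiscreteTopology
    ({x | ∃ u ∈ U, x = fun k => Real.log (σ k ((u : 𝓞 K) : K))} : Set (Fin r → ℝ))
  log_span : Submodule.span ℝ
    ({x | ∃ u ∈ U, x = fun k => Real.log (σ k ((u : 𝓞 K) : K))} : Set (Fin r → ℝ)) = ⊤

/-! ### The universal covering `ℍ^r × ℂ^s` and its Lie group structure -/

/-- The complex vector space `ℂ^r × ℂ^s`. -/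
abbrev Ambient (r s : ℕ) : Type := (Fin r → ℂ) × (Fin s → ℂ)

/-- The open subset `ℍ^r × ℂ^s`. -/
def domain (r s : ℕ) : Set (Ambient r s) := {p | ∀ k, 0 < (p.1 k).im}

/-- The character `χ_i(y) = (∏_k y_k ^ (b_{ki}/2)) exp(√-1 ∑_k c_{ki} log y_k)` of `(ℝ_{>0})^r`. -/
def chi {r s : ℕ} (b c : Fin r → Fin s → ℝ) (y : Fin r → ℝ) (i : Fin s) : ℂ :=
  ((∏ k, y k ^ (b k i / 2) : ℝ) : ℂ) *
    Complex.exp (Complex.I * ((∑ k, c k i * Real.log (y k) : ℝ) : ℂ))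

/-- The real exponents `b`, `c` describe the complex embeddings on `U`:
`τ_i(u) = (∏_k σ_k(u) ^ (b_{ki}/2)) exp(√-1 ∑_k c_{ki} log σ_k(u))` for all `u ∈ U`. -/
def OTData.IsExponents {K : Type*} [Field K] [NumberField K] {r s : ℕ} (X : OTData K r s)
    (b c : Fin r → Fin s → ℝ) : Prop :=
  ∀ u ∈ X.U, ∀ i, X.τ i ((u : 𝓞 K) : K) = chi b c (fun k => X.σ k ((u : 𝓞 K) : K)) i

/-- The product `(x + √-1 y, v) * (z, w) = (x + y z, v + χ(y) w)` of `ℍ^r × ℂ^s`. -/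
def mul {r s : ℕ} (b c : Fin r → Fin s → ℝ) (p q : Ambient r s) : Ambient r s :=
  (fun k => ((p.1 k).re : ℂ) + ((p.1 k).im : ℂ) * q.1 k,
   fun i => p.2 i + chi b c (fun k => (p.1 k).im) i * q.2 i)

theorem mul_im {r s : ℕ} (b c : Fin r → Fin s → ℝ) (p q : Ambient r s) (k : Fin r) :
    ((mul b c p q).1 k).im = (p.1 k).im * (q.1 k).im := by
  simp [mul]

theorem mul_mem {r s : ℕ} (b c : Fin r → Fin s → ℝ) {p q : Ambient r s}
    (hp : p ∈ domain r s) (hq : q ∈ domain r s) : mul b c p q ∈ domain r s := fun k => by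
  rw [mul_im]; exact mul_pos (hp k) (hq k)

theorem chi_mul {r s : ℕ} (b c : Fin r → Fin s → ℝ) {y y' : Fin r → ℝ}
    (hy : ∀ k, 0 < y k) (hy' : ∀ k, 0 < y' k) (i : Fin s) :
    chi b c (fun k => y k * y' k) i = chi b c y i * chi b c y' i := by
  have h1 : ∏ k, (y k * y' k) ^ (b k i / 2) =
      (∏ k, y k ^ (b k i / 2)) * ∏ k, y' k ^ (b k i / 2) := by
    rw [← Finset.prod_mul_distrib]
    exact Finset.prod_congr rfl fun k _ => Real.mul_rpow (hy k).le (hy' k).le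
  have h2 : ∑ k, c k i * Real.log (y k * y' k) =
      (∑ k, c k i * Real.log (y k)) + ∑ k, c k i * Real.log (y' k) := by
    rw [← Finset.sum_add_distrib]
    refine Finset.sum_congr rfl fun k _ => ?_
    rw [Real.log_mul (hy k).ne' (hy' k).ne', mul_add]
  unfold chi
  rw [h1, h2, Complex.ofReal_add, mul_add, Complex.exp_add, Complex.ofReal_mul]
  ring

theorem chi_one {r s : ℕ} (b c : Fin r → Fin s → ℝ) (i : Fin s) :
    chi b c (fun _ => 1) i = 1 := by
  simp [chi]

/-- The solvable Lie group `G` with underlying complex manifold `ℍ^r × ℂ^s`. -/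
def SolvGroup {r s : ℕ} (_b _c : Fin r → Fin s → ℝ) : Type := {p : Ambient r s // p ∈ domain r s}

instance {r s : ℕ} (b c : Fin r → Fin s → ℝ) : Mul (SolvGroup b c) :=
  ⟨fun p q => ⟨mul b c p.1 q.1, mul_mem b c p.2 q.2⟩⟩

instance {r s : ℕ} (b c : Fin r → Fin s → ℝ) : One (SolvGroup b c) :=
  ⟨⟨(fun _ => Complex.I, fun _ => 0), fun k => by simp⟩⟩

instance {r s : ℕ} (b c : Fin r → Fin s → ℝ) : Inv (SolvGroup b c) :=
  ⟨fun p => ⟨(fun k => ((-(p.1.1 k).re / (p.1.1 k).im : ℝ) : ℂ) +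
      (((p.1.1 k).im⁻¹ : ℝ) : ℂ) * Complex.I,
    fun i => -(chi b c (fun k => ((p.1.1 k).im)⁻¹) i * p.1.2 i)), fun k => by
      have := p.2 k
      simpa using this⟩⟩

instance {r s : ℕ} (b c : Fin r → Fin s → ℝ) : Group (SolvGroup b c) :=
  Group.ofLeftAxioms
    (fun p q t => by
      apply Subtype.ext
      refine Prod.ext (funext fun k => ?_) (funext fun i => ?_)
      · apply Complex.ext <;>
          simp only [HMul.hMul, Mul.mul] <;> simp [mul] <;> ring
      · have h := chi_mul b c (y := fun k => (p.1.1 k).im) (y' := fun k => (q.1.1 k).im)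
          p.2 q.2 i
        change (mul b c (mul b c p.1 q.1) t.1).2 i = (mul b c p.1 (mul b c q.1 t.1)).2 i
        have e : (fun k => ((mul b c p.1 q.1).1 k).im) =
            fun k => (p.1.1 k).im * (q.1.1 k).im := funext fun k => mul_im b c _ _ k
        change (mul b c p.1 q.1).2 i + chi b c (fun k => ((mul b c p.1 q.1).1 k).im) i * t.1.2 i
          = _
        rw [e, h]
        simp only [mul]
        ring)
    (fun p => by
      apply Subtype.ext
      change mul b c (fun _ => Complex.I, fun _ => 0) p.1 = p.1
      refine Prod.ext (funext fun k => ?_) (funext fun i => ?_)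
      · simp [mul]
      · simp [mul, chi_one])
    (fun p => by
      apply Subtype.ext
      change mul b c (fun k => ((-(p.1.1 k).re / (p.1.1 k).im : ℝ) : ℂ) +
          (((p.1.1 k).im⁻¹ : ℝ) : ℂ) * Complex.I,
        fun i => -(chi b c (fun k => ((p.1.1 k).im)⁻¹) i * p.1.2 i)) p.1 =
          (fun _ => Complex.I, fun _ => 0)
      refine Prod.ext (funext fun k => ?_) (funext fun i => ?_)
      · have hk : (p.1.1 k).im ≠ 0 := (p.2 k).ne'
        apply Complex.ext
        · simp [mul]; field_simp; ring
        · simp [mul, hk]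
      · simp [mul])

/-- The action of `(a, u) ∈ U ⋉ 𝓞 K` on `ℍ^r × ℂ^s`:
`(z, w) ↦ (σ_k(u) z_k + σ_k(a), τ_i(u) w_i + τ_i(a))`. -/
def OTData.deck {K : Type*} [Field K] [NumberField K] {r s : ℕ} (X : OTData K r s)
    (a : 𝓞 K) (u : (𝓞 K)ˣ) (p : Ambient r s) : Ambient r s :=
  (fun k => (X.σ k ((u : 𝓞 K) : K) : ℂ) * p.1 k + (X.σ k (a : K) : ℂ),
   fun i => X.τ i ((u : 𝓞 K) : K) * p.2 i + X.τ i (a : K))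

/-- Every deck transformation is a left translation of `G`, so that left-invariant tensors
descend to the Oeljeklaus-Toma manifold. -/
theorem OTData.deck_eq_mul {K : Type*} [Field K] [NumberField K] {r s : ℕ} (X : OTData K r s)
    {b c : Fin r → Fin s → ℝ} (hbc : X.IsExponents b c) (a : 𝓞 K) {u : (𝓞 K)ˣ} (hu : u ∈ X.U) :
    ∃ g ∈ domain r s, X.deck a u = mul b c g := by
  refine ⟨(fun k => (X.σ k (a : K) : ℂ) + (X.σ k ((u : 𝓞 K) : K) : ℂ) * Complex.I,
    fun i => X.τ i (a : K)), fun k => ?_, funext fun p => ?_⟩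
  · simpa using X.totally_positive u hu k
  · refine Prod.ext (funext fun k => ?_) (funext fun i => ?_)
    · simp [deck, mul, add_comm]
    · simp [deck, mul, hbc u hu i, add_comm]

/-! ### Left-invariant forms and metrics

All objects live on the open set `domain r s`; their values outside of it play no role.
The complex structure `J` is multiplication by `√-1`. -/

/-- Real differential `n`-forms. -/
abbrev Form (r s n : ℕ) : Type := Ambient r s → Ambient r s [⋀^Fin n]→L[ℝ] ℝ

/-- Multiplication by `√-1`, as a real linear map. -/
def J (r s : ℕ) : Ambient r s →L[ℝ] Ambient r s :=
  (Complex.I • ContinuousLinearMap.id ℂ (Ambient r s)).restrictScalars ℝ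

/-- The pull-back `f^* ω`. -/
def pullback {r s n : ℕ} (f : Ambient r s → Ambient r s) (ω : Form r s n) : Form r s n :=
  fun p => (ω (f p)).compContinuousLinearMap (fderiv ℝ f p)

/-- `ω` is the fundamental form of a smooth Hermitian metric on `ℍ^r × ℂ^s`: a smooth real
`(1,1)`-form with `ω(v, J v) > 0` for `v ≠ 0`. The metric is `g(u, v) = ω(u, J v)`. -/
def IsHermitianMetric {r s : ℕ} (ω : Form r s 2) : Prop :=
  ContDiffOn ℝ ((⊤ : ℕ∞) : WithTop ℕ∞) ω (domain r s) ∧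
  (∀ p ∈ domain r s, ∀ u v, ω p ![J r s u, J r s v] = ω p ![u, v]) ∧
  (∀ p ∈ domain r s, ∀ v, v ≠ 0 → 0 < ω p ![v, J r s v])

/-- Invariance under the left translations of `G`. -/
def IsLeftInvariant {r s : ℕ} (b c : Fin r → Fin s → ℝ) (ω : Form r s 2) : Prop :=
  ∀ g ∈ domain r s, ∀ p ∈ domain r s, pullback (mul b c g) ω p = ω p

/-- A `(1,1)`-form `ω` is pluriclosed: `∂∂̄ω = 0`. For a real `(1,1)`-form,
`(dω)(J·, J·, J·) = √-1 (∂ω - ∂̄ω)`, whose exterior derivative is `-2 √-1 ∂∂̄ω`. -/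
def IsPluriclosed {r s : ℕ} (ω : Form r s 2) : Prop :=
  ∀ p ∈ domain r s,
    extDeriv (fun q => (extDeriv ω q).compContinuousLinearMap (J r s)) p = 0

/-! ### The Bismut connection and the pluriclosed flow -/

/-- The Christoffel symbol `Γ` of a connection `∇_u v = D_u v + Γ(u, v)` on `ℍ^r × ℂ^s`. -/
abbrev Christoffel (r s : ℕ) : Type :=
  Ambient r s → Ambient r s →L[ℝ] Ambient r s →L[ℝ] Ambient r s

/-- `Γ` is the Bismut connection of the Hermitian metric `ω`: it is smooth, preserves the complex
structure and the metric `g(u, v) = ω(u, J v)`, and its torsion `T(u, v) = Γ(u, v) - Γ(v, u)` is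
such that `ω(T(·,·), J·)` is a `3`-form. -/
def IsBismut {r s : ℕ} (ω : Form r s 2) (Γ : Christoffel r s) : Prop :=
  ContDiffOn ℝ ((⊤ : ℕ∞) : WithTop ℕ∞) Γ (domain r s) ∧
  ∀ p ∈ domain r s,
    (∀ u v, Γ p u (J r s v) = J r s (Γ p u v)) ∧
    (∀ u v w, fderiv ℝ (fun q => ω q ![v, J r s w]) p u =
      ω p ![Γ p u v, J r s w] + ω p ![v, J r s (Γ p u w)]) ∧
    (∀ u v w, ω p ![Γ p u v - Γ p v u, J r s w] = - ω p ![Γ p u w - Γ p w u, J r s v])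

/-- The curvature `R(u, v) = ∇_u ∇_v - ∇_v ∇_u` (for constant vector fields `u`, `v`) of the
connection with Christoffel symbol `Γ`, as an endomorphism of the tangent space at `p`. -/
def curvature {r s : ℕ} (Γ : Christoffel r s) (p u v : Ambient r s) :
    Ambient r s →L[ℝ] Ambient r s :=
  fderiv ℝ Γ p u v - fderiv ℝ Γ p v u + (Γ p u).comp (Γ p v) - (Γ p v).comp (Γ p u)

/-- The Ricci form `ρ(u, v) = √-1 ∑_i g(R(u, v) X_i, X̄_i)`, with `X_i` a unitary frame, of a
Hermitian connection. This is `√-1` times the complex trace of `R(u, v)`, a skew-Hermitian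
endomorphism, hence one half of the real trace of `J ∘ R(u, v)`. -/
def ricciForm {r s : ℕ} (Γ : Christoffel r s) (p u v : Ambient r s) : ℝ :=
  (1 / 2) * LinearMap.trace ℝ (Ambient r s)
    ((J r s).comp (curvature Γ p u v) : Ambient r s →ₗ[ℝ] Ambient r s)

/-- The `(1,1)`-component of `ricciForm`. -/
def ricciForm11 {r s : ℕ} (Γ : Christoffel r s) (p u v : Ambient r s) : ℝ :=
  (1 / 2) * (ricciForm Γ p u v + ricciForm Γ p (J r s u) (J r s v))

/-- The time interval `[0, T)`, with `T = ⊤` allowed. -/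
def timeInterval (T : EReal) : Set ℝ := {t | 0 ≤ t ∧ (t : EReal) < T}

/-- `ω_t` is a solution of the pluriclosed flow `∂_t ω_t = - ρ_B^{1,1}(ω_t)` on `[0, T)`. -/
def SolvesPluriclosedFlow {r s : ℕ} (T : EReal) (ω : ℝ → Form r s 2) : Prop :=
  ∀ t ∈ timeInterval T, IsHermitianMetric (ω t) ∧ IsPluriclosed (ω t) ∧
    ∃ Γ : Christoffel r s, IsBismut (ω t) Γ ∧
      ∀ p ∈ domain r s, ∀ u v,
        HasDerivWithinAt (fun t' => ω t' p ![u, v]) (-ricciForm11 Γ p u v) (timeInterval T) t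

/-- `f` is an automorphism of the Lie group `G` preserving the complex structure, i.e. a
holomorphic group automorphism. -/
def IsAutomorphism {r s : ℕ} (b c : Fin r → Fin s → ℝ) (f : Ambient r s → Ambient r s) : Prop :=
  ContDiffOn ℂ ((⊤ : ℕ∞) : WithTop ℕ∞) f (domain r s) ∧
  ∃ Φ : SolvGroup b c ≃* SolvGroup b c, ∀ p : SolvGroup b c, f p.1 = (Φ p).1

/-- `ω` is an expanding algebraic soliton of the pluriclosed flow: for a positive, strictly
increasing scaling `a_t` and automorphisms `φ_t` of `G` preserving the complex structure, with
`a_0 = 1` and `φ_0 = id`, the family `a_t φ_t^* ω` solves the flow on `[0, T)`. -/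
def IsExpandingAlgebraicSoliton {r s : ℕ} (b c : Fin r → Fin s → ℝ) (T : EReal)
    (ω : Form r s 2) : Prop :=
  ∃ (a : ℝ → ℝ) (φ : ℝ → Ambient r s → Ambient r s),
    a 0 = 1 ∧ (∀ p ∈ domain r s, φ 0 p = p) ∧
    (∀ t ∈ timeInterval T, 0 < a t ∧ IsAutomorphism b c (φ t)) ∧
    StrictMonoOn a (timeInterval T) ∧
    SolvesPluriclosedFlow T (fun t p => a t • pullback (φ t) ω p)

/-! ### Adapted coframes -/

/-- `(1,0)`-forms: their values are complex linear. -/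
abbrev Form10 (r s : ℕ) : Type := Ambient r s → Ambient r s →L[ℂ] ℂ

/-- The exterior derivative of a `(1,0)`-form, as a complex valued `2`-form. -/
def Form10.d {r s : ℕ} (α : Form10 r s) (p u v : Ambient r s) : ℂ :=
  fderiv ℝ (fun q => α q v) p u - fderiv ℝ (fun q => α q u) p v

/-- `α ∧ β`. -/
def wedge {r s : ℕ} (α β : Form10 r s) (p u v : Ambient r s) : ℂ :=
  α p u * β p v - α p v * β p u

/-- `ᾱ ∧ β`. -/
def wedgeConjLeft {r s : ℕ} (α β : Form10 r s) (p u v : Ambient r s) : ℂ :=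
  (starRingEnd ℂ) (α p u) * β p v - (starRingEnd ℂ) (α p v) * β p u

/-- `α ∧ β̄`. -/
def wedgeConjRight {r s : ℕ} (α β : Form10 r s) (p u v : Ambient r s) : ℂ :=
  α p u * (starRingEnd ℂ) (β p v) - α p v * (starRingEnd ℂ) (β p u)

/-- Left-invariance of a `(1,0)`-form. -/
def Form10.IsLeftInvariant {r s : ℕ} (b c : Fin r → Fin s → ℝ) (α : Form10 r s) : Prop :=
  ∀ g ∈ domain r s, ∀ p ∈ domain r s, ∀ u,
    α (mul b c g p) (fderiv ℝ (mul b c g) p u) = α p u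

/-- The structure constants `λ_{ki} = -c_{ki}/2` for `i ≠ k`, `λ_{kk} = -c_{kk}/2 - √-1/4`. -/
def lam {n : ℕ} (c : Fin n → Fin n → ℝ) (k i : Fin n) : ℂ :=
  -((c k i : ℂ) / 2) - if i = k then Complex.I / 4 else 0

/-- `{α_1, …, α_n, γ_1, …, γ_n}` is a left-invariant `(1,0)`-coframe of `G` with
`dα_k = (√-1/2) α_k ∧ ᾱ_k` and `dγ_i = ∑_k λ_{ki} α_k ∧ γ_i - ∑_k λ_{ki} ᾱ_k ∧ γ_i`, where
`Im λ_{ki} = -δ_{ki}/4`. -/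
def IsAdaptedCoframe {r s n : ℕ} (b c : Fin r → Fin s → ℝ) (α γ : Fin n → Form10 r s) : Prop :=
  (∀ k, (α k).IsLeftInvariant b c) ∧ (∀ i, (γ i).IsLeftInvariant b c) ∧
  (∀ p ∈ domain r s,
    LinearIndependent ℂ (Sum.elim (fun k => α k p) (fun i => γ i p)) ∧
    Submodule.span ℂ (Set.range (Sum.elim (fun k => α k p) (fun i => γ i p))) = ⊤) ∧
  ∃ c' : Fin n → Fin n → ℝ, ∀ p ∈ domain r s, ∀ u v,
    (∀ k, (α k).d p u v = Complex.I / 2 * wedgeConjRight (α k) (α k) p u v) ∧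
    (∀ i, (γ i).d p u v =
      (∑ k, lam c' k i * wedge (α k) (γ i) p u v) -
        ∑ k, lam c' k i * wedgeConjLeft (α k) (γ i) p u v)

/-- `ω = √-1 ∑_i (A α_i ∧ ᾱ_i + B_i γ_i ∧ γ̄_i)` with `A, B_i > 0`. -/
def IsDiagonalWithCommonCoefficient {r s n : ℕ} (α γ : Fin n → Form10 r s) (ω : Form r s 2) :
    Prop :=
  ∃ (A : ℝ) (B : Fin n → ℝ), 0 < A ∧ (∀ i, 0 < B i) ∧
    ∀ p ∈ domain r s, ∀ u v, ((ω p ![u, v] : ℝ) : ℂ) =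
      Complex.I * ∑ i, ((A : ℂ) * wedgeConjRight (α i) (α i) p u v +
        (B i : ℂ) * wedgeConjRight (γ i) (γ i) p u v)

end

end OeljeklausToma

namespace OeljeklausToma

noncomputable section

open ComplexConjugate

variable {r s : ℕ}

/-! ### The standard left-invariant coframe -/

/-! All objects are left-invariant, so in the coframe of the forms dz_k/y_k and χ_i⁻¹dw_i they
become constants: a metric is a positive definite matrix C (`exists_hasMatrix`), split into a
z-block, a w-block and mixed entries. In coordinates its coefficients are monomials in the y_k with
complex exponents, so pluriclosedness, the Bismut connection and its Ricci form reduce to algebra at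
the neutral element.

Shape of G. Pluriclosedness forces b_li (b_ki + δ_kl) = 0. Hence every b_ki is 0 or -1, and no
column has two nonzero entries. The product formula gives row sums -1. A zero column would mean
|τ_i| = 1 on U; moving the relation τ_i · conj τ_i = 1 by an embedding of the algebraic closure of ℚ
would make the inverse of some σ_k on U the restriction of another embedding, against the
independence of the logarithms. So -b is a permutation matrix and r = s
(`exists_equiv_of_quadratic`). The remaining pluriclosed equations make the w-block diagonal, the
off-diagonal z-entries purely imaginary, and each mixed row proportional to a fixed vector.

Rigidity. The structure equations, read at the neutral element, determine a coframe up to one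
permutation and a rescaling of the γ_i (`coframe_rigid`). This applies to every adapted coframe and
also to the pull-back of the standard coframe by an automorphism, so automorphisms only permute and
rescale the entries of C.

Ricci form. The Bismut conditions determine the connection (`bismut_formula`), and the trace of J
against the quadratic part of the curvature vanishes, so the Ricci form is the differential of an
explicit left-invariant 1-form. Its (1,1)-part has no w-block and no off-diagonal z-entries.

A soliton is diagonal (`IsExpandingAlgebraicSoliton.matrix_eq`). The permutation may depend on t, so
symmetric functions of the entries are differentiated at t = 0. The sum of |C_{i,e(i)}|²/C_ii scales
by a_t, hence cannot decrease, while the flow gives it a nonpositive derivative that vanishes only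
if the mixed entries do. The sum of the diagonal z-entries scales by a_t and has positive
derivative, so a'(0) exists and is positive. The sum of the squared off-diagonal z-entries, and then
that of the squared differences of the diagonal ones, scale by a_t² with zero derivative, so both
vanish.

Conversely, for a diagonal metric only A moves, with A' = 3/4; the dilations w ↦ l w with l² a_t = 1
compensate the scaling on the w-block (`HasMatrix.isExpandingAlgebraicSoliton`). -/

/-- The coordinate functionals of `ℂ^r × ℂ^s`. -/
def coord (a : Fin r ⊕ Fin s) : Ambient r s →L[ℂ] ℂ :=
  Sum.elim
    (fun k => (ContinuousLinearMap.proj k).comp (ContinuousLinearMap.fst ℂ (Fin r → ℂ) (Fin s → ℂ)))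
    (fun i => (ContinuousLinearMap.proj i).comp (ContinuousLinearMap.snd ℂ (Fin r → ℂ) (Fin s → ℂ)))
    a

@[simp] theorem coord_inl (k : Fin r) (u : Ambient r s) : coord (Sum.inl k) u = u.1 k := rfl

@[simp] theorem coord_inr (i : Fin s) (u : Ambient r s) : coord (Sum.inr i) u = u.2 i := rfl

/-- The vector with prescribed coordinates. -/
def ofCoord (x : Fin r ⊕ Fin s → ℂ) : Ambient r s := (fun k => x (.inl k), fun i => x (.inr i))

@[simp] theorem coord_ofCoord (x : Fin r ⊕ Fin s → ℂ) (a) : coord a (ofCoord x) = x a := by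
  rcases a with k | i <;> rfl

theorem ext_coord {u v : Ambient r s} (h : ∀ a, coord a u = coord a v) : u = v :=
  Prod.ext (funext fun k => h (.inl k)) (funext fun i => h (.inr i))

theorem J_apply (u : Ambient r s) : J r s u = Complex.I • u := rfl

theorem J_J (u : Ambient r s) : J r s (J r s u) = -u := by
  simp [J_apply, smul_smul]

theorem isOpen_domain : IsOpen (domain r s) := by
  have : domain r s = ⋂ k : Fin r, {p | 0 < (p.1 k).im} := by
    ext p; simp [domain]
  rw [this]
  exact isOpen_iInter_of_finite fun k =>
    isOpen_lt continuous_const (Complex.continuous_im.comp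
      ((continuous_apply k).comp continuous_fst))

/-- The function `∏_k y_k ^ (-ν_k)` for complex exponents `ν`. -/
def powFactor (ν : Fin r → ℂ) (q : Ambient r s) : ℂ :=
  Complex.exp (-∑ k, ν k * (Real.log (q.1 k).im : ℂ))

theorem powFactor_ne_zero (ν : Fin r → ℂ) (q : Ambient r s) : powFactor ν q ≠ 0 :=
  Complex.exp_ne_zero _

theorem powFactor_add (ν ν' : Fin r → ℂ) (q : Ambient r s) :
    powFactor (ν + ν') q = powFactor ν q * powFactor ν' q := by
  simp only [powFactor, ← Complex.exp_add, Pi.add_apply, add_mul, Finset.sum_add_distrib]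
  ring_nf

theorem conj_powFactor (ν : Fin r → ℂ) (q : Ambient r s) :
    conj (powFactor ν q) = powFactor (fun k => conj (ν k)) q := by
  simp [powFactor, ← Complex.exp_conj]

theorem powFactor_single (k : Fin r) {q : Ambient r s} (hq : q ∈ domain r s) :
    powFactor (Pi.single k 1) q = ((q.1 k).im : ℂ)⁻¹ := by
  have h : ∑ l, (Pi.single k 1 : Fin r → ℂ) l * (Real.log (q.1 l).im : ℂ) =
      (Real.log (q.1 k).im : ℂ) := by
    rw [Finset.sum_eq_single k] <;> simp +contextual
  rw [powFactor, h, ← Complex.ofReal_neg, ← Complex.ofReal_exp, Real.exp_neg,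
    Real.exp_log (hq k), Complex.ofReal_inv]

/-- The differential of the `k`-th imaginary part. -/
def imCoord (k : Fin r) : Ambient r s →L[ℝ] ℝ :=
  Complex.imCLM.comp ((coord (s := s) (Sum.inl k)).restrictScalars ℝ)

@[simp] theorem imCoord_apply (k : Fin r) (u : Ambient r s) : imCoord k u = (u.1 k).im := rfl

theorem hasFDerivAt_powFactor (ν : Fin r → ℂ) {q : Ambient r s} (hq : q ∈ domain r s) :
    HasFDerivAt (𝕜 := ℝ) (powFactor ν)
      (-∑ k, (ν k * powFactor ν q * ((q.1 k).im : ℂ)⁻¹) •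
        (Complex.ofRealCLM.comp (imCoord k : Ambient r s →L[ℝ] ℝ))) q := by
  have h1 : ∀ k, HasFDerivAt (𝕜 := ℝ) (fun q : Ambient r s => ν k * (Real.log (q.1 k).im : ℂ))
      (ν k • Complex.ofRealCLM.comp (((q.1 k).im)⁻¹ • (imCoord k : Ambient r s →L[ℝ] ℝ))) q := by
    intro k
    have h2 : HasFDerivAt (fun q : Ambient r s => (q.1 k).im) (imCoord k) q :=
      (imCoord k).hasFDerivAt
    exact (Complex.ofRealCLM.hasFDerivAt.comp q (h2.log (hq k).ne')).const_mul (ν k)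
  have h3 := (HasFDerivAt.fun_sum (u := Finset.univ) fun k _ => h1 k).neg.cexp
  refine h3.congr_fderiv ?_
  refine ContinuousLinearMap.ext fun u => ?_
  simp [powFactor, Finset.mul_sum, mul_assoc, mul_comm, mul_left_comm]

theorem fderiv_powFactor (ν : Fin r → ℂ) {q : Ambient r s} (hq : q ∈ domain r s) (u) :
    fderiv ℝ (powFactor ν) q u =
      -∑ k, ν k * (((u.1 k).im : ℂ) * ((q.1 k).im : ℂ)⁻¹) * powFactor ν q := by
  rw [(hasFDerivAt_powFactor ν hq).fderiv]
  simp [mul_assoc, mul_comm, mul_left_comm]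

/-- The factor 1/y_k is absorbed by raising the k-th exponent by one. Derivatives are thus again
combinations of power functions, and the formula can be iterated. -/
theorem fderiv_powFactor' (ν : Fin r → ℂ) {q : Ambient r s} (hq : q ∈ domain r s) (u) :
    fderiv ℝ (powFactor ν) q u =
      -∑ k, ν k * ((u.1 k).im : ℂ) * powFactor (ν + Pi.single k 1) q := by
  rw [fderiv_powFactor ν hq]
  congr 1
  refine Finset.sum_congr rfl fun k _ => ?_
  rw [powFactor_add, powFactor_single k hq]
  ring

theorem differentiableAt_powFactor (ν : Fin r → ℂ) {q : Ambient r s} (hq : q ∈ domain r s) :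
    DifferentiableAt ℝ (powFactor ν) q := (hasFDerivAt_powFactor ν hq).differentiableAt

theorem contDiffOn_powFactor (ν : Fin r → ℂ) {n : WithTop ℕ∞} :
    ContDiffOn ℝ n (powFactor ν : Ambient r s → ℂ) (domain r s) := by
  refine ContDiffOn.cexp (ContDiffOn.neg (ContDiffOn.sum fun k _ => contDiffOn_const.mul ?_))
  refine Complex.ofRealCLM.contDiff.comp_contDiffOn (ContDiffOn.log ?_ fun q hq => (hq k).ne')
  exact (imCoord k : Ambient r s →L[ℝ] ℝ).contDiff.contDiffOn

/-- The exponents of the standard coframe: `θ_a = ∏_k y_k ^ (-weight k a) d(coord a)`. -/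
def weight (b c : Fin r → Fin s → ℝ) (k : Fin r) : Fin r ⊕ Fin s → ℂ :=
  Sum.elim (fun m => if m = k then 1 else 0) (fun i => (b k i / 2 : ℝ) + c k i * Complex.I)

/-- The standard left-invariant coframe `dz_k / y_k`, `χ_i(y)⁻¹ dw_i` of `G`. -/
def theta (b c : Fin r → Fin s → ℝ) (a : Fin r ⊕ Fin s) : Form10 r s :=
  fun q => powFactor (fun k => weight b c k a) q • coord a

variable (b c : Fin r → Fin s → ℝ)

theorem theta_apply (a : Fin r ⊕ Fin s) (q u : Ambient r s) :
    theta b c a q u = powFactor (fun k => weight b c k a) q * coord a u := rfl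

theorem theta_inl (k : Fin r) {q : Ambient r s} (hq : q ∈ domain r s) (u : Ambient r s) :
    theta b c (.inl k) q u = ((q.1 k).im : ℂ)⁻¹ * u.1 k := by
  rw [theta_apply, ← powFactor_single k hq]
  congr 2
  ext l
  simp [weight, Pi.single_apply, eq_comm]

theorem im_theta_inl (k : Fin r) {q : Ambient r s} (hq : q ∈ domain r s) (u : Ambient r s) :
    (((theta b c (.inl k) q u).im : ℝ) : ℂ) = ((u.1 k).im : ℂ) * ((q.1 k).im : ℂ)⁻¹ := by
  rw [theta_inl b c k hq, ← Complex.ofReal_inv, Complex.im_ofReal_mul]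
  push_cast
  ring

theorem powFactor_weight_inl (k : Fin r) {q : Ambient r s} (hq : q ∈ domain r s) :
    powFactor (fun l => weight b c l (.inl k)) q = ((q.1 k).im : ℂ)⁻¹ := by
  rw [← powFactor_single k hq]
  congr 1
  ext l
  simp [weight, Pi.single_apply, eq_comm]

theorem powFactor_weight_inr (i : Fin s) {q : Ambient r s} (hq : q ∈ domain r s) :
    powFactor (fun l => weight b c l (.inr i)) q = (chi b c (fun k => (q.1 k).im) i)⁻¹ := by
  have h : ∏ k, (q.1 k).im ^ (b k i / 2) = Real.exp (∑ k, Real.log (q.1 k).im * (b k i / 2)) := by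
    rw [Real.exp_sum]
    exact Finset.prod_congr rfl fun k _ => Real.rpow_def_of_pos (hq k) _
  rw [chi, h, Complex.ofReal_exp, ← Complex.exp_add, ← Complex.exp_neg, powFactor]
  congr 2
  push_cast
  rw [Finset.mul_sum, ← Finset.sum_add_distrib]
  refine Finset.sum_congr rfl fun k _ => ?_
  simp only [weight, Sum.elim_inr]
  push_cast
  ring

theorem powFactor_mul (ν : Fin r → ℂ) {g q : Ambient r s} (hg : g ∈ domain r s)
    (hq : q ∈ domain r s) :
    powFactor ν (mul b c g q) = powFactor ν g * powFactor ν q := by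
  simp only [powFactor, ← Complex.exp_add]
  congr 1
  rw [← neg_add, ← Finset.sum_add_distrib]
  congr 1
  refine Finset.sum_congr rfl fun k _ => ?_
  rw [mul_im, Real.log_mul (hg k).ne' (hq k).ne']
  push_cast
  ring

/-- The dual frame of the coframe `theta`. -/
def frame (q : Ambient r s) (x : Fin r ⊕ Fin s → ℂ) : Ambient r s :=
  ofCoord fun a => (powFactor (fun k => weight b c k a) q)⁻¹ * x a

/-- The components of a tangent vector with respect to `theta`. -/
def hat (q u : Ambient r s) : Fin r ⊕ Fin s → ℂ := fun a => theta b c a q u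

theorem hat_apply (q u : Ambient r s) (a) : hat b c q u a = theta b c a q u := rfl

@[simp] theorem hat_frame (q : Ambient r s) (x) : hat b c q (frame b c q x) = x := by
  ext a
  simp [hat, theta_apply, frame, powFactor_ne_zero]

@[simp] theorem frame_hat (q u : Ambient r s) : frame b c q (hat b c q u) = u := by
  apply ext_coord
  intro a
  simp [hat, theta_apply, frame, powFactor_ne_zero]

theorem hat_add (q u v : Ambient r s) : hat b c q (u + v) = hat b c q u + hat b c q v := by
  ext a; simp [hat]

theorem hat_smul (q : Ambient r s) (z : ℂ) (u : Ambient r s) :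
    hat b c q (z • u) = z • hat b c q u := by
  ext a; simp [hat]

theorem hat_sub (q u v : Ambient r s) : hat b c q (u - v) = hat b c q u - hat b c q v := by
  ext a; simp [hat]

theorem hat_J (q u : Ambient r s) : hat b c q (J r s u) = Complex.I • hat b c q u := by
  rw [J_apply, hat_smul]

/-- The neutral element of `G`. -/
def base (r s : ℕ) : Ambient r s := (fun _ => Complex.I, fun _ => 0)

theorem base_mem : base r s ∈ domain r s := fun k => by simp [base]

@[simp] theorem powFactor_base (ν : Fin r → ℂ) : powFactor ν (base r s) = 1 := by
  simp [powFactor, base]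

theorem theta_base (a) (u : Ambient r s) : theta b c a (base r s) u = coord a u := by
  simp [theta_apply]

theorem mul_base (q : Ambient r s) : mul b c q (base r s) = q := by
  refine Prod.ext (funext fun k => ?_) (funext fun i => ?_)
  · simp [mul, base, Complex.re_add_im]
  · simp [mul, base]

/-- The differential of a left translation. -/
def mulDeriv (g : Ambient r s) : Ambient r s →L[ℂ] Ambient r s :=
  (ContinuousLinearMap.pi fun k => ((g.1 k).im : ℂ) • coord (Sum.inl k)).prod
    (ContinuousLinearMap.pi fun i => chi b c (fun k => (g.1 k).im) i • coord (Sum.inr i))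

theorem hasFDerivAt_mul (g p : Ambient r s) :
    HasFDerivAt (mul b c g) (mulDeriv b c g) p := by
  have h : mul b c g = fun p => ((fun k => ((g.1 k).re : ℂ), g.2) : Ambient r s) +
      mulDeriv b c g p := by
    funext p
    refine Prod.ext (funext fun k => ?_) (funext fun i => ?_) <;>
    simp [mul, mulDeriv]
  rw [h]
  exact (mulDeriv b c g).hasFDerivAt.const_add _

theorem fderiv_mul (g p u : Ambient r s) :
    fderiv ℝ (mul b c g) p u = mulDeriv b c g u := by
  rw [((hasFDerivAt_mul b c g p).restrictScalars ℝ).fderiv]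
  rfl

theorem hat_mul {g p : Ambient r s} (hg : g ∈ domain r s) (hp : p ∈ domain r s) (u) :
    hat b c (mul b c g p) (mulDeriv b c g u) = hat b c p u := by
  ext a
  rw [hat_apply, hat_apply, theta_apply, theta_apply, powFactor_mul b c _ hg hp]
  rcases a with k | i
  · have : ((g.1 k).im : ℂ) ≠ 0 := by exact_mod_cast (hg k).ne'
    rw [powFactor_weight_inl b c k hg]
    simp [mulDeriv]
    field_simp
  · have := powFactor_ne_zero (fun l => weight b c l (.inr i)) g
    rw [powFactor_weight_inr b c i hg] at this ⊢
    simp [mulDeriv] at this ⊢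
    field_simp

theorem theta_isLeftInvariant (a) : (theta b c a).IsLeftInvariant b c := fun g hg p hp u => by
  rw [fderiv_mul]
  exact congrFun (hat_mul b c hg hp u) a

theorem hat_base (u : Ambient r s) : hat b c (base r s) u = fun a => coord a u :=
  funext fun a => theta_base b c a u

theorem mulDeriv_eq_frame {g : Ambient r s} (hg : g ∈ domain r s) (u) :
    mulDeriv b c g u = frame b c g fun a => coord a u := by
  rw [← hat_base b c, ← hat_mul b c hg base_mem, mul_base, frame_hat]

/-! ### Derivatives of the coframe -/

theorem differentiableAt_theta (a) {q : Ambient r s} (hq : q ∈ domain r s) (v) :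
    DifferentiableAt ℝ (fun q => theta b c a q v) q :=
  (differentiableAt_powFactor _ hq).mul_const _

theorem fderiv_theta (a) {q : Ambient r s} (hq : q ∈ domain r s) (u v) :
    fderiv ℝ (fun q => theta b c a q v) q u =
      -∑ k, weight b c k a * ((hat b c q u (.inl k)).im : ℂ) * hat b c q v a := by
  have h := ((hasFDerivAt_powFactor (fun k => weight b c k a) hq).mul_const (coord a v))
  rw [show (fun q => theta b c a q v) = fun q =>
    powFactor (fun k => weight b c k a) q * coord a v from rfl, h.fderiv]
  simp only [hat_apply, im_theta_inl b c _ hq]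
  rw [theta_apply]
  simp [Finset.sum_mul, mul_assoc, mul_comm, mul_left_comm]

theorem d_theta (a) {q : Ambient r s} (hq : q ∈ domain r s) (u v) :
    (theta b c a).d q u v = -∑ k, weight b c k a *
      (((hat b c q u (.inl k)).im : ℂ) * hat b c q v a -
        ((hat b c q v (.inl k)).im : ℂ) * hat b c q u a) := by
  rw [Form10.d, fderiv_theta b c a hq, fderiv_theta b c a hq]
  rw [← neg_add_eq_sub, neg_neg, ← sub_eq_add_neg, ← Finset.sum_sub_distrib, ← Finset.sum_neg_distrib]
  refine Finset.sum_congr rfl fun k _ => ?_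
  ring

/-! ### Left-invariant metrics -/

/-- The sesquilinear form with matrix `C`. -/
def hermForm {ι : Type*} [Fintype ι] (C : Matrix ι ι ℂ) (x y : ι → ℂ) : ℂ :=
  ∑ a, ∑ d, C a d * x a * conj (y d)

/-- `ω = √-1 ∑ C_{ad} θ_a ∧ conj θ_d`. -/
def HasMatrix (C : Matrix (Fin r ⊕ Fin s) (Fin r ⊕ Fin s) ℂ) (ω : Form r s 2) : Prop :=
  ∀ q ∈ domain r s, ∀ u v, ω q ![u, v] = -2 * (hermForm C (hat b c q u) (hat b c q v)).im

theorem form_swap {E : Type*} [NormedAddCommGroup E] [NormedSpace ℝ E]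
    (η : E [⋀^Fin 2]→L[ℝ] ℝ) (u v : E) : η ![v, u] = -η ![u, v] := by
  have h := η.toAlternatingMap.map_swap ![u, v] (show (0 : Fin 2) ≠ 1 by decide)
  have e : (![u, v] ∘ Equiv.swap (0 : Fin 2) 1) = ![v, u] := by
    ext i; fin_cases i <;> simp
  rw [e] at h
  exact h

end

end OeljeklausToma

namespace OeljeklausToma

noncomputable section

open ComplexConjugate
open scoped ComplexOrder

variable {r s : ℕ}

/-! ### Sesquilinear forms with constant matrix -/

section HermForm

variable {ι : Type*} [Fintype ι] (C : Matrix ι ι ℂ)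

theorem hermForm_add_left (x x' y : ι → ℂ) :
    hermForm C (x + x') y = hermForm C x y + hermForm C x' y := by
  simp [hermForm, mul_add, add_mul, Finset.sum_add_distrib]

theorem hermForm_smul_left (z : ℂ) (x y : ι → ℂ) :
    hermForm C (z • x) y = z * hermForm C x y := by
  simp only [hermForm, Finset.mul_sum, Pi.smul_apply, smul_eq_mul]
  exact Finset.sum_congr rfl fun _ _ => Finset.sum_congr rfl fun _ _ => by ring

theorem hermForm_smul_right (z : ℂ) (x y : ι → ℂ) :
    hermForm C x (z • y) = conj z * hermForm C x y := by
  simp only [hermForm, Finset.mul_sum, Pi.smul_apply, smul_eq_mul, map_mul]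
  exact Finset.sum_congr rfl fun _ _ => Finset.sum_congr rfl fun _ _ => by ring

theorem hermForm_neg_left (x y : ι → ℂ) : hermForm C (-x) y = -hermForm C x y := by
  simp [hermForm]

theorem hermForm_sub_left (x x' y : ι → ℂ) :
    hermForm C (x - x') y = hermForm C x y - hermForm C x' y := by
  rw [sub_eq_add_neg, hermForm_add_left, hermForm_neg_left, sub_eq_add_neg]

theorem conj_hermForm {C : Matrix ι ι ℂ} (hC : C.IsHermitian) (x y : ι → ℂ) :
    conj (hermForm C x y) = hermForm C y x := by
  simp only [hermForm, map_sum, map_mul, Complex.conj_conj]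
  rw [Finset.sum_comm]
  refine Finset.sum_congr rfl fun a _ => Finset.sum_congr rfl fun d _ => ?_
  have h : conj (C d a) = C a d := hC.apply a d
  rw [h]; ring

theorem hermForm_single [DecidableEq ι] (a d : ι) :
    hermForm C (Pi.single a 1) (Pi.single d 1) = C a d := by
  rw [hermForm, Finset.sum_eq_single a, Finset.sum_eq_single d] <;> simp +contextual

theorem hermForm_single_right [DecidableEq ι] (x : ι → ℂ) (d : ι) :
    hermForm C x (Pi.single d 1) = ∑ a, x a * C a d := by
  rw [hermForm]
  refine Finset.sum_congr rfl fun a _ => ?_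
  rw [Finset.sum_eq_single d] <;> simp +contextual [mul_comm]

/-- The conjugates appear because `hermForm` is linear in its first slot, while the quadratic form
in `Matrix.PosDef` is antilinear there. -/
theorem hermForm_self_eq (x : ι → ℂ) :
    hermForm C x x = star (fun a => conj (x a)) ⬝ᵥ C.mulVec (fun a => conj (x a)) := by
  simp only [hermForm, dotProduct, Matrix.mulVec, Finset.mul_sum, Pi.star_apply]
  refine Finset.sum_congr rfl fun a _ => Finset.sum_congr rfl fun d _ => ?_
  simp
  ring

theorem hermForm_self_pos {C : Matrix ι ι ℂ} (hC : C.PosDef) {x : ι → ℂ} (hx : x ≠ 0) :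
    0 < (hermForm C x x).re := by
  rw [hermForm_self_eq]
  refine hC.re_dotProduct_pos (x := fun a => conj (x a)) fun h => hx (funext fun a => ?_)
  simpa using congrFun h a

end HermForm

variable (b c : Fin r → Fin s → ℝ)

/-- A left-invariant Hermitian metric has constant coefficients in the coframe `theta`. -/
theorem exists_hasMatrix {ω : Form r s 2} (hω : IsHermitianMetric ω)
    (hinv : IsLeftInvariant b c ω) : ∃ C : Matrix (Fin r ⊕ Fin s) (Fin r ⊕ Fin s) ℂ,
    C.PosDef ∧ HasMatrix b c C ω := by
  obtain ⟨-, hJ, hpos⟩ := hω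
  set o := base r s
  have ho : o ∈ domain r s := base_mem
  -- This is the Hermitian form with 2 Re h = g and -2 Im h = ω, linear in the first slot and
  -- antilinear in the second; C is its matrix in the coordinate basis at the neutral element.
  set h : Ambient r s → Ambient r s → ℂ := fun u v =>
    (1 / 2) * ((ω o ![u, J r s v] : ℝ) - Complex.I * (ω o ![u, v] : ℝ)) with hdef
  have addl : ∀ u u' v, ω o ![u + u', v] = ω o ![u, v] + ω o ![u', v] := fun u u' v =>
    (ω o).vecCons_add _ _ _
  have addr : ∀ u v v', ω o ![u, v + v'] = ω o ![u, v] + ω o ![u, v'] := fun u v v' => by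
    rw [form_swap _ (v + v') u, addl, form_swap _ u v, form_swap _ u v']; ring
  have smull : ∀ (t : ℝ) u v, ω o ![t • u, v] = t * ω o ![u, v] := fun t u v =>
    (ω o).vecCons_smul _ _ _
  have smulr : ∀ (t : ℝ) u v, ω o ![u, t • v] = t * ω o ![u, v] := fun t u v => by
    rw [form_swap _ (t • v) u, smull, form_swap _ u v]; ring
  have Jl : ∀ u v, ω o ![J r s u, v] = -ω o ![u, J r s v] := fun u v => by
    rw [← hJ o ho u (J r s v), J_J, ← neg_one_smul ℝ v, smulr]; ring
  have Jneg : ∀ u v, ω o ![u, J r s (J r s v)] = - ω o ![u, v] := fun u v => by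
    rw [J_J, ← neg_one_smul ℝ v, smulr]; ring
  have hadd : ∀ u u' v, h (u + u') v = h u v + h u' v := fun u u' v => by
    simp only [hdef, addl]; push_cast; ring
  have hadd' : ∀ u v v', h u (v + v') = h u v + h u v' := fun u v v' => by
    simp only [hdef, addr, map_add]; push_cast; ring
  have hI : ∀ u v, h (Complex.I • u) v = Complex.I * h u v := fun u v => by
    simp only [hdef, ← J_apply, Jl, Jneg]; push_cast; linear_combination
      ((ω o ![u, v] : ℂ) / 2) * Complex.I_sq
  have hI' : ∀ u v, h u (Complex.I • v) = -Complex.I * h u v := fun u v => by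
    simp only [hdef, ← J_apply, Jneg]; push_cast; linear_combination
      (-(ω o ![u, v] : ℂ) / 2) * Complex.I_sq
  have hr : ∀ (t : ℝ) u v, h (t • u) v = t * h u v := fun t u v => by
    simp only [hdef, smull]; push_cast; ring
  have hr' : ∀ (t : ℝ) u v, h u (t • v) = t * h u v := fun t u v => by
    simp only [hdef, map_smul, smulr]; push_cast; ring
  have hsmul : ∀ (z : ℂ) u v, h (z • u) v = z * h u v := fun z u v => by
    have e : z • u = z.re • u + z.im • (Complex.I • u) := by
      conv_lhs => rw [← Complex.re_add_im z, add_smul, mul_smul]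
      rfl
    rw [e, hadd, hr, hr, hI]
    conv_rhs => rw [← Complex.re_add_im z]
    ring
  have hsmul' : ∀ (z : ℂ) u v, h u (z • v) = conj z * h u v := fun z u v => by
    have e : z • v = z.re • v + z.im • (Complex.I • v) := by
      conv_lhs => rw [← Complex.re_add_im z, add_smul, mul_smul]
      rfl
    have ec : conj z = z.re - z.im * Complex.I := by apply Complex.ext <;> simp
    rw [e, hadd', hr', hr', hI', ec]
    ring
  have hconj : ∀ u v, conj (h u v) = h v u := fun u v => by
    have e1 : ω o ![v, J r s u] = ω o ![u, J r s v] := by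
      rw [form_swap _ (J r s u) v, Jl, neg_neg]
    simp only [hdef, e1, form_swap _ u v]
    simp [map_ofNat]
  let hL : Ambient r s →ₗ[ℂ] Ambient r s →ₛₗ[starRingEnd ℂ] ℂ :=
    LinearMap.mk₂'ₛₗ (RingHom.id ℂ) (starRingEnd ℂ) h hadd hsmul hadd' hsmul'
  set E : Fin r ⊕ Fin s → Ambient r s := fun a => ofCoord (Pi.single a 1)
  let C : Matrix (Fin r ⊕ Fin s) (Fin r ⊕ Fin s) ℂ := fun a d => h (E a) (E d)
  have hexp : ∀ u : Ambient r s, u = ∑ a, coord a u • E a := fun u => by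
    apply ext_coord
    intro d
    rw [map_sum, Finset.sum_eq_single d] <;> simp +contextual [E, eq_comm]
  have hC : ∀ u v, h u v = hermForm C (fun a => coord a u) (fun a => coord a v) := fun u v => by
    change hL u v = _
    conv_lhs => rw [hexp u, hexp v]
    simp only [hermForm, map_sum, LinearMap.sum_apply]
    rw [Finset.sum_comm]
    refine Finset.sum_congr rfl fun a _ => ?_
    refine Finset.sum_congr rfl fun d _ => ?_
    change h (coord a u • E a) (coord d v • E d) = _
    rw [hsmul, hsmul']
    simp only [C]
    ring
  refine ⟨C, ?_, fun q hq u v => ?_⟩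
  · refine Matrix.PosDef.of_dotProduct_mulVec_pos (Matrix.IsHermitian.ext fun a d => hconj _ _)
      fun x hx => ?_
    have e := hermForm_self_eq C (fun a => conj (x a))
    simp only [Complex.conj_conj] at e
    change 0 < star x ⬝ᵥ C.mulVec x
    rw [← e]
    set u : Ambient r s := ofCoord fun a => conj (x a)
    have hu : u ≠ 0 := fun h0 => hx (funext fun a => by
      have : coord a u = 0 := by rw [h0, map_zero]
      simpa [u] using this)
    have e2 := hC u u
    simp only [u, coord_ofCoord] at e2
    rw [← e2]
    have e3 : ω o ![u, u] = 0 := by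
      have := form_swap (ω o) u u
      linarith
    simp only [hdef]
    rw [e3]
    have := hpos o ho u hu
    rw [Complex.pos_iff]
    constructor
    · simpa using this
    · simp
  -- Left translation by q carries the neutral element to q and the coordinate basis to the dual
  -- frame of `theta`, so invariance gives the same matrix at q.
  · have e1 := hinv q hq o ho
    have e2 : ω q ![u, v] = ω o ![ofCoord (hat b c q u), ofCoord (hat b c q v)] := by
      rw [← e1]
      simp only [pullback, ContinuousAlternatingMap.compContinuousLinearMap_apply]
      have : ∀ u, fderiv ℝ (mul b c q) o (ofCoord (hat b c q u)) = u := fun u => by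
        rw [fderiv_mul, mulDeriv_eq_frame b c hq]
        simp
      have e3 : (⇑(fderiv ℝ (mul b c q) o) ∘ ![ofCoord (hat b c q u), ofCoord (hat b c q v)]) =
          ![u, v] := by
        ext i : 1
        fin_cases i <;> simp [this]
      rw [e3]
      simp only [o, mul_base]
    rw [e2]
    have e4 := hC (ofCoord (hat b c q u)) (ofCoord (hat b c q v))
    simp only [coord_ofCoord] at e4
    have e5 := congrArg Complex.im e4
    simp [hdef] at e5
    linarith

variable {b c}

theorem HasMatrix.apply {C : Matrix (Fin r ⊕ Fin s) (Fin r ⊕ Fin s) ℂ} {ω : Form r s 2}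
    (h : HasMatrix b c C ω) {q : Ambient r s} (hq : q ∈ domain r s) (u v) :
    ω q ![u, v] = -2 * (hermForm C (hat b c q u) (hat b c q v)).im := h q hq u v

theorem HasMatrix.apply_J {C : Matrix (Fin r ⊕ Fin s) (Fin r ⊕ Fin s) ℂ} {ω : Form r s 2}
    (h : HasMatrix b c C ω) {q : Ambient r s} (hq : q ∈ domain r s) (u v) :
    ω q ![u, J r s v] = 2 * (hermForm C (hat b c q u) (hat b c q v)).re := by
  rw [h.apply hq, hat_J, hermForm_smul_right]
  simp

end

end OeljeklausToma

namespace OeljeklausToma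

noncomputable section

open ComplexConjugate
open scoped ComplexOrder

variable {r s : ℕ}

/-! ### Consequences of pluriclosedness -/

theorem extDeriv_two_apply {E : Type*} [NormedAddCommGroup E] [NormedSpace ℝ E]
    {ω : E → E [⋀^Fin 2]→L[ℝ] ℝ} {q : E} (h : DifferentiableAt ℝ ω q) (x y z : E) :
    extDeriv ω q ![x, y, z] = fderiv ℝ (fun q => ω q ![y, z]) q x -
      fderiv ℝ (fun q => ω q ![x, z]) q y + fderiv ℝ (fun q => ω q ![x, y]) q z := by
  rw [extDeriv_apply h, Fin.sum_univ_three]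
  have e0 : (0 : Fin 3).removeNth ![x, y, z] = ![y, z] := by
    ext i : 1; fin_cases i <;> rfl
  have e1 : (1 : Fin 3).removeNth ![x, y, z] = ![x, z] := by
    ext i : 1; fin_cases i <;> rfl
  have e2 : (2 : Fin 3).removeNth ![x, y, z] = ![x, y] := by
    ext i : 1; fin_cases i <;> rfl
  rw [e0, e1, e2]
  simp [sub_eq_add_neg]

theorem extDeriv_three_apply {E : Type*} [NormedAddCommGroup E] [NormedSpace ℝ E]
    {ω : E → E [⋀^Fin 3]→L[ℝ] ℝ} {q : E} (h : DifferentiableAt ℝ ω q) (x y z w : E) :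
    extDeriv ω q ![x, y, z, w] = fderiv ℝ (fun q => ω q ![y, z, w]) q x -
      fderiv ℝ (fun q => ω q ![x, z, w]) q y + fderiv ℝ (fun q => ω q ![x, y, w]) q z -
      fderiv ℝ (fun q => ω q ![x, y, z]) q w := by
  rw [extDeriv_apply h, Fin.sum_univ_four]
  have e0 : (0 : Fin 4).removeNth ![x, y, z, w] = ![y, z, w] := by
    ext i : 1; fin_cases i <;> rfl
  have e1 : (1 : Fin 4).removeNth ![x, y, z, w] = ![x, z, w] := by
    ext i : 1; fin_cases i <;> rfl
  have e2 : (2 : Fin 4).removeNth ![x, y, z, w] = ![x, y, w] := by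
    ext i : 1; fin_cases i <;> rfl
  have e3 : (3 : Fin 4).removeNth ![x, y, z, w] = ![x, y, z] := by
    ext i : 1; fin_cases i <;> rfl
  rw [e0, e1, e2, e3]
  simp [sub_eq_add_neg, pow_succ]

theorem contDiffOn_fderiv_form {n : ℕ} {ω : Form r s n}
    (hω : ContDiffOn ℝ ((⊤ : ℕ∞) : WithTop ℕ∞) ω (domain r s)) :
    ContDiffOn ℝ ((⊤ : ℕ∞) : WithTop ℕ∞) (fderiv ℝ ω) (domain r s) :=
  hω.fderiv_of_isOpen isOpen_domain (by simp)

theorem contDiffOn_extDeriv {n : ℕ} {ω : Form r s n}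
    (hω : ContDiffOn ℝ ((⊤ : ℕ∞) : WithTop ℕ∞) ω (domain r s)) :
    ContDiffOn ℝ ((⊤ : ℕ∞) : WithTop ℕ∞) (extDeriv ω) (domain r s) :=
  ContDiff.comp_contDiffOn
    (g := ⇑(ContinuousAlternatingMap.alternatizeUncurryFinCLM ℝ (Ambient r s) ℝ (n := n)))
    (ContinuousLinearMap.contDiff _) (contDiffOn_fderiv_form hω)

theorem contDiffOn_extDeriv_J {n : ℕ} {ω : Form r s n}
    (hω : ContDiffOn ℝ ((⊤ : ℕ∞) : WithTop ℕ∞) ω (domain r s)) :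
    ContDiffOn ℝ ((⊤ : ℕ∞) : WithTop ℕ∞)
      (fun q => (extDeriv ω q).compContinuousLinearMap (J r s)) (domain r s) :=
  ContDiff.comp_contDiffOn
    (g := ⇑(ContinuousAlternatingMap.compContinuousLinearMapCLM (F := ℝ) (ι := Fin (n + 1))
      (J r s))) (ContinuousLinearMap.contDiff _) (contDiffOn_extDeriv hω)

/-- The second derivative of the coefficients of a `2`-form. -/
def secondDeriv (ω : Form r s 2) (p v x y z : Ambient r s) : ℝ :=
  fderiv ℝ (fun q => fderiv ℝ (fun q' => ω q' ![y, z]) q x) p v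

theorem differentiableAt_fderiv_form {ω : Form r s 2}
    (hω : ContDiffOn ℝ ((⊤ : ℕ∞) : WithTop ℕ∞) ω (domain r s)) {p : Ambient r s}
    (hp : p ∈ domain r s) (x y z : Ambient r s) :
    DifferentiableAt ℝ (fun q => fderiv ℝ (fun q' => ω q' ![y, z]) q x) p := by
  have h1 : ContDiffOn ℝ ((⊤ : ℕ∞) : WithTop ℕ∞) (fun q' => ω q' ![y, z]) (domain r s) :=
    (ContinuousAlternatingMap.apply ℝ (Ambient r s) ℝ ![y, z]).contDiff.comp_contDiffOn hω
  have h2 := (h1.fderiv_of_isOpen (m := ((⊤ : ℕ∞) : WithTop ℕ∞)) isOpen_domain (by simp))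
  have h3 := (h2.contDiffAt (isOpen_domain.mem_nhds hp)).differentiableAt (by simp)
  exact h3.clm_apply (differentiableAt_const x)

/-- Since ω(J·, J·) = ω, the three J's in dω(J·, J·, J·) disappear from the arguments of ω and
survive only in the direction of differentiation. For constant vector fields one more exterior
derivative then gives an alternating sum of second derivatives of coefficients. -/
theorem IsPluriclosed.secondDeriv_eq {ω : Form r s 2} (hω : IsHermitianMetric ω)
    (hpl : IsPluriclosed ω) {p : Ambient r s} (hp : p ∈ domain r s) (v₀ v₁ v₂ v₃ : Ambient r s) :
    (secondDeriv ω p v₀ (J r s v₁) v₂ v₃ - secondDeriv ω p v₀ (J r s v₂) v₁ v₃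
      + secondDeriv ω p v₀ (J r s v₃) v₁ v₂)
    - (secondDeriv ω p v₁ (J r s v₀) v₂ v₃ - secondDeriv ω p v₁ (J r s v₂) v₀ v₃
      + secondDeriv ω p v₁ (J r s v₃) v₀ v₂)
    + (secondDeriv ω p v₂ (J r s v₀) v₁ v₃ - secondDeriv ω p v₂ (J r s v₁) v₀ v₃
      + secondDeriv ω p v₂ (J r s v₃) v₀ v₁)
    - (secondDeriv ω p v₃ (J r s v₀) v₁ v₂ - secondDeriv ω p v₃ (J r s v₁) v₀ v₂
      + secondDeriv ω p v₃ (J r s v₂) v₀ v₁) = 0 := by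
  obtain ⟨hs, hJ, -⟩ := hω
  have hd := ((contDiffOn_extDeriv_J hs).contDiffAt (isOpen_domain.mem_nhds hp)).differentiableAt
    (by simp)
  have h0 := DFunLike.congr_fun (hpl p hp) ![v₀, v₁, v₂, v₃]
  rw [extDeriv_three_apply hd] at h0
  have key : ∀ x y z v : Ambient r s, fderiv ℝ (fun q =>
      ((extDeriv ω q).compContinuousLinearMap (J r s)) ![x, y, z]) p v =
      secondDeriv ω p v (J r s x) y z - secondDeriv ω p v (J r s y) x z
        + secondDeriv ω p v (J r s z) x y := by
    intro x y z v
    have e : (fun q => ((extDeriv ω q).compContinuousLinearMap (J r s)) ![x, y, z]) =ᶠ[nhds p]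
        fun q => fderiv ℝ (fun q' => ω q' ![y, z]) q (J r s x) -
          fderiv ℝ (fun q' => ω q' ![x, z]) q (J r s y) +
          fderiv ℝ (fun q' => ω q' ![x, y]) q (J r s z) := by
      filter_upwards [isOpen_domain.mem_nhds hp] with q hq
      have e1 : (⇑(J r s) ∘ ![x, y, z]) = ![J r s x, J r s y, J r s z] := by
        ext i : 1; fin_cases i <;> rfl
      rw [ContinuousAlternatingMap.compContinuousLinearMap_apply, e1, extDeriv_two_apply
        ((hs.contDiffAt (isOpen_domain.mem_nhds hq)).differentiableAt (by simp))]
      have e2 : ∀ y z, (fun q' => ω q' ![J r s y, J r s z]) =ᶠ[nhds q] fun q' => ω q' ![y, z] :=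
        fun y z => by
          filter_upwards [isOpen_domain.mem_nhds hq] with q' hq'
          exact hJ q' hq' y z
      rw [(e2 y z).fderiv_eq, (e2 x z).fderiv_eq, (e2 x y).fderiv_eq]
    rw [e.fderiv_eq]
    have d := fun x y z => differentiableAt_fderiv_form hs hp x y z
    rw [fderiv_fun_add ((d _ _ _).fun_sub (d _ _ _)) (d _ _ _), fderiv_fun_sub (d _ _ _) (d _ _ _)]
    rfl
  rw [key, key, key, key] at h0
  exact h0

variable (b c : Fin r → Fin s → ℝ)

/-- The exponents of the coefficients of `dz_a ∧ d\bar z_d`. -/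
def biweight (a d : Fin r ⊕ Fin s) (k : Fin r) : ℂ := weight b c k a + conj (weight b c k d)

variable {b c}

theorem hermForm_hat (C : Matrix (Fin r ⊕ Fin s) (Fin r ⊕ Fin s) ℂ) (q u v : Ambient r s) :
    hermForm C (hat b c q u) (hat b c q v) =
      ∑ a, ∑ d, C a d * coord a u * conj (coord d v) * powFactor (biweight b c a d) q := by
  refine Finset.sum_congr rfl fun a _ => Finset.sum_congr rfl fun d _ => ?_
  have : biweight b c a d = (fun k => weight b c k a) + fun k => conj (weight b c k d) := rfl
  rw [this, powFactor_add, ← conj_powFactor, hat_apply, hat_apply, theta_apply, theta_apply, map_mul]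
  ring

theorem hasFDerivAt_powSum {ι : Type*} (S : Finset ι) (K : ι → ℂ) (ν : ι → Fin r → ℂ)
    {q : Ambient r s} (hq : q ∈ domain r s) :
    DifferentiableAt ℝ (fun q => ∑ a ∈ S, K a * powFactor (ν a) q) q ∧ ∀ x,
    fderiv ℝ (fun q => ∑ a ∈ S, K a * powFactor (ν a) q) q x =
      -∑ a ∈ S, ∑ k, K a * ν a k * ((x.1 k).im : ℂ) * powFactor (ν a + Pi.single k 1) q := by
  have h : ∀ a ∈ S, HasFDerivAt (fun q => K a * powFactor (ν a) q)
      (K a • fderiv ℝ (powFactor (ν a)) q) q := fun a _ =>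
    (differentiableAt_powFactor (ν a) hq).hasFDerivAt.const_mul (K a)
  have h2 := HasFDerivAt.fun_sum h
  refine ⟨h2.differentiableAt, fun x => ?_⟩
  rw [h2.fderiv, sum_apply, ← Finset.sum_neg_distrib]
  refine Finset.sum_congr rfl fun a _ => ?_
  rw [smul_apply, fderiv_powFactor' _ hq, smul_eq_mul, mul_neg, Finset.mul_sum]
  simp only [mul_assoc]

/-- The coefficients are combinations of ∏ y_k^(-`biweight`). The first derivative raises one
exponent by one, which is the shift `Pi.single k 1` in the factor produced by the second. Only
imaginary parts of the z-components matter as directions, since nothing depends on x or w. -/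
theorem HasMatrix.secondDeriv_base {C : Matrix (Fin r ⊕ Fin s) (Fin r ⊕ Fin s) ℂ} {ω : Form r s 2}
    (h : HasMatrix b c C ω) (v x y z : Ambient r s) :
    secondDeriv ω (base r s) v x y z = -2 * (∑ a, ∑ d, ∑ k, ∑ l,
      C a d * coord a y * conj (coord d z) * (biweight b c a d k) *
        (biweight b c a d l + (Pi.single k 1 : Fin r → ℂ) l) * (x.1 k).im * (v.1 l).im).im := by
  have hq : ∀ q ∈ domain r s, fderiv ℝ (fun q' => ω q' ![y, z]) q x =
      2 * (∑ t : ((Fin r ⊕ Fin s) × (Fin r ⊕ Fin s)) × Fin r,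
        (C t.1.1 t.1.2 * coord t.1.1 y * conj (coord t.1.2 z) * biweight b c t.1.1 t.1.2 t.2 *
          ((x.1 t.2).im : ℂ)) *
          powFactor (biweight b c t.1.1 t.1.2 + Pi.single t.2 1) q).im := by
    intro q hq
    have e : (fun q' => ω q' ![y, z]) =ᶠ[nhds q] fun q' =>
        (-2) * Complex.imCLM (∑ t : (Fin r ⊕ Fin s) × (Fin r ⊕ Fin s),
          (C t.1 t.2 * coord t.1 y * conj (coord t.2 z)) * powFactor (biweight b c t.1 t.2) q') := by
      filter_upwards [isOpen_domain.mem_nhds hq] with q' hq'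
      rw [h.apply hq', hermForm_hat, ← Finset.univ_product_univ, Finset.sum_product]
      rfl
    obtain ⟨d1, d2⟩ := hasFDerivAt_powSum (Finset.univ : Finset ((Fin r ⊕ Fin s) × (Fin r ⊕ Fin s)))
      (fun t => C t.1 t.2 * coord t.1 y * conj (coord t.2 z)) (fun t => biweight b c t.1 t.2) hq
    have h3 := ((Complex.imCLM.hasFDerivAt.comp q d1.hasFDerivAt).const_mul (-2))
    simp only [Function.comp_def] at h3
    rw [e.fderiv_eq, h3.fderiv]
    simp only [smul_apply, ContinuousLinearMap.comp_apply, d2]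
    rw [map_neg, ← Finset.univ_product_univ (α := (Fin r ⊕ Fin s) × (Fin r ⊕ Fin s)) (β := Fin r),
      Finset.sum_product]
    simp only [Complex.imCLM_apply, smul_eq_mul]
    ring
  have e : (fun q => fderiv ℝ (fun q' => ω q' ![y, z]) q x) =ᶠ[nhds (base r s)] fun q =>
      2 * Complex.imCLM (∑ t : ((Fin r ⊕ Fin s) × (Fin r ⊕ Fin s)) × Fin r,
        (C t.1.1 t.1.2 * coord t.1.1 y * conj (coord t.1.2 z) * biweight b c t.1.1 t.1.2 t.2 *
          ((x.1 t.2).im : ℂ)) *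
          powFactor (biweight b c t.1.1 t.1.2 + Pi.single t.2 1) q) := by
    filter_upwards [isOpen_domain.mem_nhds base_mem] with q' hq'
    exact hq q' hq'
  obtain ⟨d1, d2⟩ := hasFDerivAt_powSum
    (Finset.univ : Finset (((Fin r ⊕ Fin s) × (Fin r ⊕ Fin s)) × Fin r))
    (fun t => C t.1.1 t.1.2 * coord t.1.1 y * conj (coord t.1.2 z) * biweight b c t.1.1 t.1.2 t.2 *
          ((x.1 t.2).im : ℂ)) (fun t => biweight b c t.1.1 t.1.2 + Pi.single t.2 1)
    (base_mem (r := r) (s := s))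
  have h3 := ((Complex.imCLM.hasFDerivAt.comp (base r s) d1.hasFDerivAt).const_mul 2)
  simp only [Function.comp_def] at h3
  rw [secondDeriv, e.fderiv_eq, h3.fderiv]
  simp only [smul_apply, ContinuousLinearMap.comp_apply, d2]
  rw [map_neg, ← Finset.univ_product_univ, Finset.sum_product, ← Finset.univ_product_univ,
    Finset.sum_product]
  simp only [Complex.imCLM_apply, smul_eq_mul, powFactor_base, Pi.add_apply]
  rw [mul_neg, neg_mul, neg_inj]
  congr 2
  refine Finset.sum_congr rfl fun a _ => Finset.sum_congr rfl fun d _ =>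
    Finset.sum_congr rfl fun k _ => Finset.sum_congr rfl fun l _ => ?_
  ring

end

end OeljeklausToma

namespace OeljeklausToma

noncomputable section

open ComplexConjugate
open scoped ComplexOrder

variable {r s : ℕ} {b c : Fin r → Fin s → ℝ}

/-! ### Pluriclosedness on coordinate vectors -/

/-- The multiple `z` of a coordinate vector. -/
def vec (z : ℂ) (a : Fin r ⊕ Fin s) : Ambient r s := ofCoord (Pi.single a z)

@[simp] theorem coord_vec (z : ℂ) (a d : Fin r ⊕ Fin s) :
    coord d (vec z a) = (Pi.single a z : Fin r ⊕ Fin s → ℂ) d := coord_ofCoord _ _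

theorem vec_fst (z : ℂ) (a : Fin r ⊕ Fin s) (k : Fin r) :
    (vec z a).1 k = (Pi.single a z : Fin r ⊕ Fin s → ℂ) (.inl k) := rfl

theorem J_vec (z : ℂ) (a : Fin r ⊕ Fin s) : J r s (vec z a) = vec (Complex.I * z) a := by
  apply ext_coord
  intro d
  rw [J_apply, map_smul, coord_vec, coord_vec, Pi.single_apply, Pi.single_apply]
  split <;> simp

theorem secondDeriv_swap (ω : Form r s 2) (p v x y z : Ambient r s) :
    secondDeriv ω p v x z y = -secondDeriv ω p v x y z := by
  have e : (fun q' => ω q' ![z, y]) = fun q' => -ω q' ![y, z] := by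
    ext q; exact form_swap _ _ _
  simp only [secondDeriv, e, fderiv_fun_neg, neg_apply]

section

variable {C : Matrix (Fin r ⊕ Fin s) (Fin r ⊕ Fin s) ℂ} {ω : Form r s 2}

theorem HasMatrix.secondDeriv_eq_zero_left (h : HasMatrix b c C ω) {v : Ambient r s}
    (hv : ∀ l, (v.1 l).im = 0) (x y z : Ambient r s) : secondDeriv ω (base r s) v x y z = 0 := by
  rw [h.secondDeriv_base]
  simp [hv]

theorem HasMatrix.secondDeriv_eq_zero_right (h : HasMatrix b c C ω) {x : Ambient r s}
    (hx : ∀ l, (x.1 l).im = 0) (v y z : Ambient r s) : secondDeriv ω (base r s) v x y z = 0 := by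
  rw [h.secondDeriv_base]
  simp [hx]

theorem HasMatrix.secondDeriv_vec (h : HasMatrix b c C ω) (k l : Fin r) (a d : Fin r ⊕ Fin s)
    (z w : ℂ) :
    secondDeriv ω (base r s) (vec Complex.I (.inl l)) (vec Complex.I (.inl k)) (vec z a) (vec w d) =
      -2 * (C a d * z * conj w * biweight b c a d k *
        (biweight b c a d l + (Pi.single k 1 : Fin r → ℂ) l)).im := by
  rw [h.secondDeriv_base]
  congr 2
  rw [Finset.sum_eq_single a, Finset.sum_eq_single d, Finset.sum_eq_single k,
    Finset.sum_eq_single l]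
  · simp [vec_fst]
  all_goals simp +contextual [vec_fst, Pi.single_apply, eq_comm]

theorem eq_zero_of_im {X : ℂ} (h : ∀ z : ℂ, (z * X).im = 0) : X = 0 := by
  apply Complex.ext
  · simpa using h Complex.I
  · simpa using h 1

theorem im_vec_real (a : Fin r ⊕ Fin s) (l : Fin r) : ((vec 1 a).1 l).im = 0 := by
  rw [vec_fst, Pi.single_apply]; split <;> simp

theorem im_vec_inr (z : ℂ) (i : Fin s) (l : Fin r) : ((vec z (Sum.inr i)).1 l).im = 0 := by
  simp [vec_fst]

variable (hω : IsHermitianMetric ω) (hpl : IsPluriclosed ω)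
include hω hpl

/-- With one imaginary and one real z-direction and two w-directions, exactly one of the twelve
second derivatives survives. Letting the multiple z of the third vector vary turns the real equation
into a complex one. -/
theorem HasMatrix.pluriclosed_inr_inr (h : HasMatrix b c C ω) (i j : Fin s) (k l : Fin r) :
    C (.inr i) (.inr j) * biweight b c (.inr i) (.inr j) l *
      (biweight b c (.inr i) (.inr j) k + (Pi.single l 1 : Fin r → ℂ) k) = 0 := by
  refine eq_zero_of_im fun z => ?_
  have h0 := hpl.secondDeriv_eq hω base_mem (vec Complex.I (.inl k)) (vec 1 (.inl l))
    (vec z (.inr i)) (vec 1 (.inr j))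
  simp only [h.secondDeriv_eq_zero_left (im_vec_real _), h.secondDeriv_eq_zero_left (im_vec_inr _ _),
    J_vec, h.secondDeriv_eq_zero_right (im_vec_inr _ _), mul_one, h.secondDeriv_vec] at h0
  simp only [map_one, mul_one] at h0
  rw [← mul_assoc, ← mul_assoc, mul_comm z]
  linarith

/-- Now three vectors are z-directions, two of them real, and the two surviving terms are exchanged
by swapping l and m, with opposite signs. -/
theorem HasMatrix.pluriclosed_inr_inl (h : HasMatrix b c C ω) (i : Fin s) (k l m : Fin r) :
    C (.inr i) (.inl m) * biweight b c (.inr i) (.inl m) l *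
      (biweight b c (.inr i) (.inl m) k + (Pi.single l 1 : Fin r → ℂ) k) =
    C (.inr i) (.inl l) * biweight b c (.inr i) (.inl l) m *
      (biweight b c (.inr i) (.inl l) k + (Pi.single m 1 : Fin r → ℂ) k) := by
  rw [← sub_eq_zero]
  refine eq_zero_of_im fun z => ?_
  have h0 := hpl.secondDeriv_eq hω base_mem (vec Complex.I (.inl k)) (vec 1 (.inl l))
    (vec z (.inr i)) (vec 1 (.inl m))
  rw [secondDeriv_swap _ _ _ _ (vec z (.inr i)) (vec 1 (.inl l))] at h0
  simp only [h.secondDeriv_eq_zero_left (im_vec_real _), h.secondDeriv_eq_zero_left (im_vec_inr _ _),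
    J_vec, h.secondDeriv_eq_zero_right (im_vec_inr _ _), mul_one, h.secondDeriv_vec] at h0
  simp only [map_one, mul_one] at h0
  rw [mul_sub, Complex.sub_im, ← mul_assoc, ← mul_assoc, mul_comm z, ← mul_assoc, ← mul_assoc,
    mul_comm z]
  linarith

/-- The surviving terms are the mixed y_k, y_m derivatives of a multiple of 1/(y_k y_m), the same in
both orders. Here only the real part is controlled; imaginary off-diagonal entries are excluded
later by the soliton equation. -/
theorem HasMatrix.pluriclosed_inl_inl (h : HasMatrix b c C ω) {k m : Fin r} (hkm : k ≠ m) :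
    (C (.inl k) (.inl m)).re = 0 := by
  have h0 := hpl.secondDeriv_eq hω base_mem (vec Complex.I (.inl k)) (vec 1 (.inl k))
    (vec Complex.I (.inl m)) (vec 1 (.inl m))
  have hI : ∀ a l, ((vec (r := r) (s := s) (Complex.I * Complex.I) a).1 l).im = 0 := fun a l => by
    rw [vec_fst, Pi.single_apply]; split <;> simp
  simp only [h.secondDeriv_eq_zero_left (im_vec_real _), J_vec,
    h.secondDeriv_eq_zero_right (hI _), mul_one, h.secondDeriv_vec] at h0
  simp [biweight, weight, hkm, hkm.symm] at h0
  linarith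

end

end

end OeljeklausToma

namespace OeljeklausToma

noncomputable section

open ComplexConjugate
open scoped ComplexOrder

/-! ### The exponents of an Oeljeklaus-Toma manifold with a pluriclosed metric -/

/-- Embeddings `φ`, `ψ` of a number field can be moved by an embedding of `\bar ℚ`. -/
theorem exists_embedding_transport {K : Type*} [Field K] [NumberField K] (t t' ρ : K →+* ℂ) :
    ∃ ρ' : K →+* ℂ, ∀ x, t x * t' x = 1 → ρ x * ρ' x = 1 := by
  have hint : ∀ (f : K →+* ℂ) (x : K), f x ∈ algebraicClosure ℚ ℂ := fun f x =>
    (Algebra.IsIntegral.isIntegral (R := ℚ) x).map f.toRatAlgHom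
  let lft : (K →+* ℂ) → (K →+* algebraicClosure ℚ ℂ) := fun f => f.codRestrict _ (hint f)
  let _ : Algebra K (algebraicClosure ℚ ℂ) := (lft t).toAlgebra
  let _ : Algebra K ℂ := ρ.toAlgebra
  have : IsScalarTower ℚ K (algebraicClosure ℚ ℂ) := IsScalarTower.of_algebraMap_eq' (Subsingleton.elim _ _)
  have : Algebra.IsAlgebraic ℚ (algebraicClosure ℚ ℂ) := algebraicClosure.isAlgebraic ℚ ℂ
  have : Algebra.IsAlgebraic K (algebraicClosure ℚ ℂ) :=
    Algebra.IsAlgebraic.tower_top (K := ℚ) K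
  -- With the algebraic closure made a K-algebra by `t` and ℂ by `ρ`, a K-algebra map g satisfies g
  -- ∘ t = ρ. It sends the relation t x · t' x = 1 to ρ x · ρ' x = 1 with ρ' = g ∘ t'.
  let g : algebraicClosure ℚ ℂ →ₐ[K] ℂ := IsAlgClosed.lift
  refine ⟨(g : algebraicClosure ℚ ℂ →+* ℂ).comp (lft t'), fun x hx => ?_⟩
  have h1 : ρ x = g (lft t x) := (g.commutes x).symm
  have h2 : lft t x * lft t' x = 1 := Subtype.ext hx
  rw [h1]
  change g (lft t x) * g (lft t' x) = 1
  rw [← map_mul, h2, map_one]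

variable {K : Type*} [Field K] [NumberField K] {r s : ℕ} (X : OTData K r s)
  {b c : Fin r → Fin s → ℝ}

namespace OTData

/-- The logarithm vectors span ℝ^r, so a functional vanishing on them is zero. This converts every
multiplicative relation on U into an identity between exponents. -/
theorem log_functional_eq_zero (f : Fin r → ℝ)
    (h : ∀ u ∈ X.U, ∑ k, f k * Real.log (X.σ k ((u : 𝓞 K) : K)) = 0) : f = 0 := by
  let L : (Fin r → ℝ) →ₗ[ℝ] ℝ := ∑ k, f k • LinearMap.proj k
  have hL : ∀ x, L x = ∑ k, f k * x k := fun x => by simp [L]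
  have h1 : Submodule.span ℝ
      ({x | ∃ u ∈ X.U, x = fun k => Real.log (X.σ k ((u : 𝓞 K) : K))} : Set (Fin r → ℝ)) ≤
      LinearMap.ker L := by
    rw [Submodule.span_le]
    rintro x ⟨u, hu, rfl⟩
    simpa [hL] using h u hu
  rw [X.log_span] at h1
  funext k
  have h2 : L (Pi.single k 1) = 0 := h1 (Submodule.mem_top)
  simpa [hL, Pi.single_apply] using h2

theorem log_norm_tau (hbc : X.IsExponents b c) {u : (𝓞 K)ˣ} (hu : u ∈ X.U) (i : Fin s) :
    Real.log ‖X.τ i ((u : 𝓞 K) : K)‖ =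
      ∑ k, b k i / 2 * Real.log (X.σ k ((u : 𝓞 K) : K)) := by
  have hpos := X.totally_positive u hu
  rw [hbc u hu i, chi, norm_mul, mul_comm Complex.I, Complex.norm_exp_ofReal_mul_I, mul_one,
    Complex.norm_real, Real.norm_of_nonneg (Finset.prod_nonneg fun k _ =>
      Real.rpow_nonneg (hpos k).le _), Real.log_prod fun k _ => (Real.rpow_pos_of_pos (hpos k) _).ne']
  exact Finset.sum_congr rfl fun k _ => Real.log_rpow (hpos k) _

/-- The norm of a unit has absolute value 1 and is the product of all embeddings; each complex one
counts twice because conjugation preserves absolute values. -/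
theorem sum_log_embeddings (u : (𝓞 K)ˣ) (hu : u ∈ X.U) :
    (∑ k, Real.log (X.σ k ((u : 𝓞 K) : K))) + 2 * ∑ i, Real.log ‖X.τ i ((u : 𝓞 K) : K)‖ = 0 := by
  classical
  set x : K := ((u : 𝓞 K) : K)
  have hx : x ≠ 0 := by simp [x]
  have h1 : ∏ φ : K →+* ℂ, ‖φ x‖ = 1 := by
    have h2 := congr_arg (‖·‖) (Algebra.norm_eq_prod_embeddings ℚ ℂ x)
    rw [norm_prod, ← Fintype.prod_equiv (RingHom.equivRatAlgHom K ℂ) (fun f => ‖f x‖)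
      (fun φ => ‖φ x‖) fun _ => by simp [RingHom.equivRatAlgHom_apply]] at h2
    rw [← h2]
    have h3 : |Algebra.norm ℚ x| = 1 := NumberField.Units.norm K u
    rw [eq_ratCast, ← Complex.ofReal_ratCast, Complex.norm_real, Real.norm_eq_abs, ← Rat.cast_abs,
      h3, Rat.cast_one]
  have h4 := Fintype.prod_bijective _ X.embeddings_bijective
    (fun a => ‖(Sum.elim (fun k => Complex.ofRealHom.comp (X.σ k))
      (Sum.elim X.τ (fun i => (starRingEnd ℂ).comp (X.τ i))) :
        Fin r ⊕ (Fin s ⊕ Fin s) → (K →+* ℂ)) a x‖) (fun φ => ‖φ x‖) fun _ => rfl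
  rw [h1, Fintype.prod_sum_type, Fintype.prod_sum_type] at h4
  simp only [Sum.elim_inl, Sum.elim_inr] at h4
  have hσ : ∀ k, ‖(Complex.ofRealHom.comp (X.σ k)) x‖ = X.σ k x := fun k => by
    change ‖((X.σ k x : ℝ) : ℂ)‖ = _
    rw [Complex.norm_real, Real.norm_of_nonneg (X.totally_positive u hu k).le]
  have hτ : ∀ i, ‖((starRingEnd ℂ).comp (X.τ i)) x‖ = ‖X.τ i x‖ := fun i => Complex.norm_conj _
  have hτ0 : ∀ i, ‖X.τ i x‖ ≠ 0 := fun i => by simpa using hx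
  have hσ0 : ∀ i, X.σ i x ≠ 0 := fun i => (X.totally_positive u hu i).ne'
  simp only [hσ, hτ] at h4
  have h5 := congrArg Real.log h4
  rw [Real.log_one, Real.log_mul (Finset.prod_ne_zero_iff.2 fun k _ => hσ0 k) (mul_ne_zero
    (Finset.prod_ne_zero_iff.2 fun k _ => hτ0 k) (Finset.prod_ne_zero_iff.2 fun k _ => hτ0 k)),
    Real.log_mul (Finset.prod_ne_zero_iff.2 fun k _ => hτ0 k)
      (Finset.prod_ne_zero_iff.2 fun k _ => hτ0 k), Real.log_prod fun k _ => hσ0 k,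
    Real.log_prod fun k _ => hτ0 k] at h5
  linarith

theorem sum_exponents (hbc : X.IsExponents b c) (k : Fin r) : ∑ i, b k i = -1 := by
  have h := X.log_functional_eq_zero (fun k => 1 + ∑ i, b k i) fun u hu => by
    rw [← X.sum_log_embeddings u hu]
    simp only [X.log_norm_tau hbc hu, add_mul, one_mul, Finset.sum_add_distrib, Finset.sum_mul,
      Finset.mul_sum]
    congr 1
    rw [Finset.sum_comm]
    exact Finset.sum_congr rfl fun _ _ => Finset.sum_congr rfl fun _ _ => by ring
  have := congrFun h k
  simp only [Pi.zero_apply] at this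
  linarith

/-- If column i vanished, then τ_i · conj τ_i = 1 on U, and transport yields an embedding ρ with σ_o
ρ = 1 on U. If ρ is real, comparing exponents of σ_o gives 1 + (0 or 1) = 0; if ρ is some τ_j or its
conjugate, it gives b_oj = -2, which is the excluded value. -/
theorem exists_exponent_ne_zero (hbc : X.IsExponents b c) (hb : ∀ k i, b k i ≠ -2) (i : Fin s) :
    ∃ k, b k i ≠ 0 := by
  by_contra! h
  set o : Fin r := ⟨0, X.one_le_r⟩
  obtain ⟨ρ, hρ⟩ := exists_embedding_transport (X.τ i) ((starRingEnd ℂ).comp (X.τ i))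
    (Complex.ofRealHom.comp (X.σ o))
  have h1 : ∀ u ∈ X.U, Real.log (X.σ o ((u : 𝓞 K) : K)) +
      Real.log ‖ρ ((u : 𝓞 K) : K)‖ = 0 := by
    intro u hu
    have hn : ‖X.τ i ((u : 𝓞 K) : K)‖ = 1 := by
      have := X.log_norm_tau hbc hu i
      simp only [h, zero_div, zero_mul, Finset.sum_const_zero] at this
      have h0 : 0 < ‖X.τ i ((u : 𝓞 K) : K)‖ := by simp
      exact Real.eq_one_of_pos_of_log_eq_zero h0 this
    have h2 := hρ ((u : 𝓞 K) : K) (by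
      change X.τ i _ * conj (X.τ i _) = 1
      rw [Complex.mul_conj, Complex.normSq_eq_norm_sq, hn]; simp)
    have hpos := X.totally_positive u hu o
    have h3 := congrArg (fun z => Real.log ‖z‖) h2
    change Real.log ‖((X.σ o ((u : 𝓞 K) : K) : ℝ) : ℂ) * _‖ = _ at h3
    rw [norm_mul, Complex.norm_real, Real.norm_of_nonneg hpos.le, Real.log_mul hpos.ne' (by simp)]
      at h3
    simpa using h3
  have hτ : ∀ j, (∀ u ∈ X.U, ‖ρ ((u : 𝓞 K) : K)‖ = ‖X.τ j ((u : 𝓞 K) : K)‖) → False := by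
    intro j hj
    have h4 := X.log_functional_eq_zero (fun k => (if k = o then 1 else 0) + b k j / 2)
      fun u hu => by
        have := h1 u hu
        rw [hj u hu, X.log_norm_tau hbc hu] at this
        simp only [add_mul, Finset.sum_add_distrib]
        simpa using this
    have h5 := congrFun h4 o
    simp only [if_true, Pi.zero_apply] at h5
    exact hb o j (by linarith)
  obtain ⟨a, ha⟩ := X.embeddings_bijective.2 ρ
  rcases a with k | j | j
  · have h4 := X.log_functional_eq_zero
      (fun l => (if l = o then 1 else 0) + (if l = k then 1 else 0)) fun u hu => by
        have := h1 u hu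
        rw [← ha] at this
        change _ + Real.log ‖((X.σ k ((u : 𝓞 K) : K) : ℝ) : ℂ)‖ = 0 at this
        rw [Complex.norm_real, Real.norm_of_nonneg (X.totally_positive u hu k).le] at this
        simp only [add_mul, Finset.sum_add_distrib]
        simpa using this
    have h5 := congrFun h4 o
    simp only [if_true, Pi.zero_apply] at h5
    split_ifs at h5 <;> norm_num at h5
  · exact hτ j fun u _ => by rw [← ha]; rfl
  · exact hτ j fun u _ => by rw [← ha]; exact Complex.norm_conj _

/-- If the manifold carries a left-invariant pluriclosed metric, then `r = s` and, up to a
permutation of the complex embeddings, `σ_k(u) |τ_k(u)|² = 1` on `U`. -/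
theorem exists_equiv_of_quadratic (hbc : X.IsExponents b c)
    (hq : ∀ i k l, b l i * (b k i + if k = l then 1 else 0) = 0) :
    ∃ e : Fin s ≃ Fin r, ∀ k i, b k i = if k = e i then -1 else 0 := by
  have hval : ∀ k i, b k i = 0 ∨ b k i = -1 := fun k i => by
    have := hq i k k
    rw [if_pos rfl] at this
    rcases mul_eq_zero.1 this with h | h
    · exact Or.inl h
    · exact Or.inr (by linarith)
  have hcol : ∀ k l i, b k i ≠ 0 → k ≠ l → b l i = 0 := fun k l i hk hkl => by
    have := hq i l k
    rw [if_neg hkl.symm, add_zero] at this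
    exact (mul_eq_zero.1 this).resolve_left hk
  have hex := X.exists_exponent_ne_zero hbc fun k i h => by
    rcases hval k i with h' | h' <;> rw [h] at h' <;> norm_num at h'
  choose f hf using hex
  have hsum := X.sum_exponents hbc
  -- All entries are nonpositive, so two entries -1 in one row would push the row sum down to -2,
  -- whereas it is -1.
  have hinj : Function.Injective f := by
    intro i j hij
    by_contra hne
    have h1 : b (f i) i = -1 := (hval _ _).resolve_left (hf i)
    have h2 : b (f i) j = -1 := by rw [hij]; exact (hval _ _).resolve_left (hf j)
    have h3 : ∑ l, b (f i) l ≤ ∑ l ∈ {i, j}, b (f i) l :=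
      Finset.sum_le_sum_of_subset_of_nonpos' (Finset.subset_univ _) fun l _ _ => by
        rcases hval (f i) l with h | h <;> rw [h] <;> norm_num
    rw [hsum, Finset.sum_pair hne, h1, h2] at h3
    norm_num at h3
  have hsurj : Function.Surjective f := by
    intro k
    by_contra! hk
    have : ∑ i, b k i = 0 := Finset.sum_eq_zero fun i _ => hcol (f i) k i (hf i) (hk i)
    rw [hsum] at this
    norm_num at this
  refine ⟨Equiv.ofBijective f ⟨hinj, hsurj⟩, fun k i => ?_⟩
  change b k i = if k = f i then -1 else 0
  split_ifs with h
  · rw [h]; exact (hval _ _).resolve_left (hf i)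
  · exact hcol (f i) k i (hf i) (Ne.symm h)

end OTData

end

end OeljeklausToma

namespace OeljeklausToma

noncomputable section

open ComplexConjugate
open scoped ComplexOrder

/-! ### The Bismut connection of a left-invariant metric -/

section Algebra

variable {r : ℕ} {ι : Type*} [Fintype ι]

/-- The matrix of `-y_k ∂/∂y_k` applied to the metric. -/
def weighted (μ : ι → ℂ) (C : Matrix ι ι ℂ) : Matrix ι ι ℂ :=
  fun a d => (μ a + conj (μ d)) * C a d

theorem weighted_isHermitian {ι : Type*} (μ : ι → ℂ) {C : Matrix ι ι ℂ} (hC : C.IsHermitian) :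
    (weighted μ C).IsHermitian := Matrix.IsHermitian.ext fun a d => by
  have h : conj (C d a) = C a d := hC.apply a d
  change conj ((μ d + conj (μ a)) * C d a) = (μ a + conj (μ d)) * C a d
  rw [map_mul, map_add, Complex.conj_conj, h, add_comm]

/-- The Bismut connection of an invariant Hermitian metric is determined by the metric. -/
theorem bismut_formula {C : Matrix ι ι ℂ} (hC : C.IsHermitian) (D : Fin r → Matrix ι ι ℂ)
    (hD : ∀ k, (D k).IsHermitian) (p : Fin r → ι)
    (β : (ι → ℂ) → (ι → ℂ) → (ι → ℂ))
    (hI : ∀ x y, β x (Complex.I • y) = Complex.I • β x y)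
    (hmetric : ∀ x y z, (-∑ k, ((x (p k)).im : ℂ) * hermForm (D k) y z).re =
      (hermForm C (β x y) z + hermForm C y (β x z)).re)
    (htorsion : ∀ x y z, (hermForm C (β x y - β y x) z).re =
      -(hermForm C (β x z - β z x) y).re) (x y z : ι → ℂ) :
    2 * hermForm C (β x y) z = Complex.I * ∑ k, (y (p k) * hermForm (D k) x z -
      conj (x (p k)) * hermForm (D k) y z + conj (z (p k)) * hermForm (D k) y x) := by
  set B : (ι → ℂ) → (ι → ℂ) → (ι → ℂ) → ℂ := fun x y z => hermForm C (β x y) z with hB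
  set F : (ι → ℂ) → (ι → ℂ) → (ι → ℂ) → ℂ := fun x y z =>
    -∑ k, ((x (p k)).im : ℂ) * hermForm (D k) y z with hF
  have I3 : Complex.I ^ 3 = -Complex.I := by rw [pow_succ, Complex.I_sq]; ring
  have B2 : ∀ x y z, B x (Complex.I • y) z = Complex.I * B x y z := fun x y z => by
    simp only [hB, hI, hermForm_smul_left]
  have B3 : ∀ x y z, B x y (Complex.I • z) = -(Complex.I * B x y z) := fun x y z => by
    simp only [hB, hermForm_smul_right, Complex.conj_I]; ring
  have F2 : ∀ x y z, F x (Complex.I • y) z = Complex.I * F x y z := fun x y z => by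
    simp only [hF, hermForm_smul_left, mul_neg, Finset.mul_sum]
    congr 1
    exact Finset.sum_congr rfl fun _ _ => by ring
  have Fc : ∀ x y z, conj (F x y z) = F x z y := fun x y z => by
    simp only [hF, map_neg, map_sum, map_mul, conj_hermForm (hD _), Complex.conj_ofReal]
  have m0 : ∀ x y z, (F x y z).re = (B x y z + conj (B x z y)).re := fun x y z => by
    rw [hmetric x y z]
    simp only [hB, conj_hermForm hC]
  have m1 : ∀ x y z, F x y z = B x y z + conj (B x z y) := fun x y z => by
    -- The real part is metric compatibility itself; the imaginary part is the same condition with y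
    -- replaced by i y.
    apply Complex.ext (m0 x y z)
    have h := m0 x (Complex.I • y) z
    rw [F2, B2, B3] at h
    simp at h ⊢
    linarith
  have t0 : ∀ x y z, B x y z + conj (B x y z) - B y x z - conj (B y x z) + B x z y
      + conj (B x z y) - B z x y - conj (B z x y) = 0 := fun x y z => by
    have h := htorsion x y z
    simp only [hermForm_sub_left, Complex.sub_re] at h
    have e : ∀ w : ℂ, w + conj w = ((2 * w.re : ℝ) : ℂ) := fun w => Complex.add_conj w
    have h2 : (B x y z + conj (B x y z)) - (B y x z + conj (B y x z)) + (B x z y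
      + conj (B x z y)) - (B z x y + conj (B z x y)) = 0 := by
      rw [e, e, e, e]
      norm_cast
      simp only [hB]
      linarith
    linear_combination h2
  -- The eight instances of `t0` are combined by the projector onto the part complex linear in x and
  -- y and antilinear in z. After `m1` this determines the part of the connection that is complex
  -- linear in the direction of differentiation.
  have t1 : ∀ x y z, B y x z - Complex.I * B (Complex.I • y) x z =
      F x y z - Complex.I * F (Complex.I • x) y z := fun x y z => by
    have h1 := t0 x y z
    have h2 := t0 (Complex.I • x) y z
    have h3 := t0 x (Complex.I • y) z
    have h4 := t0 x y (Complex.I • z)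
    have h5 := t0 (Complex.I • x) (Complex.I • y) z
    have h6 := t0 (Complex.I • x) y (Complex.I • z)
    have h7 := t0 x (Complex.I • y) (Complex.I • z)
    have h8 := t0 (Complex.I • x) (Complex.I • y) (Complex.I • z)
    simp only [B2, B3, map_mul, map_neg, Complex.conj_I] at h2 h3 h4 h5 h6 h7 h8
    simp only [m1]
    linear_combination (norm := skip) (-1 / 4) * (h1 - Complex.I * h2 - Complex.I * h3
      + Complex.I * h4 - h5 + h6 + h7 - Complex.I * h8)
    ring_nf
    simp only [Complex.I_sq, I3]
    ring_nf
  -- Conjugating `t1` and using metric compatibility determines the antilinear part. The two parts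
  -- add up to twice the connection.
  have t2 : ∀ x y z, B x y z + Complex.I * B (Complex.I • x) y z =
      F x y z + Complex.I * F (Complex.I • x) y z - F z y x
        - Complex.I * F (Complex.I • z) y x := fun x y z => by
    have h := congrArg conj (t1 z x y)
    simp only [map_sub, map_mul, Complex.conj_I, Fc] at h
    rw [m1 x y z, m1 (Complex.I • x) y z]
    linear_combination -h
  have h1 := t1 y x z
  have h2 := t2 x y z
  have e1 : ∀ x y z, F x y z - Complex.I * F (Complex.I • x) y z =
      Complex.I * ∑ k, x (p k) * hermForm (D k) y z := fun x y z => by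
    simp only [hF, Finset.mul_sum, ← Finset.sum_neg_distrib, ← Finset.sum_sub_distrib]
    refine Finset.sum_congr rfl fun k _ => ?_
    have ec := (Complex.re_add_im (x (p k))).symm
    simp
    linear_combination (-((x (p k)).im : ℂ) * hermForm (D k) y z) * Complex.I_sq -
      Complex.I * hermForm (D k) y z * ec
  have e2 : ∀ x y z, F x y z + Complex.I * F (Complex.I • x) y z =
      -Complex.I * ∑ k, conj (x (p k)) * hermForm (D k) y z := fun x y z => by
    simp only [hF, Finset.mul_sum, ← Finset.sum_neg_distrib, ← Finset.sum_add_distrib]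
    refine Finset.sum_congr rfl fun k _ => ?_
    have ec : conj (x (p k)) = (x (p k)).re - (x (p k)).im * Complex.I := by
      apply Complex.ext <;> simp
    rw [ec]
    simp
    linear_combination (-((x (p k)).im : ℂ) * hermForm (D k) y z) * Complex.I_sq
  simp only [Finset.sum_add_distrib, Finset.sum_sub_distrib]
  linear_combination h1 + h2 + e1 y x z + e2 x y z - e2 z y x

/-- The coefficients of the trace of the Bismut connection. -/
def traceCoeff (μ : Fin r → ι → ℂ) (p : Fin r → ι) [DecidableEq ι] (C : Matrix ι ι ℂ) (a : ι) : ℂ :=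
  Complex.I / 2 * ∑ k, ∑ d, weighted (μ k) C a d * C⁻¹ d (p k)

variable [DecidableEq ι]

/-- Contracting the three terms of the connection formula with C⁻¹, the first and third give T and
-conj T, where T is the functional with coefficients `traceCoeff`, so they double the imaginary
part. The middle one gives the trace of the weighted matrix against C⁻¹, which `hμ` fixes to be 1
whatever C is. -/
theorem bismut_trace {C : Matrix ι ι ℂ} (hC : C.PosDef) (μ : Fin r → ι → ℂ) (p : Fin r → ι)
    (hμ : ∀ k, ∑ a, (μ k a + conj (μ k a)) = 1)
    (β : (ι → ℂ) → (ι → ℂ) → (ι → ℂ))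
    (hβ : ∀ x y z, 2 * hermForm C (β x y) z = Complex.I * ∑ k,
      (y (p k) * hermForm (weighted (μ k) C) x z - conj (x (p k)) * hermForm (weighted (μ k) C) y z
        + conj (z (p k)) * hermForm (weighted (μ k) C) y x)) (x : ι → ℂ) :
    (∑ a, β x (Pi.single a 1) a).im =
      2 * (∑ a, traceCoeff μ p C a * x a).im - (∑ k, (x (p k)).re) / 2 := by
  have hdet : IsUnit C.det := (Matrix.isUnit_iff_isUnit_det C).1 hC.isUnit
  have hinv : C * C⁻¹ = 1 := Matrix.mul_nonsing_inv C hdet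
  have hCi : C⁻¹.IsHermitian := hC.isHermitian.inv
  have hv : ∀ v : ι → ℂ, ∀ a, ∑ d, hermForm C v (Pi.single d 1) * C⁻¹ d a = v a := fun v a => by
    simp only [hermForm_single_right, Finset.sum_mul]
    rw [Finset.sum_comm]
    have : ∀ e, ∑ d, v e * C e d * C⁻¹ d a = v e * (1 : Matrix ι ι ℂ) e a := fun e => by
      rw [← hinv, Matrix.mul_apply, Finset.mul_sum]
      exact Finset.sum_congr rfl fun _ _ => by ring
    simp only [this]
    rw [Finset.sum_eq_single a] <;> simp +contextual
  have h1 : ∑ a, β x (Pi.single a 1) a =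
      ∑ a, ∑ d, hermForm C (β x (Pi.single a 1)) (Pi.single d 1) * C⁻¹ d a :=
    Finset.sum_congr rfl fun a _ => (hv _ a).symm
  have hT : ∑ a, traceCoeff μ p C a * x a =
      Complex.I / 2 * ∑ k, ∑ d, hermForm (weighted (μ k) C) x (Pi.single d 1) * C⁻¹ d (p k) := by
    simp only [traceCoeff, hermForm_single_right, Finset.mul_sum, Finset.sum_mul]
    rw [Finset.sum_comm]
    refine Finset.sum_congr rfl fun k _ => ?_
    rw [Finset.sum_comm]
    exact Finset.sum_congr rfl fun _ _ => Finset.sum_congr rfl fun _ _ => by ring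
  have hTc : conj (∑ a, traceCoeff μ p C a * x a) =
      -(Complex.I / 2) * ∑ k, ∑ d, hermForm (weighted (μ k) C) (Pi.single d 1) x * C⁻¹ (p k) d := by
    rw [hT, map_mul, map_sum]
    have : conj (Complex.I / 2) = -(Complex.I / 2) := by simp [map_ofNat]; ring
    rw [this]
    congr 1
    refine Finset.sum_congr rfl fun k _ => ?_
    rw [map_sum]
    refine Finset.sum_congr rfl fun d _ => ?_
    rw [map_mul, conj_hermForm (weighted_isHermitian _ hC.isHermitian)]
    congr 1
    exact hCi.apply _ _
  have hM : ∀ k, ∑ a, ∑ d, weighted (μ k) C a d * C⁻¹ d a = 1 := fun k => by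
    simp only [weighted, add_mul, Finset.sum_add_distrib]
    have e1 : ∑ a, ∑ d, μ k a * C a d * C⁻¹ d a = ∑ a, μ k a := by
      refine Finset.sum_congr rfl fun a _ => ?_
      simp only [mul_assoc, ← Finset.mul_sum]
      rw [← Matrix.mul_apply, hinv]; simp
    have e2 : ∑ a, ∑ d, conj (μ k d) * C a d * C⁻¹ d a = ∑ a, conj (μ k a) := by
      rw [Finset.sum_comm]
      refine Finset.sum_congr rfl fun a _ => ?_
      have : ∀ d, conj (μ k a) * C d a * C⁻¹ a d = conj (μ k a) * (C⁻¹ a d * C d a) :=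
        fun d => by ring
      simp only [this, ← Finset.mul_sum]
      rw [← Matrix.mul_apply, Matrix.nonsing_inv_mul C hdet]; simp
    rw [e1, e2, ← Finset.sum_add_distrib, hμ]
  have key : ∑ a, β x (Pi.single a 1) a = (∑ a, traceCoeff μ p C a * x a) -
      Complex.I / 2 * ∑ k, conj (x (p k)) - conj (∑ a, traceCoeff μ p C a * x a) := by
    have e0 : ∀ a d, hermForm C (β x (Pi.single a 1)) (Pi.single d 1) * C⁻¹ d a =
        Complex.I / 2 * ∑ k, ((Pi.single a 1 : ι → ℂ) (p k) *
          (hermForm (weighted (μ k) C) x (Pi.single d 1) * C⁻¹ d a) -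
          conj (x (p k)) * (weighted (μ k) C a d * C⁻¹ d a) +
          (Pi.single d 1 : ι → ℂ) (p k) *
            (hermForm (weighted (μ k) C) (Pi.single a 1) x * C⁻¹ d a)) := fun a d => by
      have h := hβ x (Pi.single a 1) (Pi.single d 1)
      have hs : ∀ k, conj ((Pi.single d 1 : ι → ℂ) (p k)) = (Pi.single d 1 : ι → ℂ) (p k) :=
        fun k => by rw [Pi.single_apply]; split <;> simp
      simp only [hermForm_single, hs] at h
      have h3 : hermForm C (β x (Pi.single a 1)) (Pi.single d 1) = Complex.I / 2 * ∑ k,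
          ((Pi.single a 1 : ι → ℂ) (p k) * hermForm (weighted (μ k) C) x (Pi.single d 1) -
          conj (x (p k)) * weighted (μ k) C a d +
          (Pi.single d 1 : ι → ℂ) (p k) * hermForm (weighted (μ k) C) (Pi.single a 1) x) := by
        linear_combination h / 2
      rw [h3, mul_assoc, Finset.sum_mul]
      congr 1
      exact Finset.sum_congr rfl fun k _ => by ring
    rw [h1, hTc, hT]
    simp only [e0, ← Finset.mul_sum]
    rw [neg_mul, sub_neg_eq_add, ← mul_sub, ← mul_add]
    congr 1
    have sw : ∀ f : ι → ι → Fin r → ℂ, ∑ a, ∑ d, ∑ k, f a d k = ∑ k, ∑ a, ∑ d, f a d k :=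
      fun f => by
        rw [Finset.sum_comm' (s := Finset.univ) (t := fun _ => Finset.univ)
          (t' := Finset.univ) (s' := fun _ => Finset.univ) (by simp)]
        have : ∀ d, ∑ a, ∑ k, f a d k = ∑ k, ∑ a, f a d k := fun d => Finset.sum_comm
        simp only [this]
        rw [Finset.sum_comm]
        exact Finset.sum_congr rfl fun k _ => Finset.sum_comm
    rw [sw, ← Finset.sum_sub_distrib, ← Finset.sum_add_distrib]
    refine Finset.sum_congr rfl fun k _ => ?_
    simp only [Finset.sum_add_distrib, Finset.sum_sub_distrib]
    congr 1
    · congr 1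
      · rw [Finset.sum_eq_single (p k)]
        · simp
        · intro a _ ha
          simp [ha.symm]
        · simp
      · simp only [← Finset.mul_sum, hM, mul_one]
    · refine Finset.sum_congr rfl fun a _ => ?_
      rw [Finset.sum_eq_single (p k)]
      · simp
      · intro d _ hd
        simp [hd.symm]
      · simp
  rw [key]
  simp only [Complex.sub_im, Complex.conj_im]
  have : (Complex.I / 2 * ∑ k, conj (x (p k))).im = (∑ k, (x (p k)).re) / 2 := by
    rw [← map_sum, Complex.mul_im]
    simp
    ring
  rw [this]
  ring

end Algebra

end

end OeljeklausToma

namespace OeljeklausToma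

noncomputable section

open ComplexConjugate
open scoped ComplexOrder

variable {r s : ℕ} {b c : Fin r → Fin s → ℝ}

/-! ### Traces of endomorphisms commuting with `J` -/

theorem trace_eq_sum (f : Ambient r s →ₗ[ℝ] Ambient r s) :
    LinearMap.trace ℝ (Ambient r s) f =
      ∑ a, ((coord a (f (vec 1 a))).re + (coord a (f (vec Complex.I a))).im) := by
  let re' : Fin r ⊕ Fin s → (Ambient r s →ₗ[ℝ] ℝ) := fun a =>
    ↑(Complex.reCLM.comp ((coord a).restrictScalars ℝ) : Ambient r s →L[ℝ] ℝ)
  let im' : Fin r ⊕ Fin s → (Ambient r s →ₗ[ℝ] ℝ) := fun a =>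
    ↑(Complex.imCLM.comp ((coord a).restrictScalars ℝ) : Ambient r s →L[ℝ] ℝ)
  have h : f = ∑ a, ((re' a).smulRight (f (vec 1 a)) + (im' a).smulRight (f (vec Complex.I a))) := by
    refine LinearMap.ext fun u => ?_
    have hu : u = ∑ a, ((re' a u) • vec 1 a + (im' a u) • vec Complex.I a) := by
      apply ext_coord
      intro d
      rw [map_sum, Finset.sum_eq_single d]
      · have : ∀ (t : ℝ) (v : Ambient r s), coord d (t • v) = t * coord d v := fun t v =>
          ((coord d).restrictScalars ℝ).map_smul t v
        rw [map_add, this, this, coord_vec, coord_vec, Pi.single_eq_same, Pi.single_eq_same, mul_one]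
        exact (Complex.re_add_im _).symm
      · intro a _ ha
        have : ∀ (t : ℝ) (v : Ambient r s), coord d (t • v) = t * coord d v := fun t v =>
          ((coord d).restrictScalars ℝ).map_smul t v
        rw [map_add, this, this, coord_vec, coord_vec, Pi.single_eq_of_ne ha.symm,
          Pi.single_eq_of_ne ha.symm]
        simp
      · simp
    conv_lhs => rw [hu]
    simp [map_sum, map_add, map_smul]
  conv_lhs => rw [h]
  simp only [map_sum, map_add, LinearMap.trace_smulRight]
  rfl

theorem trace_J_comp (A : Ambient r s →L[ℝ] Ambient r s)
    (hA : ∀ v, A (J r s v) = J r s (A v)) :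
    LinearMap.trace ℝ (Ambient r s) ((J r s).comp A : Ambient r s →ₗ[ℝ] Ambient r s) =
      -2 * (∑ a, coord a (A (vec 1 a))).im := by
  rw [trace_eq_sum, Complex.im_sum, Finset.mul_sum]
  refine Finset.sum_congr rfl fun a _ => ?_
  have h1 : vec Complex.I a = J r s (vec 1 a) := by rw [J_vec, mul_one]
  change (coord a (J r s (A (vec 1 a)))).re + (coord a (J r s (A (vec Complex.I a)))).im = _
  rw [h1, hA, J_J, map_neg, J_apply, map_smul]
  simp
  ring

/-- Cyclicity of the trace, with J moved past B. It removes the quadratic terms of the curvature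
from the Ricci form. -/
theorem trace_J_commutator (A B : Ambient r s →L[ℝ] Ambient r s)
    (hB : ∀ v, B (J r s v) = J r s (B v)) :
    LinearMap.trace ℝ (Ambient r s)
      ((J r s).comp (A.comp B) : Ambient r s →ₗ[ℝ] Ambient r s) =
    LinearMap.trace ℝ (Ambient r s)
      ((J r s).comp (B.comp A) : Ambient r s →ₗ[ℝ] Ambient r s) := by
  have h1 : ((J r s).comp (A.comp B) : Ambient r s →ₗ[ℝ] Ambient r s) =
      (((J r s).comp A : Ambient r s →L[ℝ] Ambient r s) : Ambient r s →ₗ[ℝ] Ambient r s) *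
        (B : Ambient r s →ₗ[ℝ] Ambient r s) := rfl
  have h2 : ((J r s).comp (B.comp A) : Ambient r s →ₗ[ℝ] Ambient r s) =
      (B : Ambient r s →ₗ[ℝ] Ambient r s) *
      (((J r s).comp A : Ambient r s →L[ℝ] Ambient r s) : Ambient r s →ₗ[ℝ] Ambient r s) := by
    refine LinearMap.ext fun v => ?_
    exact (hB (A v)).symm
  rw [h1, h2, LinearMap.trace_mul_comm]

/-- The functional `A ↦ tr (J A)`. -/
def traceJ (r s : ℕ) : (Ambient r s →L[ℝ] Ambient r s) →L[ℝ] ℝ :=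
  LinearMap.toContinuousLinearMap
    { toFun := fun A => LinearMap.trace ℝ (Ambient r s)
        ((J r s).comp A : Ambient r s →ₗ[ℝ] Ambient r s)
      map_add' := fun A B => by
        rw [← map_add, ContinuousLinearMap.comp_add]; rfl
      map_smul' := fun t A => by
        rw [RingHom.id_apply, ← map_smul, ContinuousLinearMap.comp_smul]; rfl }

theorem traceJ_apply (A : Ambient r s →L[ℝ] Ambient r s) :
    traceJ r s A = LinearMap.trace ℝ (Ambient r s)
      ((J r s).comp A : Ambient r s →ₗ[ℝ] Ambient r s) := rfl

/-- The commutator of Christoffel symbols is killed by the trace against J, so what remains is the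
exterior derivative of the 1-form v ↦ tr(J Γ(v)), up to the factor 1/2. -/
theorem ricciForm_eq {Γ : Christoffel r s} {p : Ambient r s}
    (hd : DifferentiableAt ℝ Γ p) (hJ : ∀ u v, Γ p u (J r s v) = J r s (Γ p u v)) (u v) :
    ricciForm Γ p u v = (1 / 2) * (fderiv ℝ (fun q => traceJ r s (Γ q v)) p u -
      fderiv ℝ (fun q => traceJ r s (Γ q u)) p v) := by
  have h1 : ∀ u v, fderiv ℝ (fun q => traceJ r s (Γ q v)) p u = traceJ r s (fderiv ℝ Γ p u v) := by
    intro u v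
    have h2 : HasFDerivAt (fun q => Γ q v) ((fderiv ℝ Γ p).flip v) p := by
      have := hd.hasFDerivAt.clm_apply (hasFDerivAt_const v p)
      simpa using this
    have h3 := (traceJ r s).hasFDerivAt.comp p h2
    rw [show (fun q => traceJ r s (Γ q v)) = ⇑(traceJ r s) ∘ fun q => Γ q v from rfl, h3.fderiv]
    rfl
  rw [h1, h1, ricciForm, ← traceJ_apply, curvature, map_sub, map_add, map_sub,
    traceJ_apply ((Γ p u).comp (Γ p v)), trace_J_commutator _ _ (hJ v), ← traceJ_apply]
  ring

/-! ### The Ricci form of the Bismut connection -/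

theorem frame_smul (q : Ambient r s) (z : ℂ) (x) : frame b c q (z • x) = z • frame b c q x := by
  apply ext_coord
  intro a
  simp [frame]
  ring

/-- The frame differs from the coordinate basis by a diagonal complex matrix, which cancels on
diagonal entries of complex linear maps. -/
theorem coord_frame_single (q : Ambient r s) (A : Ambient r s →L[ℝ] Ambient r s)
    (hA : ∀ v, A (J r s v) = J r s (A v)) (a : Fin r ⊕ Fin s) :
    hat b c q (A (frame b c q (Pi.single a 1))) a = coord a (A (vec 1 a)) := by
  have hsm : ∀ (z : ℂ) v, A (z • v) = z • A v := fun z v => by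
    have e : ∀ v : Ambient r s, z • v = z.re • v + z.im • J r s v := fun v => by
      conv_lhs => rw [← Complex.re_add_im z, add_smul, mul_smul]
      rfl
    rw [e, map_add, map_smul, map_smul, hA, ← e]
  have h1 : frame b c q (Pi.single a 1) = (powFactor (fun k => weight b c k a) q)⁻¹ • vec 1 a := by
    apply ext_coord
    intro d
    rw [frame, coord_ofCoord, map_smul, coord_vec, smul_eq_mul]
    by_cases h : d = a
    · subst h; rfl
    · simp [h]
  rw [h1, hsm, hat_smul, Pi.smul_apply, hat_apply, theta_apply, smul_eq_mul]
  exact inv_mul_cancel_left₀ (powFactor_ne_zero _ _) _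

section

variable {C : Matrix (Fin r ⊕ Fin s) (Fin r ⊕ Fin s) ℂ} {ω : Form r s 2}

theorem HasMatrix.fderiv_apply (h : HasMatrix b c C ω) {q : Ambient r s} (hq : q ∈ domain r s)
    (u v w : Ambient r s) :
    fderiv ℝ (fun q => ω q ![v, J r s w]) q u = 2 * (-∑ k, ((hat b c q u (.inl k)).im : ℂ) *
      hermForm (weighted (weight b c k) C) (hat b c q v) (hat b c q w)).re := by
  have e : (fun q' => ω q' ![v, J r s w]) =ᶠ[nhds q] fun q' =>
      2 * Complex.reCLM (∑ t : (Fin r ⊕ Fin s) × (Fin r ⊕ Fin s),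
        (C t.1 t.2 * coord t.1 v * conj (coord t.2 w)) * powFactor (biweight b c t.1 t.2) q') := by
    filter_upwards [isOpen_domain.mem_nhds hq] with q' hq'
    rw [h.apply_J hq', hermForm_hat, ← Finset.univ_product_univ, Finset.sum_product]
    rfl
  have h1 := HasFDerivAt.fun_sum (u := (Finset.univ : Finset ((Fin r ⊕ Fin s) × (Fin r ⊕ Fin s))))
    fun t _ => (hasFDerivAt_powFactor (biweight b c t.1 t.2) hq).const_mul
      (C t.1 t.2 * coord t.1 v * conj (coord t.2 w))
  have h3 := ((Complex.reCLM.hasFDerivAt.comp q h1).const_mul 2)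
  simp only [Function.comp_def] at h3
  rw [e.fderiv_eq, h3.fderiv]
  simp only [smul_apply, ContinuousLinearMap.comp_apply, Complex.reCLM_apply, smul_eq_mul]
  congr 2
  simp only [sum_apply, smul_apply, ← Finset.univ_product_univ, Finset.sum_product, neg_apply,
    ContinuousLinearMap.comp_apply, smul_eq_mul, hermForm, Finset.mul_sum]
  have sw : ∀ f : Fin r → Fin r ⊕ Fin s → Fin r ⊕ Fin s → ℂ,
      ∑ k, ∑ a, ∑ d, f k a d = ∑ a, ∑ d, ∑ k, f k a d := fun f => by
    rw [Finset.sum_comm]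
    exact Finset.sum_congr rfl fun a _ => Finset.sum_comm
  rw [sw, ← Finset.sum_neg_distrib]
  refine Finset.sum_congr rfl fun a _ => ?_
  rw [← Finset.sum_neg_distrib]
  refine Finset.sum_congr rfl fun d _ => ?_
  rw [mul_neg, Finset.mul_sum]
  congr 1
  refine Finset.sum_congr rfl fun k _ => ?_
  have hp : powFactor (biweight b c a d) q = powFactor (fun k => weight b c k a) q *
      conj (powFactor (fun k => weight b c k d) q) := by
    rw [conj_powFactor, ← powFactor_add]; rfl
  simp only [hat_apply, im_theta_inl b c k hq]
  simp only [theta_apply, weighted, Complex.ofRealCLM_apply, imCoord_apply, map_mul, hp, biweight]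
  ring

/-- Written in the left-invariant frame, any Bismut connection satisfies the hypotheses of
`bismut_formula` at each point, so its trace has constant coefficients in `theta`, determined by C.
No invariance of Γ is assumed. -/
theorem IsBismut.traceJ_eq (h : HasMatrix b c C ω) (hC : C.PosDef)
    (hw : ∀ k, ∑ a, (weight b c k a + conj (weight b c k a)) = 1) {Γ : Christoffel r s}
    (hΓ : IsBismut ω Γ) {q : Ambient r s} (hq : q ∈ domain r s) (v : Ambient r s) :
    traceJ r s (Γ q v) =
      -4 * (∑ a, traceCoeff (weight b c) Sum.inl C a * theta b c a q v).im +
        ∑ k, (theta b c (.inl k) q v).re := by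
  obtain ⟨hJ, hm, ht⟩ := hΓ.2 q hq
  set β : (Fin r ⊕ Fin s → ℂ) → (Fin r ⊕ Fin s → ℂ) → (Fin r ⊕ Fin s → ℂ) := fun x y =>
    hat b c q (Γ q (frame b c q x) (frame b c q y)) with hβ
  have key := bismut_trace hC (weight b c) Sum.inl hw β
    (bismut_formula hC.isHermitian (fun k => weighted (weight b c k) C)
      (fun k => weighted_isHermitian _ hC.isHermitian) Sum.inl β
      (fun x y => by simp only [hβ, frame_smul, ← J_apply, hJ, hat_J])
      (fun x y z => by
        have h1 := hm (frame b c q x) (frame b c q y) (frame b c q z)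
        rw [h.fderiv_apply hq, h.apply_J hq, h.apply_J hq] at h1
        simp only [hat_frame] at h1
        rw [Complex.add_re]
        linarith)
      (fun x y z => by
        have h1 := ht (frame b c q x) (frame b c q y) (frame b c q z)
        rw [h.apply_J hq, h.apply_J hq, hat_sub, hat_sub] at h1
        simp only [hat_frame] at h1
        linarith)) (hat b c q v)
  have e : ∑ a, β (hat b c q v) (Pi.single a 1) a = ∑ a, coord a (Γ q v (vec 1 a)) := by
    refine Finset.sum_congr rfl fun a _ => ?_
    simp only [hβ, frame_hat]
    exact coord_frame_single q (Γ q v) (hJ v) a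
  rw [traceJ_apply, trace_J_comp _ (hJ v), ← e, key]
  simp only [hat_apply]
  ring

theorem IsBismut.ricciForm_eq (h : HasMatrix b c C ω) (hC : C.PosDef)
    (hw : ∀ k, ∑ a, (weight b c k a + conj (weight b c k a)) = 1) {Γ : Christoffel r s}
    (hΓ : IsBismut ω Γ) {p : Ambient r s} (hp : p ∈ domain r s) (u v : Ambient r s) :
    ricciForm Γ p u v =
      -2 * (∑ a, traceCoeff (weight b c) Sum.inl C a * (theta b c a).d p u v).im +
        (∑ k, ((theta b c (.inl k)).d p u v).re) / 2 := by
  have hd : DifferentiableAt ℝ Γ p :=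
    (hΓ.1.contDiffAt (isOpen_domain.mem_nhds hp)).differentiableAt (by simp)
  have h1 : ∀ u v, fderiv ℝ (fun q => traceJ r s (Γ q v)) p u =
      -4 * (∑ a, traceCoeff (weight b c) Sum.inl C a *
        fderiv ℝ (fun q => theta b c a q v) p u).im +
        ∑ k, (fderiv ℝ (fun q => theta b c (.inl k) q v) p u).re := by
    intro u v
    have e : (fun q => traceJ r s (Γ q v)) =ᶠ[nhds p] fun q =>
      -4 * Complex.imCLM (∑ a, traceCoeff (weight b c) Sum.inl C a * theta b c a q v) +
        ∑ k, Complex.reCLM (theta b c (.inl k) q v) := by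
      filter_upwards [isOpen_domain.mem_nhds hp] with q hq
      exact hΓ.traceJ_eq h hC hw hq v
    have hθ := fun a => (differentiableAt_theta b c a hp v).hasFDerivAt
    have d1 := Complex.imCLM.hasFDerivAt.comp p (HasFDerivAt.fun_sum (u := Finset.univ)
      fun a _ => (hθ a).const_mul (traceCoeff (weight b c) Sum.inl C a))
    have d2 := HasFDerivAt.fun_sum (u := Finset.univ) fun (k : Fin r) _ =>
      Complex.reCLM.hasFDerivAt.comp p (hθ (.inl k))
    have d3 := (d1.const_mul (-4)).fun_add d2
    simp only [Function.comp_def] at d3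
    rw [e.fderiv_eq, d3.fderiv]
    simp only [add_apply, smul_apply, sum_apply, ContinuousLinearMap.comp_apply,
      Complex.imCLM_apply, Complex.reCLM_apply, smul_eq_mul]
  rw [OeljeklausToma.ricciForm_eq hd (hΓ.2 p hp).1, h1, h1]
  simp only [Form10.d, mul_sub, Complex.sub_re, Finset.sum_sub_distrib, Complex.sub_im]
  ring

/-- The `(1,1)`-part of the Bismut Ricci form of a left-invariant metric. -/
theorem IsBismut.ricciForm11_eq (h : HasMatrix b c C ω) (hC : C.PosDef)
    (hw : ∀ k, ∑ a, (weight b c k a + conj (weight b c k a)) = 1) {Γ : Christoffel r s}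
    (hΓ : IsBismut ω Γ) {p : Ambient r s} (hp : p ∈ domain r s) (u v : Ambient r s) :
    ricciForm11 Γ p u v =
      (∑ a, ∑ k, traceCoeff (weight b c) Sum.inl C a * weight b c k a *
        (conj (hat b c p u (.inl k)) * hat b c p v a -
          conj (hat b c p v (.inl k)) * hat b c p u a)).re -
      (∑ k, (hat b c p u (.inl k) * conj (hat b c p v (.inl k))).im) / 2 := by
  set x := hat b c p u
  set y := hat b c p v
  -- Adding the value on Ju, Jv combines the imaginary and real parts of the z-components into their
  -- conjugates: this is the (1,1)-part of dθ_a.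
  have hd : ∀ a, (theta b c a).d p u v + (theta b c a).d p (J r s u) (J r s v) =
      -Complex.I * ∑ k, weight b c k a * (conj (x (.inl k)) * y a - conj (y (.inl k)) * x a) := by
    intro a
    rw [d_theta b c a hp, d_theta b c a hp, hat_J, hat_J, ← neg_add, neg_mul, neg_inj,
      ← Finset.sum_add_distrib, Finset.mul_sum]
    refine Finset.sum_congr rfl fun k _ => ?_
    have ec : ∀ z : ℂ, conj z = z.re - z.im * Complex.I := fun z => by
      apply Complex.ext <;> simp
    simp only [ec, Pi.smul_apply, smul_eq_mul, Complex.mul_im, Complex.I_re, Complex.I_im, zero_mul,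
      one_mul, zero_add]
    change weight b c k a * (((x (.inl k)).im : ℂ) * y a - ((y (.inl k)).im : ℂ) * x a) +
      weight b c k a * (((x (.inl k)).re : ℂ) * (Complex.I * y a) -
        ((y (.inl k)).re : ℂ) * (Complex.I * x a)) = _
    linear_combination (-weight b c k a * (-((x (.inl k)).im : ℂ) * y a +
      ((y (.inl k)).im : ℂ) * x a)) * Complex.I_sq
  have hk : ∀ k, ((theta b c (.inl k)).d p u v + (theta b c (.inl k)).d p (J r s u) (J r s v)).re =
      -2 * (x (.inl k) * conj (y (.inl k))).im := fun k => by
    rw [hd, Finset.sum_eq_single k]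
    · simp [weight]; ring
    · intro l _ hl; simp [weight, hl.symm]
    · simp
  rw [ricciForm11, hΓ.ricciForm_eq h hC hw hp, hΓ.ricciForm_eq h hC hw hp]
  have e1 : (1 / 2 : ℝ) * (-2 * (∑ a, traceCoeff (weight b c) Sum.inl C a *
      (theta b c a).d p u v).im + (∑ k, ((theta b c (.inl k)).d p u v).re) / 2 +
      (-2 * (∑ a, traceCoeff (weight b c) Sum.inl C a * (theta b c a).d p (J r s u) (J r s v)).im +
      (∑ k, ((theta b c (.inl k)).d p (J r s u) (J r s v)).re) / 2)) =
      -(∑ a, traceCoeff (weight b c) Sum.inl C a * ((theta b c a).d p u v +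
        (theta b c a).d p (J r s u) (J r s v))).im + (∑ k, ((theta b c (.inl k)).d p u v +
        (theta b c (.inl k)).d p (J r s u) (J r s v)).re) / 4 := by
    simp only [mul_add, Finset.sum_add_distrib, Complex.add_im, Complex.add_re]
    ring
  rw [e1]
  simp only [hk]
  simp only [hd]
  have e2 : ∑ a, traceCoeff (weight b c) Sum.inl C a * (-Complex.I * ∑ k, weight b c k a *
      (conj (x (.inl k)) * y a - conj (y (.inl k)) * x a)) = -Complex.I *
      ∑ a, ∑ k, traceCoeff (weight b c) Sum.inl C a * weight b c k a *
        (conj (x (.inl k)) * y a - conj (y (.inl k)) * x a) := by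
    simp only [Finset.mul_sum]
    exact Finset.sum_congr rfl fun _ _ => Finset.sum_congr rfl fun _ _ => by ring
  rw [e2, ← Finset.mul_sum]
  simp only [Complex.mul_im, Complex.neg_im, Complex.neg_re, Complex.I_re, Complex.I_im]
  ring

end

end

end OeljeklausToma

namespace OeljeklausToma

noncomputable section

open ComplexConjugate
open scoped ComplexOrder

variable {r s : ℕ} {b c : Fin r → Fin s → ℝ}

/-! ### Rigidity of adapted coframes -/

theorem weight_inl (k m : Fin r) : weight b c k (.inl m) = if m = k then 1 else 0 := rfl

theorem weight_inr (k : Fin r) (i : Fin s) :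
    weight b c k (.inr i) = (b k i / 2 : ℝ) + c k i * Complex.I := rfl

theorem eq_sum_coord (f : Ambient r s →L[ℂ] ℂ) (u : Ambient r s) :
    f u = ∑ a, f (vec 1 a) * coord a u := by
  have hu : u = ∑ a, coord a u • vec 1 a := by
    apply ext_coord
    intro d
    rw [map_sum, Finset.sum_eq_single d] <;> simp +contextual [eq_comm]
  conv_lhs => rw [hu]
  simp only [map_sum, map_smul, smul_eq_mul, mul_comm]

theorem vec_eq_smul (z : ℂ) (a : Fin r ⊕ Fin s) : vec z a = z • vec 1 a := by
  apply ext_coord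
  intro d
  rw [map_smul, coord_vec, coord_vec, Pi.single_apply, Pi.single_apply]
  split <;> simp

/-- The differential at the neutral element of the left-invariant form extending `f`. -/
def dBase (b c : Fin r → Fin s → ℝ) (f : Ambient r s →L[ℂ] ℂ) (u v : Ambient r s) : ℂ :=
  ∑ a, f (vec 1 a) * (theta b c a).d (base r s) u v

theorem dBase_eq (f : Ambient r s →L[ℂ] ℂ) (u v : Ambient r s) :
    dBase b c f u v = -∑ a, ∑ k, f (vec 1 a) * weight b c k a *
      (((u.1 k).im : ℂ) * coord a v - ((v.1 k).im : ℂ) * coord a u) := by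
  rw [dBase, ← Finset.sum_neg_distrib]
  refine Finset.sum_congr rfl fun a _ => ?_
  rw [d_theta b c a base_mem, mul_neg, Finset.mul_sum]
  simp only [hat_base, coord_inl, mul_assoc]

theorem dBase_vec (f : Ambient r s →L[ℂ] ℂ) (a : Fin r ⊕ Fin s) (l : Fin r) :
    dBase b c f (vec 1 a) (vec Complex.I (.inl l)) = f (vec 1 a) * weight b c l a := by
  rw [dBase_eq, Finset.sum_eq_single a, Finset.sum_eq_single l]
  · simp [im_vec_real]; simp [vec_fst]
  · intro k _ hk; simp [im_vec_real]; simp [vec_fst, hk]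
  · simp
  · intro d _ hd
    refine Finset.sum_eq_zero fun k _ => ?_
    simp [im_vec_real, Pi.single_eq_of_ne hd]
  · simp

theorem dBase_vec_inr (f : Ambient r s →L[ℂ] ℂ) (a : Fin r ⊕ Fin s) (i : Fin s) (z : ℂ) :
    dBase b c f (vec 1 a) (vec z (.inr i)) = 0 := by
  rw [dBase_eq, neg_eq_zero]
  refine Finset.sum_eq_zero fun d _ => Finset.sum_eq_zero fun k _ => ?_
  simp [im_vec_real, im_vec_inr]

/-- A coframe at the neutral element satisfying the structure equations of an adapted coframe is
obtained from the standard one by permuting and rescaling. -/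
theorem coframe_rigid (e : Fin s ≃ Fin r) (hb : ∀ k i, b k i = if k = e i then -1 else 0)
    (α γ : Fin s → Ambient r s →L[ℂ] ℂ) (c' : Fin s → Fin s → ℝ)
    (hα : ∀ k u v, dBase b c (α k) u v =
      Complex.I / 2 * (α k u * conj (α k v) - α k v * conj (α k u)))
    (hγ : ∀ i u v, dBase b c (γ i) u v =
      (∑ k, lam c' k i * (α k u * γ i v - α k v * γ i u)) -
        ∑ k, lam c' k i * (conj (α k u) * γ i v - conj (α k v) * γ i u))
    (hinj : ∀ u, (∀ k, α k u = 0) → (∀ i, γ i u = 0) → u = 0) :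
    ∃ (π : Fin s ≃ Fin r) (q : Fin s → ℂ), (∀ i, q i ≠ 0) ∧
      (∀ k u, α k u = coord (.inl (π k)) u) ∧
      ∀ i u, γ i u = q i * coord (.inr (e.symm (π i))) u := by
  have hvI : ∀ (f : Ambient r s →L[ℂ] ℂ) a, f (vec Complex.I a) = Complex.I * f (vec 1 a) :=
    fun f a => by rw [vec_eq_smul Complex.I, map_smul, smul_eq_mul]
  have hI2 := Complex.I_mul_I
  -- The left side of the structure equation vanishes on two w-directions, while the right side is
  -- the squared modulus of α_k on this vector.
  have α_inr : ∀ k i, α k (vec 1 (.inr i)) = 0 := fun k i => by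
    have h := hα k (vec 1 (.inr i)) (vec Complex.I (.inr i))
    rw [dBase_vec_inr, hvI, map_mul, Complex.conj_I] at h
    have h2 : α k (vec 1 (.inr i)) * conj (α k (vec 1 (.inr i))) = 0 := by
      linear_combination -h + α k (vec 1 (.inr i)) * conj (α k (vec 1 (.inr i))) * hI2
    simpa using h2
  -- The same test on a z-direction shows that the value equals its own squared modulus, hence is 0
  -- or 1.
  have α_mul : ∀ k l, α k (vec 1 (.inl l)) =
      α k (vec 1 (.inl l)) * conj (α k (vec 1 (.inl l))) := fun k l => by
    have h := hα k (vec 1 (.inl l)) (vec Complex.I (.inl l))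
    rw [dBase_vec, hvI, map_mul, Complex.conj_I, weight_inl, if_pos rfl] at h
    linear_combination h - α k (vec 1 (.inl l)) * conj (α k (vec 1 (.inl l))) * hI2
  have α_real : ∀ k l, conj (α k (vec 1 (.inl l))) = α k (vec 1 (.inl l)) := fun k l => by
    rw [α_mul k l, map_mul, Complex.conj_conj, mul_comm]
  have α_val : ∀ k l, α k (vec 1 (.inl l)) = 0 ∨ α k (vec 1 (.inl l)) = 1 := fun k l => by
    have h := α_mul k l
    rw [α_real] at h
    have : α k (vec 1 (.inl l)) * (α k (vec 1 (.inl l)) - 1) = 0 := by linear_combination -h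
    rcases mul_eq_zero.1 this with h | h
    · exact Or.inl h
    · exact Or.inr (sub_eq_zero.1 h)
  have α_orth : ∀ k l m, l ≠ m → α k (vec 1 (.inl l)) = 1 → α k (vec 1 (.inl m)) = 0 :=
    fun k l m hlm h1 => by
      have h := hα k (vec 1 (.inl l)) (vec Complex.I (.inl m))
      rw [dBase_vec, hvI, map_mul, Complex.conj_I, weight_inl, if_neg hlm, α_real, α_real, h1] at h
      linear_combination -h + α k (vec 1 (.inl m)) * hI2
  have γ_inl : ∀ i l, γ i (vec 1 (.inl l)) = 0 := fun i l => by
    have h := hγ i (vec 1 (.inl l)) (vec Complex.I (.inl l))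
    rw [dBase_vec, weight_inl, if_pos rfl] at h
    simp only [hvI, map_mul, Complex.conj_I, α_real] at h
    have h2 : γ i (vec 1 (.inl l)) *
        (1 + 2 * Complex.I * ∑ k, lam c' k i * α k (vec 1 (.inl l))) = 0 := by
      have e1 : ∑ k, lam c' k i * (α k (vec 1 (.inl l)) * (Complex.I * γ i (vec 1 (.inl l))) -
          Complex.I * α k (vec 1 (.inl l)) * γ i (vec 1 (.inl l))) = 0 :=
        Finset.sum_eq_zero fun k _ => by ring
      have e2 : ∑ k, lam c' k i * (α k (vec 1 (.inl l)) * (Complex.I * γ i (vec 1 (.inl l))) -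
          -Complex.I * α k (vec 1 (.inl l)) * γ i (vec 1 (.inl l))) =
          2 * Complex.I * γ i (vec 1 (.inl l)) * ∑ k, lam c' k i * α k (vec 1 (.inl l)) := by
        rw [Finset.mul_sum]
        exact Finset.sum_congr rfl fun k _ => by ring
      rw [e1, e2] at h
      linear_combination h
    -- The second factor has real part at least 1, because Im λ_ki ≤ 0 and the values of α_k are 0
    -- or 1.
    refine (mul_eq_zero.1 h2).resolve_right fun h3 => ?_
    have h4 := congrArg Complex.re h3
    have h5 : (∑ k, lam c' k i * α k (vec 1 (.inl l))).im ≤ 0 := by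
      rw [Complex.im_sum]
      refine Finset.sum_nonpos fun k _ => ?_
      rcases α_val k l with h | h <;> rw [h]
      · simp
      · rw [mul_one, lam]
        split <;> simp
    simp at h4
    simp at h5
    linarith
  have vec_ne : ∀ a : Fin r ⊕ Fin s, vec (1 : ℂ) a ≠ 0 := fun a h => by
    have := congrArg (coord a) h
    simp at this
  have hex : ∀ l, ∃ k, α k (vec 1 (.inl l)) = 1 := fun l => by
    by_contra! h
    exact vec_ne _ (hinj (vec 1 (.inl l)) (fun k => (α_val k l).resolve_right (h k))
      fun i => γ_inl i l)
  choose κ hκ using hex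
  have κ_inj : Function.Injective κ := fun l m hlm => by
    by_contra hne
    have := α_orth (κ l) l m hne (hκ l)
    rw [hlm, hκ m] at this
    exact one_ne_zero this
  -- Nondegeneracy and orthogonality give an injection from z-indices to α-indices; it is bijective
  -- because e makes the two index sets equinumerous.
  have κ_bij : Function.Bijective κ :=
    (Fintype.bijective_iff_injective_and_card κ).2 ⟨κ_inj, (Fintype.card_congr e).symm⟩
  obtain ⟨π, hπ⟩ : ∃ π : Fin s ≃ Fin r, ∀ k, κ (π k) = k :=
    ⟨(Equiv.ofBijective κ κ_bij).symm, fun k => (Equiv.ofBijective κ κ_bij).apply_symm_apply k⟩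
  have α_eq : ∀ k l, α k (vec 1 (.inl l)) = if l = π k then 1 else 0 := fun k l => by
    have h1 : α k (vec 1 (.inl (π k))) = 1 := by
      have := hκ (π k)
      rwa [hπ] at this
    split_ifs with h
    · rw [h, h1]
    · exact α_orth k (π k) l (Ne.symm h) h1
  have α_fin : ∀ k u, α k u = coord (.inl (π k)) u := fun k u => by
    rw [eq_sum_coord, Finset.sum_eq_single (Sum.inl (π k))]
    · rw [α_eq, if_pos rfl, one_mul]
    · intro a _ ha
      rcases a with l | i
      · rw [α_eq, if_neg fun h => ha (congrArg Sum.inl h), zero_mul]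
      · rw [α_inr, zero_mul]
    · simp
  have γ_rel : ∀ i j l, γ i (vec 1 (.inr j)) ≠ 0 → (l = e j ↔ l = π i) := fun i j l hij => by
    have h := hγ i (vec 1 (.inr j)) (vec Complex.I (.inl l))
    rw [dBase_vec] at h
    simp only [hvI, γ_inl, α_inr, map_mul, Complex.conj_I, α_real] at h
    simp only [map_zero, mul_zero, zero_sub, α_eq, mul_ite, mul_one, mul_zero] at h
    have e1 : ∀ z : ℂ, ∑ k, lam c' k i * -((if l = π k then z else 0) * γ i (vec 1 (.inr j))) =
        -(lam c' (π.symm l) i * z * γ i (vec 1 (.inr j))) := fun z => by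
      rw [Finset.sum_eq_single (π.symm l)]
      · simp; ring
      · intro k _ hk
        rw [if_neg fun h => hk (by rw [h]; simp)]
        simp
      · simp
    rw [e1, e1] at h
    have h2 : γ i (vec 1 (.inr j)) * (weight b c l (.inr j) +
        2 * Complex.I * lam c' (π.symm l) i) = 0 := by linear_combination h
    -- Only real parts are compared: the weight contributes -1/2 exactly when l = e j, and 2iλ
    -- contributes 1/2 exactly when l = π i. Cancellation forces both or neither, whatever the c's
    -- are.
    have h3 := congrArg Complex.re ((mul_eq_zero.1 h2).resolve_left hij)
    rw [weight_inr, hb, lam] at h3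
    have h4 : l = π i ↔ i = π.symm l :=
      ⟨fun h => by rw [h, π.symm_apply_apply], fun h => by rw [h, π.apply_symm_apply]⟩
    rw [h4]
    by_cases h5 : l = e j <;> by_cases h6 : i = π.symm l
    · exact iff_of_true h5 h6
    · exfalso
      rw [if_pos h5, if_neg h6] at h3
      simp at h3
    · exfalso
      rw [if_neg h5, if_pos h6] at h3
      norm_num at h3
    · exact iff_of_false h5 h6
  have γ_ne : ∀ i, γ i (vec 1 (.inr (e.symm (π i)))) ≠ 0 := fun i => by
    by_contra h0
    refine vec_ne _ (hinj (vec 1 (.inr (e.symm (π i)))) (fun k => α_inr k _) fun i' => ?_)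
    by_contra h1
    have := (γ_rel i' _ (π i) h1).1 (by simp)
    rw [← π.injective this] at h1
    exact h1 h0
  refine ⟨π, fun i => γ i (vec 1 (.inr (e.symm (π i)))), γ_ne, α_fin, fun i u => ?_⟩
  rw [eq_sum_coord, Finset.sum_eq_single (Sum.inr (e.symm (π i)))]
  · intro a _ ha
    rcases a with l | j
    · rw [γ_inl, zero_mul]
    · by_cases h : γ i (vec 1 (.inr j)) = 0
      · rw [h, zero_mul]
      · have := (γ_rel i j (e j) h).1 rfl
        exact absurd (by rw [← this]; simp) ha
  · simp

end

end OeljeklausToma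

namespace OeljeklausToma

noncomputable section

open ComplexConjugate
open scoped ComplexOrder

variable {r s : ℕ} {b c : Fin r → Fin s → ℝ}

/-! ### Left-invariant (1,0)-forms and adapted coframes -/

theorem Form10.IsLeftInvariant.apply_eq {α : Form10 r s} (hα : α.IsLeftInvariant b c)
    {q : Ambient r s} (hq : q ∈ domain r s) (u : Ambient r s) :
    α q u = ∑ a, α (base r s) (vec 1 a) * theta b c a q u := by
  have h := hα q hq (base r s) base_mem (ofCoord (hat b c q u))
  rw [mul_base, fderiv_mul, mulDeriv_eq_frame b c hq] at h
  simp only [coord_ofCoord] at h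
  rw [show (fun a => hat b c q u a) = hat b c q u from rfl, frame_hat] at h
  rw [h, eq_sum_coord]
  simp only [coord_ofCoord, hat_apply]

theorem d_eq_of_eqOn {α : Form10 r s} (f : Fin r ⊕ Fin s → ℂ) {q : Ambient r s}
    (hq : q ∈ domain r s)
    (h : ∀ q ∈ domain r s, ∀ u, α q u = ∑ a, f a * theta b c a q u) (u v : Ambient r s) :
    α.d q u v = ∑ a, f a * (theta b c a).d q u v := by
  have h1 : ∀ u v, fderiv ℝ (fun q => α q v) q u =
      ∑ a, f a * fderiv ℝ (fun q => theta b c a q v) q u := fun u v => by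
    have e : (fun q => α q v) =ᶠ[nhds q] fun q => ∑ a, f a * theta b c a q v := by
      filter_upwards [isOpen_domain.mem_nhds hq] with q' hq'
      exact h q' hq' v
    have d := HasFDerivAt.fun_sum (u := Finset.univ) fun a _ =>
      (differentiableAt_theta b c a hq v).hasFDerivAt.const_mul (f a)
    rw [e.fderiv_eq, d.fderiv]
    simp only [sum_apply, smul_apply, smul_eq_mul]
  simp only [Form10.d, h1, mul_sub, Finset.sum_sub_distrib]

theorem Form10.IsLeftInvariant.d_base {α : Form10 r s} (hα : α.IsLeftInvariant b c)
    (u v : Ambient r s) : α.d (base r s) u v = dBase b c (α (base r s)) u v :=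
  d_eq_of_eqOn _ base_mem (fun _ hq u => hα.apply_eq hq u) u v

/-- Every adapted coframe is a permutation and rescaling of the standard one. -/
theorem IsAdaptedCoframe.rigid (e : Fin s ≃ Fin r) (hb : ∀ k i, b k i = if k = e i then -1 else 0)
    {α γ : Fin s → Form10 r s} (h : IsAdaptedCoframe b c α γ) :
    ∃ (π : Fin s ≃ Fin r) (q : Fin s → ℂ), (∀ i, q i ≠ 0) ∧
      ∀ p ∈ domain r s, ∀ u, (∀ k, α k p u = theta b c (.inl (π k)) p u) ∧
        ∀ i, γ i p u = q i * theta b c (.inr (e.symm (π i))) p u := by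
  obtain ⟨hα, hγ, hfr, c', hd⟩ := h
  obtain ⟨π, q, hq, h1, h2⟩ := coframe_rigid (c := c) e hb (fun k => α k (base r s))
    (fun i => γ i (base r s)) c'
    (fun k u v => by
      rw [← (hα k).d_base, (hd (base r s) base_mem u v).1 k]; rfl)
    (fun i u v => by
      rw [← (hγ i).d_base, (hd (base r s) base_mem u v).2 i]; rfl)
    (fun u h1 h2 => by
      have h3 : ∀ f : Ambient r s →L[ℂ] ℂ, f u = 0 := fun f => by
        have hf : f ∈ Submodule.span ℂ (Set.range (Sum.elim (fun k => α k (base r s))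
            (fun i => γ i (base r s)))) := by rw [(hfr (base r s) base_mem).2]; trivial
        induction hf using Submodule.span_induction with
        | mem x hx =>
          obtain ⟨a, rfl⟩ := hx
          rcases a with k | i
          · exact h1 k
          · exact h2 i
        | zero => rfl
        | add x y _ _ hx hy => rw [add_apply, hx, hy, add_zero]
        | smul z x _ hx => rw [smul_apply, hx, smul_zero]
      exact ext_coord fun a => by rw [h3, map_zero])
  refine ⟨π, q, hq, fun p hp u => ⟨fun k => ?_, fun i => ?_⟩⟩
  · rw [(hα k).apply_eq hp]
    simp only [h1, coord_vec]
    rw [Finset.sum_eq_single (Sum.inl (π k))] <;> simp +contextual [eq_comm]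
  · rw [(hγ i).apply_eq hp]
    simp only [h2, coord_vec]
    rw [Finset.sum_eq_single (Sum.inr (e.symm (π i)))] <;>
      simp +contextual [eq_comm]

/-- This is the dictionary between the exponents of χ_i and the structure constants: the value b =
-1 on the permutation is what produces the imaginary part -1/4 of λ. -/
theorem weight_eq_lam (e : Fin s ≃ Fin r) (hb : ∀ k i, b k i = if k = e i then -1 else 0)
    (k i : Fin s) :
    weight b c (e k) (.inr i) = -2 * Complex.I * lam (fun k i => c (e k) i) k i := by
  rw [weight_inr, hb, lam]
  have hI := Complex.I_sq
  by_cases h : i = k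
  · subst h
    simp
    linear_combination (-1 / 2 : ℂ) * hI
  · rw [if_neg fun h' => h (e.injective h').symm, if_neg h]
    simp
    ring

theorem d_theta_inl (k : Fin r) {q : Ambient r s} (hq : q ∈ domain r s) (u v : Ambient r s) :
    (theta b c (.inl k)).d q u v =
      Complex.I / 2 * wedgeConjRight (theta b c (.inl k)) (theta b c (.inl k)) q u v := by
  rw [d_theta b c _ hq, Finset.sum_eq_single k]
  · rw [weight_inl, if_pos rfl, wedgeConjRight]
    simp only [hat_apply]
    set x := theta b c (.inl k) q u
    set y := theta b c (.inl k) q v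
    apply Complex.ext <;> simp <;> ring
  · intro l _ hl
    rw [weight_inl, if_neg hl.symm, zero_mul]
  · simp

theorem d_theta_inr (e : Fin s ≃ Fin r) (hb : ∀ k i, b k i = if k = e i then -1 else 0)
    (i : Fin s) {q : Ambient r s} (hq : q ∈ domain r s) (u v : Ambient r s) :
    (theta b c (.inr i)).d q u v =
      (∑ k, lam (fun k i => c (e k) i) k i *
        wedge (theta b c (.inl (e k))) (theta b c (.inr i)) q u v) -
      ∑ k, lam (fun k i => c (e k) i) k i *
        wedgeConjLeft (theta b c (.inl (e k))) (theta b c (.inr i)) q u v := by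
  rw [d_theta b c _ hq, ← Equiv.sum_comp e, ← Finset.sum_sub_distrib, ← Finset.sum_neg_distrib]
  refine Finset.sum_congr rfl fun k _ => ?_
  rw [weight_eq_lam e hb, wedge, wedgeConjLeft]
  simp only [hat_apply]
  have ec : ∀ z : ℂ, conj z = z - 2 * Complex.I * z.im := fun z => by
    apply Complex.ext <;> simp
    ring
  rw [ec, ec]
  ring

/-- The standard coframe is adapted. -/
theorem isAdaptedCoframe_theta (e : Fin s ≃ Fin r)
    (hb : ∀ k i, b k i = if k = e i then -1 else 0) :
    IsAdaptedCoframe b c (fun k => theta b c (.inl (e k))) (fun i => theta b c (.inr i)) := by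
  refine ⟨fun k => theta_isLeftInvariant b c _, fun i => theta_isLeftInvariant b c _,
    fun p hp => ?_, fun k i => c (e k) i, fun p hp u v => ⟨fun k => d_theta_inl (e k) hp u v,
      fun i => d_theta_inr e hb i hp u v⟩⟩
  set f : Fin s ⊕ Fin s → Ambient r s →L[ℂ] ℂ :=
    Sum.elim (fun k => theta b c (.inl (e k)) p) (fun i => theta b c (.inr i) p)
  let E : Fin s ⊕ Fin s ≃ Fin r ⊕ Fin s := Equiv.sumCongr e (Equiv.refl _)
  have hf : ∀ a, f a = theta b c (E a) p := by
    rintro (k | i) <;> rfl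
  have hval : ∀ a d, f a (frame b c p (Pi.single (E d) 1)) = if a = d then 1 else 0 := fun a d => by
    rw [hf, ← hat_apply, hat_frame, Pi.single_apply]
    simp [E.injective.eq_iff]
  constructor
  · rw [Fintype.linearIndependent_iff]
    intro g hg a
    have := DFunLike.congr_fun hg (frame b c p (Pi.single (E a) 1))
    rw [sum_apply, Finset.sum_eq_single a] at this
    · simpa [hval] using this
    · intro d _ hd
      rw [smul_apply, hval, if_neg hd, smul_zero]
    · simp
  · rw [eq_top_iff]
    intro g _
    have : g = ∑ a, g (frame b c p (Pi.single (E a) 1)) • f a := by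
      refine ContinuousLinearMap.ext fun u => ?_
      have hu : u = ∑ a, f a u • frame b c p (Pi.single (E a) 1) := by
        apply Function.LeftInverse.injective (frame_hat b c p)
        funext d
        obtain ⟨d, rfl⟩ := E.surjective d
        rw [hat_apply, hat_apply, map_sum, Finset.sum_eq_single d, map_smul, ← hf, hval]
        · simp
        · intro a _ ha
          rw [map_smul, ← hf, hval, if_neg ha.symm, smul_zero]
        · simp
      conv_lhs => rw [hu]
      simp only [map_sum, map_smul, sum_apply, smul_apply, smul_eq_mul]
      exact Finset.sum_congr rfl fun _ _ => mul_comm _ _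
    rw [this]
    exact Submodule.sum_mem _ fun a _ => Submodule.smul_mem _ _ (Submodule.subset_span ⟨a, rfl⟩)

end

end OeljeklausToma

namespace OeljeklausToma

noncomputable section

open ComplexConjugate
open scoped ComplexOrder

variable {r s : ℕ} {b c : Fin r → Fin s → ℝ}

/-! ### Automorphisms of `G` -/

theorem IsAutomorphism.mapsTo {f : Ambient r s → Ambient r s} (hf : IsAutomorphism b c f)
    {p : Ambient r s} (hp : p ∈ domain r s) : f p ∈ domain r s := by
  obtain ⟨-, Φ, hΦ⟩ := hf
  rw [hΦ ⟨p, hp⟩]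
  exact (Φ ⟨p, hp⟩).2

theorem IsAutomorphism.map_mul {f : Ambient r s → Ambient r s} (hf : IsAutomorphism b c f)
    {g p : Ambient r s} (hg : g ∈ domain r s) (hp : p ∈ domain r s) :
    f (mul b c g p) = mul b c (f g) (f p) := by
  obtain ⟨-, Φ, hΦ⟩ := hf
  rw [hΦ ⟨p, hp⟩, hΦ ⟨g, hg⟩]
  let g' : SolvGroup b c := ⟨g, hg⟩
  let p' : SolvGroup b c := ⟨p, hp⟩
  have h := hΦ (g' * p')
  rw [_root_.map_mul] at h
  exact h

theorem IsAutomorphism.map_base {f : Ambient r s → Ambient r s} (hf : IsAutomorphism b c f) :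
    f (base r s) = base r s := by
  obtain ⟨-, Φ, hΦ⟩ := hf
  have h := hΦ (1 : SolvGroup b c)
  rw [map_one] at h
  exact h

theorem IsAutomorphism.differentiableAt {f : Ambient r s → Ambient r s}
    (hf : IsAutomorphism b c f) {p : Ambient r s} (hp : p ∈ domain r s) :
    DifferentiableAt ℂ f p :=
  (hf.1.contDiffAt (isOpen_domain.mem_nhds hp)).differentiableAt (by simp)

theorem IsAutomorphism.fderiv_eq {f : Ambient r s → Ambient r s}
    (hf : IsAutomorphism b c f) {p : Ambient r s} (hp : p ∈ domain r s) (u : Ambient r s) :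
    fderiv ℝ f p u = fderiv ℂ f p u := by
  rw [((hf.differentiableAt hp).hasFDerivAt.restrictScalars ℝ).fderiv]
  rfl

/-- Differentiating f ∘ L_q = L_{f(q)} ∘ f at the neutral element shows that, in left-invariant
frames, the differential of f is the same matrix at every point. -/
theorem IsAutomorphism.pullback_theta {f : Ambient r s → Ambient r s}
    (hf : IsAutomorphism b c f) {q : Ambient r s} (hq : q ∈ domain r s) (a : Fin r ⊕ Fin s)
    (v : Ambient r s) :
    theta b c a (f q) (fderiv ℝ f q v) =
      ∑ d, coord a (fderiv ℂ f (base r s) (vec 1 d)) * theta b c d q v := by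
  set w : Ambient r s := ofCoord (hat b c q v) with hw
  have hv : v = mulDeriv b c q w := by
    rw [mulDeriv_eq_frame b c hq]
    simp only [hw, coord_ofCoord]
    exact (frame_hat b c q v).symm
  have h1 : HasFDerivAt (fun p => f (mul b c q p))
      ((fderiv ℂ f q).comp (mulDeriv b c q)) (base r s) := by
    have h2 := (hf.differentiableAt hq).hasFDerivAt
    have h3 := hasFDerivAt_mul b c q (base r s)
    rw [← mul_base b c q] at h2
    have h4 := h2.comp (base r s) h3
    rw [mul_base] at h4
    exact h4
  have h5 : HasFDerivAt (fun p => mul b c (f q) (f p))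
      ((mulDeriv b c (f q)).comp (fderiv ℂ f (base r s))) (base r s) :=
    (hasFDerivAt_mul b c (f q) (f (base r s))).comp (base r s)
      (hf.differentiableAt base_mem).hasFDerivAt
  have h6 : (fun p => f (mul b c q p)) =ᶠ[nhds (base r s)] fun p => mul b c (f q) (f p) := by
    filter_upwards [isOpen_domain.mem_nhds base_mem] with p hp
    exact hf.map_mul hq hp
  have h7 := DFunLike.congr_fun ((h1.congr_of_eventuallyEq h6.symm).unique h5) w
  simp only [ContinuousLinearMap.comp_apply] at h7
  rw [hf.fderiv_eq hq, hv, h7, mulDeriv_eq_frame b c (hf.mapsTo hq), ← hat_apply, hat_frame, ← hv]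
  have h8 := eq_sum_coord ((coord a).comp (fderiv ℂ f (base r s))) w
  simp only [ContinuousLinearMap.comp_apply] at h8
  rw [h8]
  simp only [hw, coord_ofCoord, hat_apply]

/-- Pull-back commutes with d: the second derivative of f enters symmetrically and drops out on
antisymmetrizing. Thus the pulled-back coframe satisfies the structure equations needed for
`coframe_rigid`. -/
theorem IsAutomorphism.dBase_eq {f : Ambient r s → Ambient r s} (hf : IsAutomorphism b c f)
    (a : Fin r ⊕ Fin s) (u v : Ambient r s) :
    dBase b c ((coord a).comp (fderiv ℂ f (base r s))) u v =
      (theta b c a).d (base r s) (fderiv ℂ f (base r s) u) (fderiv ℂ f (base r s) v) := by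
  set P := fderiv ℂ f (base r s)
  have hcont : ContDiffAt ℝ ((⊤ : ℕ∞) : WithTop ℕ∞) f (base r s) :=
    (hf.1.contDiffAt (isOpen_domain.mem_nhds base_mem)).restrict_scalars ℝ
  have hsymm := hcont.isSymmSndFDerivAt (by simp; norm_cast)
  have hd2 : DifferentiableAt ℝ (fderiv ℝ f) (base r s) :=
    (hcont.fderiv_right (m := 1) (by norm_cast)).differentiableAt (by simp)
  have hP : ∀ u, fderiv ℝ f (base r s) u = P u := fun u => hf.fderiv_eq base_mem u
  have h1 : ∀ u v, ∑ d, coord a (P (vec 1 d)) * fderiv ℝ (fun q => theta b c d q v) (base r s) u =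
      fderiv ℝ (fun q => theta b c a q (P v)) (base r s) (P u) +
        coord a (fderiv ℝ (fderiv ℝ f) (base r s) u v) := by
    intro u v
    have e : (fun q => theta b c a (f q) (fderiv ℝ f q v)) =ᶠ[nhds (base r s)]
        fun q => ∑ d, coord a (P (vec 1 d)) * theta b c d q v := by
      filter_upwards [isOpen_domain.mem_nhds base_mem] with q hq
      exact hf.pullback_theta hq a v
    have d1 := HasFDerivAt.fun_sum (u := Finset.univ) fun d _ =>
      (differentiableAt_theta b c d base_mem v).hasFDerivAt.const_mul (coord a (P (vec 1 d)))
    have hfd : HasFDerivAt f (fderiv ℝ f (base r s)) (base r s) :=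
      (hcont.differentiableAt (by simp)).hasFDerivAt
    have hpw : HasFDerivAt (powFactor fun k => weight b c k a)
        (fderiv ℝ (powFactor fun k => weight b c k a) (base r s)) (f (base r s)) := by
      rw [hf.map_base]
      exact (differentiableAt_powFactor _ base_mem).hasFDerivAt
    have hD : HasFDerivAt (fun q => fderiv ℝ f q v) ((fderiv ℝ (fderiv ℝ f) (base r s)).flip v)
        (base r s) := by
      have := hd2.hasFDerivAt.clm_apply (hasFDerivAt_const v (base r s))
      simpa using this
    have hD' : HasFDerivAt (fun q => coord a (fderiv ℝ f q v))
        (((coord a).restrictScalars ℝ).comp ((fderiv ℝ (fderiv ℝ f) (base r s)).flip v))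
        (base r s) := ((coord a).restrictScalars ℝ).hasFDerivAt.comp (base r s) hD
    have d2 := (hpw.comp (base r s) hfd).fun_mul hD'
    have h2 := DFunLike.congr_fun (d1.unique (d2.congr_of_eventuallyEq e.symm)) u
    simp only [sum_apply, smul_apply, smul_eq_mul, add_apply,
      ContinuousLinearMap.comp_apply, hf.map_base, powFactor_base, hP, Function.comp_apply] at h2
    have h3 : fderiv ℝ (fun q => theta b c a q (P v)) (base r s) (P u) =
        coord a (P v) * fderiv ℝ (powFactor fun k => weight b c k a) (base r s) (P u) := by
      have := ((differentiableAt_powFactor (fun k => weight b c k a)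
        (base_mem (r := r) (s := s))).hasFDerivAt.mul_const (coord a (P v))).fderiv
      rw [show (fun q => theta b c a q (P v)) = fun q =>
        powFactor (fun k => weight b c k a) q * coord a (P v) from rfl, this]
      rfl
    rw [h2, h3, add_comm]
    simp
  have h4 := h1 u v
  have h5 := h1 v u
  rw [hsymm.eq v u] at h5
  simp only [dBase, Form10.d, ContinuousLinearMap.comp_apply, mul_sub, Finset.sum_sub_distrib]
  rw [h4, h5]
  ring

/-- The differential at the neutral element of an automorphism permutes and rescales the
coordinates. -/
theorem IsAutomorphism.rigid (e : Fin s ≃ Fin r) (hb : ∀ k i, b k i = if k = e i then -1 else 0)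
    {f : Ambient r s → Ambient r s} (hf : IsAutomorphism b c f)
    (hinj : ∀ u, fderiv ℝ f (base r s) u = 0 → u = 0) :
    ∃ (π : Fin s ≃ Fin r) (q : Fin s → ℂ), (∀ i, q i ≠ 0) ∧ ∀ u,
      (∀ k, coord (.inl (e k)) (fderiv ℝ f (base r s) u) = coord (.inl (π k)) u) ∧
      ∀ i, coord (.inr i) (fderiv ℝ f (base r s) u) = q i * coord (.inr (e.symm (π i))) u := by
  obtain ⟨π, q, hq, h1, h2⟩ := coframe_rigid (c := c) e hb
    (fun k => (coord (.inl (e k))).comp (fderiv ℂ f (base r s)))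
    (fun i => (coord (.inr i)).comp (fderiv ℂ f (base r s))) (fun k i => c (e k) i)
    (fun k u v => by
      rw [hf.dBase_eq, d_theta_inl _ base_mem, wedgeConjRight]
      simp only [theta_base]; rfl)
    (fun i u v => by
      rw [hf.dBase_eq, d_theta_inr e hb _ base_mem]
      simp only [wedge, wedgeConjLeft, theta_base]; rfl)
    (fun u h1 h2 => hinj u (by
      rw [hf.fderiv_eq base_mem]
      refine ext_coord fun a => ?_
      rw [map_zero]
      rcases a with k | i
      · rw [← e.apply_symm_apply k]; exact h1 _
      · exact h2 i))
  refine ⟨π, q, hq, fun u => ?_⟩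
  rw [hf.fderiv_eq base_mem]
  exact ⟨fun k => h1 k u, fun i => h2 i u⟩

end

end OeljeklausToma

namespace OeljeklausToma

noncomputable section

open ComplexConjugate
open scoped ComplexOrder

variable {r s : ℕ} {b c : Fin r → Fin s → ℝ}

/-! ### Coefficients of `(1,1)`-forms at the neutral element -/

/-- The coefficient of `√-1 θ_a ∧ conj θ_d` of a real `(1,1)`-form at the neutral element. -/
def entry (η : Ambient r s → Ambient r s → ℝ) (a d : Fin r ⊕ Fin s) : ℂ :=
  ((η (vec 1 a) (J r s (vec 1 d)) : ℝ) - Complex.I * (η (vec 1 a) (vec 1 d) : ℝ)) / 2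

theorem hat_base_vec (z : ℂ) (a : Fin r ⊕ Fin s) :
    hat b c (base r s) (vec z a) = Pi.single a z := by
  rw [hat_base]
  funext d
  exact coord_vec z a d

section
variable {C : Matrix (Fin r ⊕ Fin s) (Fin r ⊕ Fin s) ℂ} {ω : Form r s 2}

theorem HasMatrix.entry_eq (h : HasMatrix b c C ω) (a d : Fin r ⊕ Fin s) :
    entry (fun u v => ω (base r s) ![u, v]) a d = C a d := by
  rw [entry, h.apply_J base_mem, h.apply base_mem, hat_base_vec, hat_base_vec, hermForm_single]
  apply Complex.ext <;> simp

variable (hC : C.PosDef) (hw : ∀ k, ∑ a, (weight b c k a + conj (weight b c k a)) = 1)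
  {Γ : Christoffel r s} (hΓ : IsBismut ω Γ)
include hC hw hΓ

theorem IsBismut.entry_ricci (h : HasMatrix b c C ω) (a d : Fin r ⊕ Fin s) :
    entry (ricciForm11 Γ (base r s)) a d =
      Complex.I / 2 * (traceCoeff (weight b c) Sum.inl C a *
        (∑ k, if d = .inl k then weight b c k a else 0) -
        conj (traceCoeff (weight b c) Sum.inl C d *
          (∑ k, if a = .inl k then weight b c k d else 0))) +
      if a = d ∧ a.isLeft then 1 / 4 else 0 := by
  have key : ∀ z : ℂ, ricciForm11 Γ (base r s) (vec 1 a) (vec z d) =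
      (traceCoeff (weight b c) Sum.inl C d * (∑ k, if a = .inl k then weight b c k d else 0) * z -
        traceCoeff (weight b c) Sum.inl C a * (∑ k, if d = .inl k then weight b c k a else 0) *
          conj z).re + (if a = d ∧ a.isLeft then z.im / 2 else 0) := fun z => by
    rw [hΓ.ricciForm11_eq h hC hw base_mem, hat_base_vec, hat_base_vec]
    have e1 : ∀ f : Fin r ⊕ Fin s → Fin r → ℂ, ∑ t, ∑ k, f t k *
        (conj ((Pi.single a 1 : Fin r ⊕ Fin s → ℂ) (.inl k)) *
            (Pi.single d z : Fin r ⊕ Fin s → ℂ) t -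
          conj ((Pi.single d z : Fin r ⊕ Fin s → ℂ) (.inl k)) *
            (Pi.single a 1 : Fin r ⊕ Fin s → ℂ) t) =
        (∑ k, if a = .inl k then f d k else 0) * z -
          (∑ k, if d = .inl k then f a k else 0) * conj z := fun f => by
      simp only [mul_sub, Finset.sum_sub_distrib, Finset.sum_mul]
      congr 1
      · rw [Finset.sum_eq_single d]
        · refine Finset.sum_congr rfl fun k _ => ?_
          by_cases hk : a = .inl k
          · simp [hk]
          · simp [hk, Ne.symm hk]
        · intro t _ ht; simp [ht]
        · simp
      · rw [Finset.sum_eq_single a]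
        · refine Finset.sum_congr rfl fun k _ => ?_
          by_cases hk : d = .inl k
          · simp [hk]
          · simp [hk, Ne.symm hk]
        · intro t _ ht; simp [ht]
        · simp
    have e2 : ∑ k, ((Pi.single a 1 : Fin r ⊕ Fin s → ℂ) (.inl k) *
        conj ((Pi.single d z : Fin r ⊕ Fin s → ℂ) (.inl k))).im =
        if a = d ∧ a.isLeft then -z.im else 0 := by
      rcases a with m | i
      · rw [Finset.sum_eq_single m]
        · by_cases hd : d = .inl m
          · simp [hd]
          · simp [Ne.symm hd]
        · intro k _ hk; simp [hk]
        · simp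
      · simp
    rw [e1, e2]
    simp only [Finset.mul_sum, mul_ite, mul_zero]
    split <;> ring
  rw [entry, J_vec, mul_one, key, key]
  set X := traceCoeff (weight b c) Sum.inl C d * (∑ k, if a = .inl k then weight b c k d else 0)
  set Y := traceCoeff (weight b c) Sum.inl C a * (∑ k, if d = .inl k then weight b c k a else 0)
  split <;> apply Complex.ext <;> simp <;> ring

/-- Every term of the (1,1)-form carries a conjugate z-component, so nothing survives on two
w-directions. Along the flow this makes the initial derivative of the w-block zero. -/
theorem IsBismut.entry_ricci_inr_inr (h : HasMatrix b c C ω) (i j : Fin s) :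
    entry (ricciForm11 Γ (base r s)) (.inr i) (.inr j) = 0 := by
  rw [hΓ.entry_ricci hC hw h]
  simp

theorem IsBismut.entry_ricci_inr_inl (h : HasMatrix b c C ω) (i : Fin s) (m : Fin r) :
    entry (ricciForm11 Γ (base r s)) (.inr i) (.inl m) =
      Complex.I / 2 * (traceCoeff (weight b c) Sum.inl C (.inr i) * weight b c m (.inr i)) := by
  rw [hΓ.entry_ricci hC hw h]
  simp

theorem IsBismut.entry_ricci_inl_inl (h : HasMatrix b c C ω) (k m : Fin r) :
    entry (ricciForm11 Γ (base r s)) (.inl k) (.inl m) =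
      if k = m then ((1 / 4 - (traceCoeff (weight b c) Sum.inl C (.inl k)).im : ℝ) : ℂ) else 0 := by
  rw [hΓ.entry_ricci hC hw h]
  simp only [Sum.inl.injEq, weight_inl, Sum.isLeft_inl, and_true]
  by_cases hkm : k = m
  · subst hkm
    simp
    apply Complex.ext <;> simp <;> ring
  · simp [hkm, Ne.symm hkm]

end

/-! ### The trace coefficients of a pluriclosed metric -/

section
variable {C : Matrix (Fin r ⊕ Fin s) (Fin r ⊕ Fin s) ℂ} (hC : C.PosDef)
include hC

theorem mul_inv_apply (a d : Fin r ⊕ Fin s) :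
    ∑ t, C a t * C⁻¹ t d = if a = d then 1 else 0 := by
  have hdet : IsUnit C.det := (Matrix.isUnit_iff_isUnit_det C).1 hC.isUnit
  rw [← Matrix.mul_apply, Matrix.mul_nonsing_inv C hdet, Matrix.one_apply]

theorem conj_inv_diag (a : Fin r ⊕ Fin s) : ((C⁻¹ a a).re : ℂ) = C⁻¹ a a :=
  Complex.conj_eq_iff_re.1 (hC.inv.isHermitian.apply a a)

/-- The contribution of the diagonal entry C_ii is eliminated through the (w_i, z_k) entry of C C⁻¹
= 1. What remains is linear in the mixed row and involves only the z-block of C⁻¹. -/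
theorem traceCoeff_inr {i : Fin s} (h0 : ∀ j, j ≠ i → C (.inr i) (.inr j) = 0) :
    traceCoeff (weight b c) Sum.inl C (.inr i) = Complex.I / 2 *
      (∑ k, C (.inr i) (.inl k) * C⁻¹ (.inl k) (.inl k) -
        ∑ k, ∑ m, C (.inr i) (.inl m) * C⁻¹ (.inl m) (.inl k) * conj (weight b c k (.inr i))) := by
  rw [traceCoeff, ← Finset.sum_sub_distrib]
  congr 1
  refine Finset.sum_congr rfl fun k _ => ?_
  have h1 := mul_inv_apply hC (.inr i) (.inl k)
  rw [if_neg (by simp), Fintype.sum_sum_type] at h1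
  rw [Finset.sum_eq_single (a := i) (s := (Finset.univ : Finset (Fin s)))
    (h₀ := fun j _ hj => by rw [h0 j hj, zero_mul]) (h₁ := by simp)] at h1
  simp only [weighted, Fintype.sum_sum_type]
  rw [Finset.sum_eq_single (a := i) (s := (Finset.univ : Finset (Fin s)))
    (h₀ := fun j _ hj => by rw [h0 j hj]; ring) (h₁ := by simp)]
  have h2 : ∑ m, (weight b c k (.inr i) + conj (weight b c k (.inl m))) * C (.inr i) (.inl m) *
      C⁻¹ (.inl m) (.inl k) = weight b c k (.inr i) *
        (∑ m, C (.inr i) (.inl m) * C⁻¹ (.inl m) (.inl k)) +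
        C (.inr i) (.inl k) * C⁻¹ (.inl k) (.inl k) := by
    simp only [add_mul, Finset.sum_add_distrib, Finset.mul_sum, weight_inl, mul_assoc]
    congr 1
    rw [Finset.sum_eq_single k] <;> simp +contextual
  rw [h2, ← Finset.sum_mul]
  linear_combination (weight b c k (.inr i) + conj (weight b c k (.inr i))) * h1

/-- Without mixed entries, the diagonal entry of C C⁻¹ = 1 supplies the constant. The other products
C_mk C⁻¹_kk are imaginary, as C⁻¹_kk is real, so only k = m contributes. -/
theorem traceCoeff_inl_im {m : Fin r} (h0 : ∀ j, C (.inl m) (.inr j) = 0)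
    (h1 : ∀ k, k ≠ m → (C (.inl m) (.inl k)).re = 0) :
    (traceCoeff (weight b c) Sum.inl C (.inl m)).im =
      (1 + (C (.inl m) (.inl m)).re * (C⁻¹ (.inl m) (.inl m)).re) / 2 := by
  have h2 := mul_inv_apply hC (.inl m) (.inl m)
  rw [if_pos rfl, Fintype.sum_sum_type] at h2
  simp only [h0, zero_mul, Finset.sum_const_zero, add_zero] at h2
  have h3 : traceCoeff (weight b c) Sum.inl C (.inl m) = Complex.I / 2 *
      (1 + ∑ k, C (.inl m) (.inl k) * ((C⁻¹ (.inl k) (.inl k)).re : ℂ)) := by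
    rw [traceCoeff, ← h2]
    congr 1
    simp only [weighted, Fintype.sum_sum_type, h0, mul_zero, zero_mul, Finset.sum_const_zero,
      add_zero, add_mul, Finset.sum_add_distrib, weight_inl]
    congr 1
    · rw [Finset.sum_eq_single m] <;> simp +contextual [eq_comm]
    · refine Finset.sum_congr rfl fun k _ => ?_
      rw [Finset.sum_eq_single k] <;> simp +contextual [conj_inv_diag hC]
  have h4 : (∑ k, C (.inl m) (.inl k) * ((C⁻¹ (.inl k) (.inl k)).re : ℂ)).re =
      (C (.inl m) (.inl m)).re * (C⁻¹ (.inl m) (.inl m)).re := by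
    rw [Complex.re_sum, Finset.sum_eq_single m]
    · simp
    · intro k _ hk; simp [h1 k hk]
    · simp
  rw [h3]
  simp only [Complex.mul_im, Complex.add_re, h4]
  simp
  ring

theorem inv_diag_pos (a : Fin r ⊕ Fin s) : 0 < (C⁻¹ a a).re :=
  (Complex.pos_iff.1 hC.inv.diag_pos).1

theorem diag_pos (a : Fin r ⊕ Fin s) : 0 < (C a a).re :=
  (Complex.pos_iff.1 hC.diag_pos).1

/-- For a pluriclosed metric the mixed coefficients decrease along the flow. -/
theorem mixed_coeff_decreasing (e : Fin s ≃ Fin r)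
    (hb : ∀ k i, b k i = if k = e i then -1 else 0) {i : Fin s}
    (h0 : ∀ j, j ≠ i → C (.inr i) (.inr j) = 0)
    (h1 : ∀ l m, C (.inr i) (.inl m) * weight b c l (.inr i) =
      C (.inr i) (.inl l) * weight b c m (.inr i)) :
    ∃ κ : ℂ, κ.re < 0 ∧
      -(Complex.I / 2 * (traceCoeff (weight b c) Sum.inl C (.inr i) *
        weight b c (e i) (.inr i))) = C (.inr i) (.inl (e i)) * κ := by
  set μ : Fin r → ℂ := fun k => weight b c k (.inr i) with hμ
  -- Proportionality of the mixed row to μ lets C_{i,e(i)} be factored out, leaving this constant.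
  -- The linear sum has real part -(C⁻¹)_{e(i)e(i)}/2 < 0, and the double sum is the value of the
  -- positive form C⁻¹ at μ extended by zero.
  refine ⟨(∑ k, μ k * C⁻¹ (.inl k) (.inl k) -
    ∑ k, ∑ m, μ m * C⁻¹ (.inl m) (.inl k) * conj (μ k)) / 4, ?_, ?_⟩
  · have e1 : (∑ k, μ k * C⁻¹ (.inl k) (.inl k)).re = -(C⁻¹ (.inl (e i)) (.inl (e i))).re / 2 := by
      rw [Complex.re_sum, Finset.sum_eq_single (e i)]
      · rw [← conj_inv_diag hC, Complex.re_mul_ofReal, hμ]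
        simp [weight_inr, hb]
        ring
      · intro k _ hk
        rw [← conj_inv_diag hC, Complex.re_mul_ofReal, hμ]
        simp [weight_inr, hb, hk]
      · simp
    have e2 : ∑ k, ∑ m, μ m * C⁻¹ (.inl m) (.inl k) * conj (μ k) =
        hermForm C⁻¹ (Sum.elim μ 0) (Sum.elim μ 0) := by
      rw [hermForm, Finset.sum_comm]
      simp only [Fintype.sum_sum_type, Sum.elim_inl, Sum.elim_inr, Pi.zero_apply, map_zero,
        mul_zero, zero_mul, Finset.sum_const_zero, add_zero]
      exact Finset.sum_congr rfl fun _ _ => Finset.sum_congr rfl fun _ _ => by ring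
    have e3 : 0 ≤ (hermForm C⁻¹ (Sum.elim μ 0) (Sum.elim μ (0 : Fin s → ℂ))).re := by
      by_cases hx : (Sum.elim μ (0 : Fin s → ℂ)) = 0
      · rw [hx]; simp [hermForm]
      · exact (hermForm_self_pos hC.inv hx).le
    have e4 := inv_diag_pos hC (.inl (e i))
    rw [e2]
    have : ∀ z : ℂ, (z / 4).re = z.re / 4 := fun z => by simp
    rw [this, Complex.sub_re, e1]
    linarith
  · rw [traceCoeff_inr hC h0]
    have h2 : ∀ m, μ (e i) * C (.inr i) (.inl m) = C (.inr i) (.inl (e i)) * μ m := fun m => by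
      rw [← h1, mul_comm]
    have s1 : μ (e i) * ∑ k, C (.inr i) (.inl k) * C⁻¹ (.inl k) (.inl k) =
        C (.inr i) (.inl (e i)) * ∑ k, μ k * C⁻¹ (.inl k) (.inl k) := by
      simp only [Finset.mul_sum, ← mul_assoc, h2]
    have s2 : μ (e i) * ∑ k, ∑ m, C (.inr i) (.inl m) * C⁻¹ (.inl m) (.inl k) * conj (μ k) =
        C (.inr i) (.inl (e i)) * ∑ k, ∑ m, μ m * C⁻¹ (.inl m) (.inl k) * conj (μ k) := by
      simp only [Finset.mul_sum, ← mul_assoc, h2]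
    change -(Complex.I / 2 * (Complex.I / 2 * (_ - ∑ k, ∑ m, C (.inr i) (.inl m) *
      C⁻¹ (.inl m) (.inl k) * conj (μ k)) * μ (e i))) = _
    linear_combination (-Complex.I ^ 2 / 4) * (s1 - s2) - (C (.inr i) (.inl (e i)) / 4 *
      (∑ k, μ k * C⁻¹ (.inl k) (.inl k) -
        ∑ k, ∑ m, μ m * C⁻¹ (.inl m) (.inl k) * conj (μ k))) * Complex.I_sq

end

/-! ### The metric coefficients of a pluriclosed metric -/

/-- The coordinate z_k contributes 2 and the single w_i with e i = k contributes -1. -/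
theorem sum_weight (e : Fin s ≃ Fin r) (hb : ∀ k i, b k i = if k = e i then -1 else 0)
    (k : Fin r) : ∑ a, (weight b c k a + conj (weight b c k a)) = 1 := by
  have h : ∀ i, weight b c k (.inr i) + conj (weight b c k (.inr i)) =
      if e.symm k = i then -1 else 0 := fun i => by
    rw [weight_inr, hb, Complex.add_conj]
    by_cases hk : k = e i
    · subst hk; simp; norm_num
    · have : e.symm k ≠ i := fun h => hk (by rw [← h, e.apply_symm_apply])
      simp [hk, this]
  rw [Fintype.sum_sum_type]
  simp only [h, weight_inl]
  rw [Finset.sum_eq_single k] <;> simp +contextual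

section
variable {C : Matrix (Fin r ⊕ Fin s) (Fin r ⊕ Fin s) ℂ} {ω : Form r s 2}
  (hω : IsHermitianMetric ω) (hpl : IsPluriclosed ω)
include hω hpl

/-- On the diagonal the c's cancel in the exponent, which becomes b, and C_ii ≠ 0 by positivity. -/
theorem HasMatrix.quadratic (h : HasMatrix b c C ω) (hC : C.PosDef) (i : Fin s) (k l : Fin r) :
    b l i * (b k i + if k = l then 1 else 0) = 0 := by
  have h1 := h.pluriclosed_inr_inr hω hpl i i k l
  have hc : C (.inr i) (.inr i) ≠ 0 := fun h => by
    have := diag_pos hC (.inr i)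
    rw [h] at this
    simp at this
  have hbw : ∀ k, biweight b c (.inr i) (.inr i) k = (b k i : ℂ) := fun k => by
    simp only [biweight, weight_inr]
    rw [Complex.add_conj]
    simp
    ring
  rw [hbw, hbw, mul_assoc, mul_eq_zero, or_iff_right hc, Pi.single_apply] at h1
  have h2 : ((b l i * (b k i + if k = l then 1 else 0) : ℝ) : ℂ) = 0 := by
    rw [← h1]; push_cast; split <;> simp
  exact_mod_cast h2

/-- For i ≠ j the exponent in y_{e(i)} has real part -1/2, so neither it nor its shift by 1 can
vanish. -/
theorem HasMatrix.inr_inr_eq_zero (e : Fin s ≃ Fin r)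
    (hb : ∀ k i, b k i = if k = e i then -1 else 0) (h : HasMatrix b c C ω) {i j : Fin s}
    (hij : j ≠ i) : C (.inr i) (.inr j) = 0 := by
  have h1 := h.pluriclosed_inr_inr hω hpl i j (e i) (e i)
  have hre : (biweight b c (.inr i) (.inr j) (e i)).re = -(1 / 2) := by
    simp [biweight, weight_inr, hb, hij.symm]
    norm_num
  have n1 : biweight b c (.inr i) (.inr j) (e i) ≠ 0 := fun h => by
    rw [h] at hre; norm_num at hre
  have n2 : biweight b c (.inr i) (.inr j) (e i) + (Pi.single (e i) 1 : Fin r → ℂ) (e i) ≠ 0 :=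
    fun h => by
      have := congrArg Complex.re h
      rw [Complex.add_re, hre] at this
      norm_num at this
  rw [mul_eq_zero, mul_eq_zero] at h1
  tauto

/-- Taking k = e(i) in the mixed pluriclosed identity makes the second factor the same on both
sides. Its real part is ±1/2, because l and m cannot both equal e(i), so it cancels. -/
theorem HasMatrix.inr_inl_proportional (e : Fin s ≃ Fin r)
    (hb : ∀ k i, b k i = if k = e i then -1 else 0) (h : HasMatrix b c C ω) (i : Fin s)
    (l m : Fin r) : C (.inr i) (.inl m) * weight b c l (.inr i) =
      C (.inr i) (.inl l) * weight b c m (.inr i) := by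
  by_cases hlm : l = m
  · subst hlm; rfl
  have hbw : ∀ m k, biweight b c (.inr i) (.inl m) k =
      weight b c k (.inr i) + if m = k then 1 else 0 := fun m k => by
    simp only [biweight, weight_inl]
    split <;> simp
  have h1 := h.pluriclosed_inr_inl hω hpl i (e i) l m
  rw [hbw, hbw, hbw, hbw, if_neg (Ne.symm hlm), if_neg hlm, add_zero, add_zero,
    Pi.single_apply, Pi.single_apply] at h1
  set x := weight b c (e i) (.inr i) + (if m = e i then 1 else 0) +
    (if l = e i then 1 else 0) with hx
  have hxre : x.re ≠ 0 := by
    rw [hx, weight_inr, hb]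
    by_cases h1 : m = e i
    · have h2 : l ≠ e i := fun h => hlm (h.trans h1.symm)
      simp [h1, h2]; norm_num
    · by_cases h2 : l = e i
      · simp [h1, h2]; norm_num
      · simp [h1, h2]
  have hx0 : x ≠ 0 := fun h => hxre (by rw [h]; rfl)
  refine mul_right_cancel₀ hx0 ?_
  have e1 : ∀ n : Fin r, (if e i = n then (1 : ℂ) else 0) = if n = e i then 1 else 0 :=
    fun n => by simp [eq_comm]
  rw [e1, e1] at h1
  rw [hx]
  linear_combination h1

end

end

end OeljeklausToma

namespace OeljeklausToma

noncomputable section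

open ComplexConjugate
open scoped ComplexOrder

variable {r s : ℕ} {b c : Fin r → Fin s → ℝ}

/-! ### Derivatives at the initial time -/

theorem timeInterval_mem_nhdsGT {T : EReal} (hT : 0 < T) :
    timeInterval T ∈ nhdsWithin (0 : ℝ) (Set.Ioi 0) := by
  obtain ⟨x, hx0, hxT⟩ := EReal.lt_iff_exists_real_btwn.1 hT
  have hx : (0 : ℝ) < x := by exact_mod_cast hx0
  filter_upwards [Ioo_mem_nhdsGT hx] with t ht
  exact ⟨ht.1.le, lt_trans (by exact_mod_cast ht.2) hxT⟩

theorem zero_mem_timeInterval {T : EReal} (hT : 0 < T) : (0 : ℝ) ∈ timeInterval T :=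
  ⟨le_rfl, by simpa using hT⟩

theorem deriv_nonneg_of_le {T : EReal} (hT : 0 < T) {f : ℝ → ℝ} {d : ℝ}
    (hf : HasDerivWithinAt f d (Set.Ioi 0) 0) (h : ∀ t ∈ timeInterval T, f 0 ≤ f t) : 0 ≤ d := by
  rw [hasDerivWithinAt_iff_tendsto_slope' (by simp)] at hf
  refine ge_of_tendsto hf ?_
  filter_upwards [timeInterval_mem_nhdsGT hT, self_mem_nhdsWithin] with t ht ht0
  rw [slope_def_field]
  exact div_nonneg (sub_nonneg.2 (h t ht)) (sub_nonneg.2 (le_of_lt ht0))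

/-- Differentiating f = a² f(0) from the right at 0 gives 0 = 2 a'(0) f(0). -/
theorem eq_zero_of_quadratic_scaling {T : EReal} (hT : 0 < T) {a f : ℝ → ℝ} {d : ℝ}
    (ha0 : a 0 = 1) (hd : d ≠ 0) (ha : HasDerivWithinAt a d (Set.Ioi 0) 0)
    (hf : HasDerivWithinAt f 0 (Set.Ioi 0) 0)
    (h : ∀ t ∈ timeInterval T, f t = a t ^ 2 * f 0) : f 0 = 0 := by
  have h1 := (ha.pow 2).mul_const (f 0)
  have h2 : f =ᶠ[nhdsWithin (0 : ℝ) (Set.Ioi 0)] fun t => a t ^ 2 * f 0 := by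
    filter_upwards [timeInterval_mem_nhdsGT hT] with t ht using h t ht
  have h3 := h1.congr_of_eventuallyEq h2 (by simp [ha0])
  have h4 := (uniqueDiffWithinAt_Ioi (0 : ℝ)).eq_deriv _ hf h3
  rw [ha0] at h4
  simpa [hd] using h4.symm

theorem hasDerivWithinAt_normSq {f : ℝ → ℂ} {f' : ℂ} {S : Set ℝ} {t : ℝ}
    (hf : HasDerivWithinAt f f' S t) :
    HasDerivWithinAt (fun t => Complex.normSq (f t)) (2 * (conj (f t) * f').re) S t := by
  have h1 := Complex.reCLM.hasFDerivAt.comp_hasDerivWithinAt t hf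
  have h2 := Complex.imCLM.hasFDerivAt.comp_hasDerivWithinAt t hf
  have h3 := (h1.mul h1).add (h2.mul h2)
  refine (h3.congr_deriv ?_)
  simp
  ring

/-! ### Solitons -/

theorem pullback_apply {f : Ambient r s → Ambient r s} {ω : Form r s 2} (p u v : Ambient r s) :
    pullback f ω p ![u, v] = ω (f p) ![fderiv ℝ f p u, fderiv ℝ f p v] := by
  rw [pullback, ContinuousAlternatingMap.compContinuousLinearMap_apply]
  congr 1
  ext i : 1
  fin_cases i <;> rfl

theorem pullback_eq_self {f : Ambient r s → Ambient r s} (hf : ∀ p ∈ domain r s, f p = p)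
    (ω : Form r s 2) {p : Ambient r s} (hp : p ∈ domain r s) (u v : Ambient r s) :
    pullback f ω p ![u, v] = ω p ![u, v] := by
  have h : f =ᶠ[nhds p] id := by
    filter_upwards [isOpen_domain.mem_nhds hp] with q hq using hf q hq
  rw [pullback_apply, h.fderiv_eq, hf p hp]
  simp

section
variable {C : Matrix (Fin r ⊕ Fin s) (Fin r ⊕ Fin s) ℂ} {ω : Form r s 2}

/-- Up to a permutation and rescaling of the coordinates, the coefficients of an automorphism
pull-back are those of the original metric. -/
theorem exists_entry_pullback (e : Fin s ≃ Fin r)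
    (hb : ∀ k i, b k i = if k = e i then -1 else 0) (h : HasMatrix b c C ω) {a : ℝ}
    {f : Ambient r s → Ambient r s} (hf : IsAutomorphism b c f)
    (hpos : ∀ v, v ≠ 0 → 0 < (a • pullback f ω (base r s)) ![v, J r s v]) :
    ∃ (π : Fin s ≃ Fin r) (q : Fin s → ℂ), (∀ i, q i ≠ 0) ∧
      let E := entry fun u v => (a • pullback f ω (base r s)) ![u, v]
      (∀ k m, E (.inl (π k)) (.inl (π m)) = a * C (.inl (e k)) (.inl (e m))) ∧
      (∀ i k, E (.inr (e.symm (π i))) (.inl (π k)) = a * (q i * C (.inr i) (.inl (e k)))) ∧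
      ∀ i, E (.inr (e.symm (π i))) (.inr (e.symm (π i))) =
        a * (Complex.normSq (q i) * C (.inr i) (.inr i)) := by
  have hap : ∀ u v, (a • pullback f ω (base r s)) ![u, v] =
      a * ω (base r s) ![fderiv ℝ f (base r s) u, fderiv ℝ f (base r s) v] := fun u v => by
    rw [ContinuousAlternatingMap.smul_apply, pullback_apply, hf.map_base, smul_eq_mul]
  -- Positivity of the evolved metric already excludes a kernel, so invertibility of the
  -- differential need not be extracted from the group isomorphism.
  have hinj : ∀ u, fderiv ℝ f (base r s) u = 0 → u = 0 := fun u hu => by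
    by_contra hne
    have h1 := hpos u hne
    rw [hap, hu, (ω (base r s)).map_coord_zero 0 rfl] at h1
    simp at h1
  obtain ⟨π, q, hq, hP⟩ := hf.rigid e hb hinj
  have hl : ∀ k, fderiv ℝ f (base r s) (vec 1 (.inl (π k))) = vec 1 (.inl (e k)) := fun k => by
    refine ext_coord fun d => ?_
    rcases d with m | i
    · rw [← e.apply_symm_apply m, (hP _).1, coord_vec, coord_vec, Pi.single_apply,
        Pi.single_apply]
      simp [Equiv.symm_apply_eq]
    · rw [(hP _).2]; simp
  have hr : ∀ i, fderiv ℝ f (base r s) (vec 1 (.inr (e.symm (π i)))) = q i • vec 1 (.inr i) :=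
    fun i => by
    refine ext_coord fun d => ?_
    rcases d with m | j
    · rw [← e.apply_symm_apply m, (hP _).1]; simp
    · rw [(hP _).2, map_smul, coord_vec, coord_vec, Pi.single_apply, Pi.single_apply]
      by_cases hji : j = i
      · subst hji; simp
      · simp [hji]
  have hJ : ∀ u, fderiv ℝ f (base r s) (J r s u) = J r s (fderiv ℝ f (base r s) u) := fun u => by
    rw [hf.fderiv_eq base_mem, hf.fderiv_eq base_mem, J_apply, map_smul]; rfl
  have hE : ∀ a' d, entry (fun u v => (a • pullback f ω (base r s)) ![u, v]) a' d =
      a * hermForm C (fun t => coord t (fderiv ℝ f (base r s) (vec 1 a')))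
        (fun t => coord t (fderiv ℝ f (base r s) (vec 1 d))) := fun a' d => by
    rw [entry, hap, hap, hJ, h.apply_J base_mem, h.apply base_mem, hat_base, hat_base]
    apply Complex.ext <;> simp <;> ring
  have hv : ∀ d : Fin r ⊕ Fin s, (fun t => coord t (vec (r := r) (s := s) 1 d)) =
      Pi.single d 1 := fun d => funext fun t => coord_vec 1 d t
  have hv' : ∀ (z : ℂ) (d : Fin r ⊕ Fin s), (fun t => coord t (z • vec (r := r) (s := s) 1 d)) =
      z • Pi.single d 1 := fun z d => by
    rw [← hv]; funext t; rw [map_smul]; rfl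
  refine ⟨π, q, hq, fun k m => ?_, fun i k => ?_, fun i => ?_⟩
  · rw [hE, hl, hl, hv, hv, hermForm_single]
  · rw [hE, hl, hr, hv, hv', hermForm_smul_left, hermForm_single]
  · rw [hE, hr, hv', hermForm_smul_left, hermForm_smul_right, hermForm_single,
      Complex.normSq_eq_conj_mul_self]
    ring

theorem sum_perm (e π : Fin s ≃ Fin r) (f : Fin s → ℝ) :
    ∑ i, f (e.symm (π i)) = ∑ i, f i := Equiv.sum_comp (π.trans e.symm) f

variable (hs : 1 ≤ s) (e : Fin s ≃ Fin r) (hb : ∀ k i, b k i = if k = e i then -1 else 0)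
  (hω : IsHermitianMetric ω) (hpl : IsPluriclosed ω) {T : EReal} (hT : 0 < T)
include hs hb hω hpl hT

/-- A pluriclosed algebraic soliton is diagonal in the standard coframe, with a common coefficient
on the hyperbolic factors. -/
theorem IsExpandingAlgebraicSoliton.matrix_eq (h : HasMatrix b c C ω) (hC : C.PosDef)
    (hsol : IsExpandingAlgebraicSoliton b c T ω) :
    ∃ A : ℝ, C = Matrix.diagonal (Sum.elim (fun _ => (A : ℂ)) fun i => C (.inr i) (.inr i)) := by
  obtain ⟨a, φ, ha0, hφ0, haut, hmono, hflow⟩ := hsol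
  have h0 := zero_mem_timeInterval hT
  have hC0 : HasMatrix b c C (fun p => a 0 • pullback (φ 0) ω p) := fun q hq u v => by
    change (a 0 • pullback (φ 0) ω q) ![u, v] = _
    rw [ha0, one_smul, pullback_eq_self hφ0 ω hq]
    exact h q hq u v
  obtain ⟨-, -, Γ, hΓ, hd⟩ := hflow 0 h0
  have hw := sum_weight (c := c) e hb
  set E : ℝ → Fin r ⊕ Fin s → Fin r ⊕ Fin s → ℂ := fun t =>
    entry fun u v => (a t • pullback (φ t) ω (base r s)) ![u, v] with hE
  have hE0 : ∀ x y, E 0 x y = C x y := hC0.entry_eq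
  have hEd : ∀ x y, HasDerivWithinAt (fun t => E t x y)
      (-entry (ricciForm11 Γ (base r s)) x y) (Set.Ioi 0) 0 := fun x y => by
    have h1 := fun u v => ((hd (base r s) base_mem u v).mono_of_mem_nhdsWithin
      (timeInterval_mem_nhdsGT hT)).ofReal_comp
    refine (((h1 (vec 1 x) (J r s (vec 1 y))).sub
      ((h1 (vec 1 x) (vec 1 y)).const_mul Complex.I)).div_const 2).congr_deriv ?_
    rw [entry]
    push_cast
    ring
  have hscale : ∀ t ∈ timeInterval T, ∃ (π : Fin s ≃ Fin r) (q : Fin s → ℂ), (∀ i, q i ≠ 0) ∧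
      (∀ k m, E t (.inl (π k)) (.inl (π m)) = a t * C (.inl (e k)) (.inl (e m))) ∧
      (∀ i k, E t (.inr (e.symm (π i))) (.inl (π k)) = a t * (q i * C (.inr i) (.inl (e k)))) ∧
      ∀ i, E t (.inr (e.symm (π i))) (.inr (e.symm (π i))) =
        a t * (Complex.normSq (q i) * C (.inr i) (.inr i)) := fun t ht =>
    exists_entry_pullback e hb h (haut t ht).2 ((hflow t ht).1.2.2 (base r s) base_mem)
  have hww : ∀ i j, j ≠ i → C (.inr i) (.inr j) = 0 := fun i j hij =>
    h.inr_inr_eq_zero hω hpl e hb hij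
  have hprop := h.inr_inl_proportional hω hpl e hb
  have hre : ∀ k m, k ≠ m → (C (.inl k) (.inl m)).re = 0 := fun k m hkm =>
    h.pluriclosed_inl_inl hω hpl hkm
  have hBim : ∀ i, ((C (.inr i) (.inr i)).re : ℂ) = C (.inr i) (.inr i) := fun i =>
    Complex.conj_eq_iff_re.1 (hC.isHermitian.apply _ _)
  have hmixed : ∀ i k, C (.inr i) (.inl k) = 0 := by
    choose κ hκ hκd using fun i => mixed_coeff_decreasing (c := c) hC e hb (hww i) (hprop i)
    -- The quotient is insensitive to the rescalings q_i and the sum to the permutation, so V scales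
    -- exactly by a_t. Since the denominators have zero derivative at 0, the decay of the numerators
    -- alone gives V'(0).
    set V : ℝ → ℝ := fun t => ∑ i, Complex.normSq (E t (.inr i) (.inl (e i))) /
      (E t (.inr i) (.inr i)).re with hV
    have hVd : HasDerivWithinAt V (∑ i, 2 * (κ i).re *
        (Complex.normSq (C (.inr i) (.inl (e i))) / (C (.inr i) (.inr i)).re))
        (Set.Ioi 0) 0 := by
      refine HasDerivWithinAt.fun_sum fun i _ => ?_
      have d1 := hasDerivWithinAt_normSq (hEd (.inr i) (.inl (e i)))
      have d2 := Complex.reCLM.hasFDerivAt.comp_hasDerivWithinAt 0 (hEd (.inr i) (.inr i))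
      have hne := (diag_pos hC (.inr i)).ne'
      rw [hΓ.entry_ricci_inr_inl hC hw hC0, hκd, hE0] at d1
      rw [hΓ.entry_ricci_inr_inr hC hw hC0] at d2
      refine (d1.div d2 (by simpa [hE0] using hne)).congr_deriv ?_
      have hn : conj (C (.inr i) (.inl (e i))) * (C (.inr i) (.inl (e i)) * κ i) =
          (Complex.normSq (C (.inr i) (.inl (e i))) : ℂ) * κ i := by
        rw [Complex.normSq_eq_conj_mul_self]; ring
      simp only [hn, Function.comp_apply, Complex.reCLM_apply, hE0, neg_zero, Complex.zero_re,
        mul_zero, sub_zero, Complex.re_ofReal_mul]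
      field_simp
    have hV0 : V 0 = ∑ i, Complex.normSq (C (.inr i) (.inl (e i))) / (C (.inr i) (.inr i)).re := by
      simp only [hV, hE0]
    have hnn : ∀ i, 0 ≤ Complex.normSq (C (.inr i) (.inl (e i))) / (C (.inr i) (.inr i)).re :=
      fun i => div_nonneg (Complex.normSq_nonneg _) (diag_pos hC _).le
    have hVs : ∀ t ∈ timeInterval T, V t = a t * V 0 := fun t ht => by
      obtain ⟨π, q, hq, -, h2, h3⟩ := hscale t ht
      have hat := (haut t ht).1.ne'
      rw [hV0, Finset.mul_sum]
      simp only [hV]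
      rw [← sum_perm e π]
      refine Finset.sum_congr rfl fun i _ => ?_
      rw [e.apply_symm_apply, h2, h3, Complex.re_ofReal_mul, Complex.re_ofReal_mul,
        Complex.normSq_mul, Complex.normSq_mul, Complex.normSq_ofReal]
      have := (diag_pos hC (.inr i)).ne'
      have := Complex.normSq_pos.2 (hq i) |>.ne'
      field_simp
    have hVle : ∀ t ∈ timeInterval T, V 0 ≤ V t := fun t ht => by
      rw [hVs t ht]
      have h1 : 1 ≤ a t := by rw [← ha0]; exact hmono.monotoneOn h0 ht ht.1
      have h2 : 0 ≤ V 0 := by rw [hV0]; exact Finset.sum_nonneg fun i _ => hnn i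
      nlinarith
    have hge := deriv_nonneg_of_le hT hVd hVle
    have hle : ∀ i, 2 * (κ i).re *
        (Complex.normSq (C (.inr i) (.inl (e i))) / (C (.inr i) (.inr i)).re) ≤ 0 := fun i =>
      mul_nonpos_of_nonpos_of_nonneg (by linarith [hκ i]) (hnn i)
    have hz := (Finset.sum_eq_zero_iff_of_nonpos fun i _ => hle i).1
      (le_antisymm (Finset.sum_nonpos fun i _ => hle i) hge)
    intro i k
    have hzi := hz i (Finset.mem_univ i)
    have hp : C (.inr i) (.inl (e i)) = 0 := by
      rw [mul_eq_zero, div_eq_zero_iff, Complex.normSq_eq_zero] at hzi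
      rcases hzi with hzi | hzi | hzi
      · linarith [hκ i]
      · exact hzi
      · exact absurd hzi (diag_pos hC _).ne'
    -- The weight at e(i) has real part -1/2, so proportionality spreads the vanishing of this one
    -- entry to the whole mixed row.
    have hpk := hprop i (e i) k
    rw [hp, zero_mul, mul_eq_zero] at hpk
    refine hpk.resolve_right fun h => ?_
    have := congrArg Complex.re h
    simp [weight_inr, hb] at this
  have hmixed' : ∀ k i, C (.inl k) (.inr i) = 0 := fun k i => by
    rw [← hC.isHermitian.apply, hmixed, star_zero]
  set D : Fin r → ℝ := fun m => (1 + (C (.inl m) (.inl m)).re * (C⁻¹ (.inl m) (.inl m)).re) / 2 -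
    1 / 4 with hD
  have hdiag : ∀ m, HasDerivWithinAt (fun t => (E t (.inl m) (.inl m)).re) (D m)
      (Set.Ioi 0) 0 := fun m => by
    have d2 := Complex.reCLM.hasFDerivAt.comp_hasDerivWithinAt 0 (hEd (.inl m) (.inl m))
    rw [hΓ.entry_ricci_inl_inl hC hw hC0, if_pos rfl,
      traceCoeff_inl_im hC (hmixed' m) fun k hk => hre m k hk.symm] at d2
    refine d2.congr_deriv ?_
    rw [← Complex.ofReal_neg, Complex.reCLM_apply, Complex.ofReal_re, hD]
    ring
  have hoff : ∀ k m, k ≠ m → HasDerivWithinAt (fun t => E t (.inl k) (.inl m)) 0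
      (Set.Ioi 0) 0 := fun k m hkm => by
    have := hEd (.inl k) (.inl m)
    rwa [hΓ.entry_ricci_inl_inl hC hw hC0, if_neg hkm, neg_zero] at this
  have hDpos : ∀ m, 0 < D m := fun m => by
    have := mul_pos (diag_pos hC (.inl m)) (inv_diag_pos hC (.inl m))
    simp only [hD]
    linarith
  have hr : Nonempty (Fin r) := ⟨e ⟨0, hs⟩⟩
  set S₀ := ∑ m, (C (.inl m) (.inl m)).re with hS₀
  have hS₀pos : 0 < S₀ := Finset.sum_pos (fun m _ => diag_pos hC _) Finset.univ_nonempty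
  -- The scaling a is not assumed differentiable. The trace of the z-block is permutation invariant,
  -- so it recovers a_t and transfers its derivative, which is positive.
  have ha : HasDerivWithinAt a ((∑ m, D m) / S₀) (Set.Ioi 0) 0 := by
    have d := (HasDerivWithinAt.fun_sum (u := Finset.univ) fun m _ => hdiag m).div_const S₀
    have hat : ∀ t ∈ timeInterval T, a t = (∑ m, (E t (.inl m) (.inl m)).re) / S₀ :=
      fun t ht => by
      obtain ⟨π, q, -, h1, -⟩ := hscale t ht
      rw [eq_div_iff hS₀pos.ne', hS₀, ← Equiv.sum_comp π fun m => (E t (.inl m) (.inl m)).re,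
        ← Equiv.sum_comp e fun m => (C (.inl m) (.inl m)).re, Finset.mul_sum]
      simp only [h1, Complex.re_ofReal_mul]
    refine d.congr_of_eventuallyEq ?_ (hat 0 h0)
    filter_upwards [timeInterval_mem_nhdsGT hT] with t ht using hat t ht
  have hane : (∑ m, D m) / S₀ ≠ 0 :=
    (div_pos (Finset.sum_pos (fun m _ => hDpos m) Finset.univ_nonempty) hS₀pos).ne'
  have hzz : ∀ k m, k ≠ m → C (.inl k) (.inl m) = 0 := by
    -- Off-diagonal entries receive no Ricci contribution, so F'(0) = 0, although F scales by a_t².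
    set F : ℝ → ℝ := fun t => ∑ k, ∑ m, if k = m then 0 else
      Complex.normSq (E t (.inl k) (.inl m)) with hF
    have hFd : HasDerivWithinAt F 0 (Set.Ioi 0) 0 := by
      have : HasDerivWithinAt F (∑ k : Fin r, ∑ m : Fin r, 0) (Set.Ioi 0) 0 := by
        refine HasDerivWithinAt.fun_sum fun k _ => HasDerivWithinAt.fun_sum fun m _ => ?_
        by_cases hkm : k = m
        · simpa [hkm] using hasDerivWithinAt_const (0 : ℝ) (Set.Ioi (0 : ℝ)) (0 : ℝ)
        · simpa [hkm] using hasDerivWithinAt_normSq (hoff k m hkm)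
      simpa using this
    have hF0 := eq_zero_of_quadratic_scaling hT ha0 hane ha hFd fun t ht => by
      obtain ⟨π, q, -, h1, -⟩ := hscale t ht
      simp only [hF, Finset.mul_sum]
      rw [← Equiv.sum_comp π, ← Equiv.sum_comp e]
      refine Finset.sum_congr rfl fun k _ => ?_
      rw [← Equiv.sum_comp π, ← Equiv.sum_comp e]
      refine Finset.sum_congr rfl fun m _ => ?_
      rw [h1, Complex.normSq_mul, Complex.normSq_ofReal, hE0]
      simp only [EmbeddingLike.apply_eq_iff_eq]
      split
      · simp
      · ring
    intro k m hkm
    have hnn : ∀ k m, 0 ≤ if k = m then 0 else Complex.normSq (E 0 (.inl k) (.inl m)) :=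
      fun k m => by split; exacts [le_rfl, Complex.normSq_nonneg _]
    have h1 := (Finset.sum_eq_zero_iff_of_nonneg
      (fun k _ => Finset.sum_nonneg fun m _ => hnn k m)).1 hF0 k (Finset.mem_univ k)
    have h2 := (Finset.sum_eq_zero_iff_of_nonneg (fun m _ => hnn k m)).1 h1 m (Finset.mem_univ m)
    rw [if_neg hkm, Complex.normSq_eq_zero, hE0] at h2
    exact h2
  -- With C now diagonal on the z-block and no mixed entries, C_mm C⁻¹_mm = 1, so D_m = 1 - 1/4 for
  -- every m.
  have hD34 : ∀ m, D m = 3 / 4 := fun m => by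
    have h2 := mul_inv_apply hC (.inl m) (.inl m)
    rw [if_pos rfl, Fintype.sum_sum_type, Finset.sum_eq_single m
      (fun k _ hk => by rw [hzz m k hk.symm, zero_mul]) (by simp)] at h2
    simp only [hmixed', zero_mul, Finset.sum_const_zero, add_zero] at h2
    rw [← conj_inv_diag hC] at h2
    have h3 := congrArg Complex.re h2
    rw [Complex.re_mul_ofReal, Complex.one_re] at h3
    simp only [hD, h3]
    norm_num
  have heq : ∀ k m, (C (.inl k) (.inl k)).re = (C (.inl m) (.inl m)).re := by
    -- All diagonal entries grow at the same rate 3/4, so their differences are stationary at 0,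
    -- while the sum of squares scales by a_t².
    set F : ℝ → ℝ := fun t => ∑ k, ∑ m, ((E t (.inl k) (.inl k)).re -
      (E t (.inl m) (.inl m)).re) ^ 2 with hF
    have hFd : HasDerivWithinAt F 0 (Set.Ioi 0) 0 := by
      have : HasDerivWithinAt F (∑ k : Fin r, ∑ m : Fin r, 0) (Set.Ioi 0) 0 := by
        refine HasDerivWithinAt.fun_sum fun k _ => HasDerivWithinAt.fun_sum fun m _ => ?_
        have := ((hdiag k).sub (hdiag m)).pow 2
        rw [hD34, hD34, sub_self, mul_zero] at this
        exact this
      simpa using this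
    have hF0 := eq_zero_of_quadratic_scaling hT ha0 hane ha hFd fun t ht => by
      obtain ⟨π, q, -, h1, -⟩ := hscale t ht
      simp only [hF, Finset.mul_sum]
      rw [← Equiv.sum_comp π, ← Equiv.sum_comp e]
      refine Finset.sum_congr rfl fun k _ => ?_
      rw [← Equiv.sum_comp π, ← Equiv.sum_comp e]
      refine Finset.sum_congr rfl fun m _ => ?_
      rw [h1, h1, Complex.re_ofReal_mul, Complex.re_ofReal_mul, hE0, hE0]
      ring
    intro k m
    have h1 := (Finset.sum_eq_zero_iff_of_nonneg
      (fun k _ => Finset.sum_nonneg fun m _ => sq_nonneg _)).1 hF0 k (Finset.mem_univ k)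
    have h2 := (Finset.sum_eq_zero_iff_of_nonneg (fun m _ => sq_nonneg _)).1 h1 m
      (Finset.mem_univ m)
    rw [hE0, hE0] at h2
    exact sub_eq_zero.1 (pow_eq_zero_iff two_ne_zero |>.1 h2)
  obtain ⟨m₀⟩ := hr
  refine ⟨(C (.inl m₀) (.inl m₀)).re, ?_⟩
  ext x y
  rw [Matrix.diagonal_apply]
  rcases x with k | i <;> rcases y with m | j
  · by_cases hkm : k = m
    · subst hkm
      rw [if_pos rfl, Sum.elim_inl, ← heq k m₀]
      exact (Complex.conj_eq_iff_re.1 (hC.isHermitian.apply _ _)).symm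
    · rw [if_neg (by simpa using hkm), hzz k m hkm]
  · rw [if_neg (by simp), hmixed']
  · rw [if_neg (by simp), hmixed]
  · by_cases hij : i = j
    · subst hij; rw [if_pos rfl, Sum.elim_inr]
    · rw [if_neg (by simpa using hij), hww i j (Ne.symm hij)]

end

end

end OeljeklausToma

namespace OeljeklausToma

noncomputable section

open ComplexConjugate
open scoped ComplexOrder

variable {r s : ℕ} {b c : Fin r → Fin s → ℝ}

/-! ### Pull-back by linear maps -/

section
variable (L : Ambient r s →L[ℂ] Ambient r s)

theorem fderiv_linear (p u : Ambient r s) : fderiv ℝ L p u = L u := by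
  rw [(L.hasFDerivAt.restrictScalars ℝ).fderiv]; rfl

theorem pullback_linear {n : ℕ} (ω : Form r s n) :
    pullback L ω = fun p => (ω (L p)).compContinuousLinearMap (L.restrictScalars ℝ) := by
  funext p
  rw [pullback, (L.hasFDerivAt.restrictScalars ℝ).fderiv]

variable {L}

theorem extDeriv_pullback_linear {n : ℕ} {ω : Form r s n} {p : Ambient r s}
    (hω : DifferentiableAt ℝ ω (L p)) :
    extDeriv (fun p => (ω (L p)).compContinuousLinearMap (L.restrictScalars ℝ)) p =
      (extDeriv ω (L p)).compContinuousLinearMap (L.restrictScalars ℝ) := by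
  have h := extDeriv_pullback (x := p) hω
    ((L.restrictScalars ℝ).contDiff (n := ((⊤ : ℕ∞) : WithTop ℕ∞))).contDiffAt
    (by simp; norm_cast)
  simpa only [ContinuousLinearMap.coe_restrictScalars',
    (L.hasFDerivAt.restrictScalars ℝ).fderiv] using h

variable (hL : ∀ p ∈ domain r s, L p ∈ domain r s)
include hL

theorem IsHermitianMetric.pullback_linear {ω : Form r s 2} (hω : IsHermitianMetric ω)
    (hinj : ∀ u, L u = 0 → u = 0) {a : ℝ} (ha : 0 < a) :
    IsHermitianMetric fun p => a • pullback L ω p := by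
  have hap : ∀ p u v, (a • pullback L ω p) ![u, v] = a * ω (L p) ![L u, L v] := fun p u v => by
    rw [ContinuousAlternatingMap.smul_apply, pullback_apply, fderiv_linear, fderiv_linear,
      smul_eq_mul]
  have hJ : ∀ u, L (J r s u) = J r s (L u) := fun u => by rw [J_apply, map_smul]; rfl
  refine ⟨?_, fun p hp u v => ?_, fun p hp v hv => ?_⟩
  · rw [OeljeklausToma.pullback_linear]
    have h1 : ContDiffOn ℝ ((⊤ : ℕ∞) : WithTop ℕ∞) (fun p => ω (L p)) (domain r s) :=
      hω.1.comp (L.restrictScalars ℝ).contDiff.contDiffOn hL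
    exact (ContDiff.comp_contDiffOn
      (g := ⇑(ContinuousAlternatingMap.compContinuousLinearMapCLM (F := ℝ) (ι := Fin 2)
        (L.restrictScalars ℝ))) (ContinuousLinearMap.contDiff _) h1).const_smul a
  · rw [hap, hap, hJ, hJ, hω.2.1 _ (hL p hp)]
  · rw [hap, hJ]
    exact mul_pos ha (hω.2.2 _ (hL p hp) _ fun h => hv (hinj v h))

theorem IsPluriclosed.pullback_linear {ω : Form r s 2} (hω : IsHermitianMetric ω)
    (hpl : IsPluriclosed ω) (a : ℝ) : IsPluriclosed fun p => a • pullback L ω p := by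
  intro p hp
  rw [OeljeklausToma.pullback_linear]
  have h1 : ∀ q ∈ domain r s, extDeriv
      (fun p => a • (ω (L p)).compContinuousLinearMap (L.restrictScalars ℝ)) q =
      a • (extDeriv ω (L q)).compContinuousLinearMap (L.restrictScalars ℝ) := fun q hq => by
    rw [← extDeriv_pullback_linear ((hω.1.contDiffAt
      (isOpen_domain.mem_nhds (hL q hq))).differentiableAt (by simp))]
    exact extDeriv_smul a _
  have h2 : (fun q => (extDeriv
      (fun p => a • (ω (L p)).compContinuousLinearMap (L.restrictScalars ℝ)) q
      ).compContinuousLinearMap (J r s)) =ᶠ[nhds p]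
      a • fun q => ((extDeriv ω (L q)).compContinuousLinearMap (J r s)).compContinuousLinearMap
        (L.restrictScalars ℝ) := by
    filter_upwards [isOpen_domain.mem_nhds hp] with q hq
    rw [h1 q hq]
    ext v
    change a * extDeriv ω (L q) (fun i => L (J r s (v i))) =
      a * extDeriv ω (L q) (fun i => J r s (L (v i)))
    simp only [J_apply, map_smul]
  rw [h2.extDeriv_eq, extDeriv_smul, extDeriv_pullback_linear
    (((contDiffOn_extDeriv_J hω.1).contDiffAt
      (isOpen_domain.mem_nhds (hL p hp))).differentiableAt (by simp)), hpl _ (hL p hp)]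
  ext v
  simp

end

/-! ### Dilations of the complex factors -/

/-- The map `(z, w) ↦ (z, l w)`. -/
def dilation (r s : ℕ) (l : ℝ) : Ambient r s →L[ℂ] Ambient r s :=
  (ContinuousLinearMap.fst ℂ _ _).prod ((l : ℂ) • ContinuousLinearMap.snd ℂ _ _)

theorem dilation_apply (l : ℝ) (p : Ambient r s) : dilation r s l p = (p.1, (l : ℂ) • p.2) := rfl

theorem dilation_mem (l : ℝ) {p : Ambient r s} (hp : p ∈ domain r s) :
    dilation r s l p ∈ domain r s := hp

/-- The w-part of the product is linear in the two w-components, with coefficients depending only on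
y, hence commutes with scaling w. -/
theorem isAutomorphism_dilation {l : ℝ} (hl : l ≠ 0) :
    IsAutomorphism b c (dilation r s l) := by
  have hl' : (l : ℂ) ≠ 0 := by exact_mod_cast hl
  refine ⟨(dilation r s l).contDiff.contDiffOn,
    { toFun := fun p => ⟨dilation r s l p.1, dilation_mem l p.2⟩
      invFun := fun p => ⟨dilation r s l⁻¹ p.1, dilation_mem l⁻¹ p.2⟩
      left_inv := fun p => Subtype.ext ?_
      right_inv := fun p => Subtype.ext ?_
      map_mul' := fun p q => Subtype.ext ?_ }, fun p => rfl⟩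
  · refine Prod.ext rfl ?_
    change ((l⁻¹ : ℝ) : ℂ) • (l : ℂ) • p.1.2 = p.1.2
    rw [Complex.ofReal_inv, inv_smul_smul₀ hl']
  · refine Prod.ext rfl ?_
    change (l : ℂ) • ((l⁻¹ : ℝ) : ℂ) • p.1.2 = p.1.2
    rw [Complex.ofReal_inv, smul_inv_smul₀ hl']
  · change dilation r s l (mul b c p.1 q.1) = mul b c (dilation r s l p.1) (dilation r s l q.1)
    refine Prod.ext rfl (funext fun i => ?_)
    simp [dilation_apply, mul]
    ring

theorem hat_dilation (l : ℝ) (p u : Ambient r s) :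
    hat b c (dilation r s l p) (dilation r s l u) =
      Sum.elim (fun k => hat b c p u (.inl k)) fun i => l * hat b c p u (.inr i) := by
  funext a
  rcases a with k | i
  · rfl
  · simp only [hat_apply, theta_apply, coord_inr, Sum.elim_inr]
    change powFactor (fun k => weight b c k (.inr i)) p * (l * u.2 i) = _
    ring

/-- The matrix of the metric `√-1 ∑ (A ω_i ∧ ω̄_i + B_i γ_i ∧ γ̄_i)`. -/
def diagMatrix (r : ℕ) {s : ℕ} (A : ℝ) (B : Fin s → ℝ) :
    Matrix (Fin r ⊕ Fin s) (Fin r ⊕ Fin s) ℂ :=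
  Matrix.diagonal (Sum.elim (fun _ => (A : ℂ)) fun i => (B i : ℂ))

theorem hermForm_diagonal {ι : Type*} [Fintype ι] [DecidableEq ι] (D x y : ι → ℂ) :
    hermForm (Matrix.diagonal D) x y = ∑ a, D a * x a * conj (y a) := by
  rw [hermForm]
  refine Finset.sum_congr rfl fun a _ => ?_
  rw [Finset.sum_eq_single a]
  · rw [Matrix.diagonal_apply_eq]
  · intro d _ hd
    rw [Matrix.diagonal_apply_ne _ hd.symm, zero_mul, zero_mul]
  · simp

theorem hermForm_diagMatrix (A : ℝ) (B : Fin s → ℝ) (x y : Fin r ⊕ Fin s → ℂ) :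
    hermForm (diagMatrix r A B) x y = A * ∑ k, x (.inl k) * conj (y (.inl k)) +
      ∑ i, B i * (x (.inr i) * conj (y (.inr i))) := by
  rw [diagMatrix, hermForm_diagonal, Fintype.sum_sum_type, Finset.mul_sum]
  simp only [Sum.elim_inl, Sum.elim_inr, mul_assoc]

/-- The dilation multiplies the w-block by l², cancelling the scaling a there and leaving it only on
the z-block. This matches a flow in which only A moves. -/
theorem HasMatrix.smul_pullback_dilation {A : ℝ} {B : Fin s → ℝ} {ω : Form r s 2}
    (h : HasMatrix b c (diagMatrix r A B) ω) {a l : ℝ} (hal : a * l ^ 2 = 1) :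
    HasMatrix b c (diagMatrix r (a * A) B) fun p => a • pullback (dilation r s l) ω p := by
  intro p hp u v
  change (a • pullback (dilation r s l) ω p) ![u, v] = _
  rw [ContinuousAlternatingMap.smul_apply, pullback_apply, fderiv_linear, fderiv_linear,
    h _ (dilation_mem l hp), hat_dilation, hat_dilation, hermForm_diagMatrix, hermForm_diagMatrix,
    smul_eq_mul]
  simp only [Sum.elim_inl, Sum.elim_inr]
  have hal' : (a : ℂ) * l ^ 2 = 1 := by exact_mod_cast hal
  have e : (a : ℂ) * (A * ∑ k, hat b c p u (.inl k) * conj (hat b c p v (.inl k)) +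
      ∑ i, B i * (l * hat b c p u (.inr i) * conj (l * hat b c p v (.inr i)))) =
      ((a * A : ℝ) : ℂ) * ∑ k, hat b c p u (.inl k) * conj (hat b c p v (.inl k)) +
      ∑ i, B i * (hat b c p u (.inr i) * conj (hat b c p v (.inr i))) := by
    have e2 : (a : ℂ) * ∑ i, B i * (l * hat b c p u (.inr i) * conj (l * hat b c p v (.inr i))) =
        ∑ i, B i * (hat b c p u (.inr i) * conj (hat b c p v (.inr i))) := by
      rw [Finset.mul_sum]
      refine Finset.sum_congr rfl fun i _ => ?_
      rw [map_mul, Complex.conj_ofReal]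
      linear_combination (B i * (hat b c p u (.inr i) * conj (hat b c p v (.inr i)))) * hal'
    rw [mul_add, e2]
    push_cast
    ring
  rw [← e, Complex.im_ofReal_mul]
  ring

end

end OeljeklausToma

namespace OeljeklausToma

noncomputable section

open ComplexConjugate
open scoped ComplexOrder

variable {r s : ℕ} {b c : Fin r → Fin s → ℝ}

/-! ### The Bismut connection of a diagonal metric -/

/-- The Christoffel symbols, in the standard left-invariant frame, of the Bismut connection of
a diagonal metric. -/
def bismutSymbol (e : Fin s ≃ Fin r) (A : ℝ) (B : Fin s → ℝ) :
    (Fin r ⊕ Fin s → ℂ) →ₗ[ℝ] (Fin r ⊕ Fin s → ℂ) →ₗ[ℝ] (Fin r ⊕ Fin s → ℂ) :=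
  LinearMap.mk₂ ℝ (fun x y => Sum.elim
      (fun k => Complex.I * (y (.inl k) * x (.inl k)) - Complex.I / 2 * (B (e.symm k) / A : ℝ) *
        (y (.inr (e.symm k)) * conj (x (.inr (e.symm k)))))
      (fun i => Complex.I / 2 *
        (conj (x (.inl (e i))) * y (.inr i) - y (.inl (e i)) * x (.inr i))))
    (fun x x' y => by
      funext a; rcases a with k | i <;>
        simp only [Pi.add_apply, map_add, Sum.elim_inl, Sum.elim_inr] <;> ring)
    (fun t x y => by
      funext a; rcases a with k | i <;>
        simp only [Pi.smul_apply, Complex.real_smul, map_mul, Complex.conj_ofReal, Sum.elim_inl,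
          Sum.elim_inr] <;> ring)
    (fun x y y' => by
      funext a; rcases a with k | i <;>
        simp only [Pi.add_apply, Sum.elim_inl, Sum.elim_inr] <;> ring)
    (fun t x y => by
      funext a; rcases a with k | i <;>
        simp only [Pi.smul_apply, Complex.real_smul, Sum.elim_inl, Sum.elim_inr] <;> ring)

theorem bismutSymbol_inl (e : Fin s ≃ Fin r) (A : ℝ) (B : Fin s → ℝ) (x y) (k : Fin r) :
    bismutSymbol e A B x y (.inl k) = Complex.I * (y (.inl k) * x (.inl k)) -
      Complex.I / 2 * (B (e.symm k) / A : ℝ) *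
        (y (.inr (e.symm k)) * conj (x (.inr (e.symm k)))) := rfl

theorem bismutSymbol_inr (e : Fin s ≃ Fin r) (A : ℝ) (B : Fin s → ℝ) (x y) (i : Fin s) :
    bismutSymbol e A B x y (.inr i) = Complex.I / 2 *
      (conj (x (.inl (e i))) * y (.inr i) - y (.inl (e i)) * x (.inr i)) := rfl

theorem bismutSymbol_I_smul (e : Fin s ≃ Fin r) (A : ℝ) (B : Fin s → ℝ) (x y) :
    bismutSymbol e A B x (Complex.I • y) = Complex.I • bismutSymbol e A B x y := by
  funext a
  rcases a with k | i
  · simp only [bismutSymbol_inl, Pi.smul_apply, smul_eq_mul]; ring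
  · simp only [bismutSymbol_inr, Pi.smul_apply, smul_eq_mul]; ring

/-- The real linear map `u ↦ hat b c p u`. -/
def hatL (b c : Fin r → Fin s → ℝ) (p : Ambient r s) :
    Ambient r s →ₗ[ℝ] (Fin r ⊕ Fin s → ℂ) where
  toFun := hat b c p
  map_add' := hat_add b c p
  map_smul' t u := by
    rw [RingHom.id_apply, ← Complex.coe_smul t u, hat_smul]
    rfl

/-- The real linear map `x ↦ frame b c p x`. -/
def frameL (b c : Fin r → Fin s → ℝ) (p : Ambient r s) :
    (Fin r ⊕ Fin s → ℂ) →ₗ[ℝ] Ambient r s where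
  toFun := frame b c p
  map_add' x y := by
    refine ext_coord fun a => ?_
    simp [frame, mul_add]
  map_smul' t x := by
    rw [RingHom.id_apply, ← Complex.coe_smul t (frame b c p x), ← frame_smul]
    rfl

/-- The left-invariant connection with Christoffel symbols `β` in the standard frame. -/
def christoffelOf (b c : Fin r → Fin s → ℝ)
    (β : (Fin r ⊕ Fin s → ℂ) →ₗ[ℝ] (Fin r ⊕ Fin s → ℂ) →ₗ[ℝ] (Fin r ⊕ Fin s → ℂ)) :
    Christoffel r s := fun p =>
  ((β.compl₁₂ (hatL b c p) (hatL b c p)).compr₂ (frameL b c p)).toContinuousBilinearMap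

theorem christoffelOf_apply (β : (Fin r ⊕ Fin s → ℂ) →ₗ[ℝ] (Fin r ⊕ Fin s → ℂ) →ₗ[ℝ]
    (Fin r ⊕ Fin s → ℂ)) (p u v : Ambient r s) :
    christoffelOf b c β p u v = frame b c p (β (hat b c p u) (hat b c p v)) := rfl

theorem contDiffOn_hat (u : Ambient r s) (a : Fin r ⊕ Fin s) {n : WithTop ℕ∞} :
    ContDiffOn ℝ n (fun p => hat b c p u a) (domain r s) :=
  (contDiffOn_powFactor _).mul contDiffOn_const

theorem contDiffOn_conj_hat (u : Ambient r s) (a : Fin r ⊕ Fin s) {n : WithTop ℕ∞} :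
    ContDiffOn ℝ n (fun p => conj (hat b c p u a)) (domain r s) := by
  have e : (fun p : Ambient r s => conj (hat b c p u a)) = fun p =>
      powFactor (fun k => conj (weight b c k a)) p * conj (coord a u) := by
    funext p
    rw [hat_apply, theta_apply, map_mul, conj_powFactor]
  rw [e]
  exact (contDiffOn_powFactor _).mul contDiffOn_const

theorem contDiffOn_bismutSymbol (e : Fin s ≃ Fin r) (A : ℝ) (B : Fin s → ℝ) (u v : Ambient r s)
    (a : Fin r ⊕ Fin s) {n : WithTop ℕ∞} :
    ContDiffOn ℝ n (fun p => bismutSymbol e A B (hat b c p u) (hat b c p v) a) (domain r s) := by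
  rcases a with k | i
  · exact (contDiffOn_const.mul ((contDiffOn_hat _ _).mul (contDiffOn_hat _ _))).sub
      (contDiffOn_const.mul ((contDiffOn_hat _ _).mul (contDiffOn_conj_hat _ _)))
  · exact contDiffOn_const.mul (((contDiffOn_conj_hat _ _).mul (contDiffOn_hat _ _)).sub
      ((contDiffOn_hat _ _).mul (contDiffOn_hat _ _)))

theorem contDiffOn_christoffelOf (e : Fin s ≃ Fin r) (A : ℝ) (B : Fin s → ℝ) {n : WithTop ℕ∞} :
    ContDiffOn ℝ n (christoffelOf b c (bismutSymbol e A B)) (domain r s) := by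
  refine contDiffOn_clm_apply.2 fun u => contDiffOn_clm_apply.2 fun v => ?_
  have h : ∀ a, ContDiffOn ℝ n (fun p => (powFactor (fun k => weight b c k a) p)⁻¹ *
      bismutSymbol e A B (hat b c p u) (hat b c p v) a) (domain r s) := fun a =>
    ((contDiffOn_powFactor _).inv fun p _ => powFactor_ne_zero _ p).mul
      (contDiffOn_bismutSymbol e A B u v a)
  exact (contDiffOn_pi.2 fun k => h (.inl k)).prodMk (contDiffOn_pi.2 fun i => h (.inr i))

theorem hermForm_diagMatrix_equiv (e : Fin s ≃ Fin r) (A : ℝ) (B : Fin s → ℝ)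
    (x y : Fin r ⊕ Fin s → ℂ) :
    hermForm (diagMatrix r A B) x y = ∑ i, (A * (x (.inl (e i)) * conj (y (.inl (e i)))) +
      B i * (x (.inr i) * conj (y (.inr i)))) := by
  rw [hermForm_diagMatrix, Finset.sum_add_distrib, Finset.mul_sum, ← Equiv.sum_comp e]

theorem sum_hermForm_weighted_diagMatrix (e : Fin s ≃ Fin r)
    (hb : ∀ k i, b k i = if k = e i then -1 else 0) (A : ℝ) (B : Fin s → ℝ) (τ : Fin r → ℂ)
    (x y : Fin r ⊕ Fin s → ℂ) :
    ∑ k, τ k * hermForm (weighted (weight b c k) (diagMatrix r A B)) x y =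
      ∑ i, τ (e i) * (2 * A * (x (.inl (e i)) * conj (y (.inl (e i)))) -
        B i * (x (.inr i) * conj (y (.inr i)))) := by
  rw [← Equiv.sum_comp e]
  refine Finset.sum_congr rfl fun j _ => ?_
  congr 1
  have e1 : weighted (weight b c (e j)) (diagMatrix r A B) = Matrix.diagonal fun a =>
      (weight b c (e j) a + conj (weight b c (e j) a)) *
        (Sum.elim (fun _ => (A : ℂ)) (fun i => (B i : ℂ)) a) := by
    ext a d
    rw [weighted, diagMatrix]
    by_cases had : a = d
    · subst had; rw [Matrix.diagonal_apply_eq, Matrix.diagonal_apply_eq]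
    · rw [Matrix.diagonal_apply_ne _ had, Matrix.diagonal_apply_ne _ had, mul_zero]
  rw [e1, hermForm_diagonal, Fintype.sum_sum_type, Finset.sum_eq_single (e j),
    Finset.sum_eq_single j]
  · have h2 : weight b c (e j) (.inr j) + conj (weight b c (e j) (.inr j)) = -1 := by
      rw [Complex.add_conj, weight_inr, hb]
      simp
      ring
    rw [h2, weight_inl, if_pos rfl, Sum.elim_inl, Sum.elim_inr, map_one]
    ring
  · intro i _ hij
    have h2 : weight b c (e j) (.inr i) + conj (weight b c (e j) (.inr i)) = 0 := by
      rw [Complex.add_conj, weight_inr, hb]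
      simp [hij.symm]
    rw [h2]; ring
  · simp
  · intro k _ hk
    rw [weight_inl, if_neg hk]
    simp
  · simp

/-- The Bismut connection of a diagonal metric. -/
theorem HasMatrix.isBismut (e : Fin s ≃ Fin r) (hb : ∀ k i, b k i = if k = e i then -1 else 0)
    {A : ℝ} (hA : A ≠ 0) {B : Fin s → ℝ} {ω : Form r s 2}
    (h : HasMatrix b c (diagMatrix r A B) ω) :
    IsBismut ω (christoffelOf b c (bismutSymbol e A B)) := by
  have hA' : (A : ℂ) ≠ 0 := by exact_mod_cast hA
  -- A solution of the flow must exhibit a Bismut connection. The symbol is what `bismut_formula`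
  -- gives for a diagonal matrix, and the metric and torsion conditions are checked for one index
  -- pair (e(i), i) at a time.
  refine ⟨contDiffOn_christoffelOf e A B, fun p hp => ⟨fun u v => ?_, fun u v w => ?_,
    fun u v w => ?_⟩⟩
  · rw [christoffelOf_apply, christoffelOf_apply, hat_J, bismutSymbol_I_smul, frame_smul, J_apply]
  · rw [h.fderiv_apply hp, h.apply_J hp, h.apply_J hp, christoffelOf_apply, christoffelOf_apply,
      hat_frame, hat_frame, ← mul_add, ← Complex.add_re]
    congr 2
    rw [sum_hermForm_weighted_diagMatrix e hb A B fun k => ((hat b c p u (.inl k)).im : ℂ),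
      hermForm_diagMatrix_equiv e, hermForm_diagMatrix_equiv e, ← Finset.sum_add_distrib,
      ← Finset.sum_neg_distrib]
    refine Finset.sum_congr rfl fun i _ => ?_
    simp only [bismutSymbol_inl, bismutSymbol_inr, e.symm_apply_apply, map_sub, map_mul,
      Complex.conj_I, Complex.conj_ofReal, Complex.conj_conj, map_div₀, map_ofNat]
    have him : ((hat b c p u (.inl (e i))).im : ℂ) =
        (hat b c p u (.inl (e i)) - conj (hat b c p u (.inl (e i)))) / (2 * Complex.I) :=
      Complex.im_eq_sub_conj _
    rw [him]
    push_cast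
    field_simp
    rw [Complex.I_sq]
    ring
  · rw [h.apply_J hp, h.apply_J hp]
    simp only [christoffelOf_apply, hat_sub, hat_frame]
    rw [← mul_neg]
    congr 1
    rw [hermForm_diagMatrix_equiv e, hermForm_diagMatrix_equiv e, ← Complex.neg_re,
      ← Finset.sum_neg_distrib, Complex.re_sum, Complex.re_sum]
    refine Finset.sum_congr rfl fun i _ => ?_
    simp only [Pi.sub_apply, bismutSymbol_inl, bismutSymbol_inr, e.symm_apply_apply]
    set x := hat b c p u
    set y := hat b c p v
    set z := hat b c p w
    have e1 : ∀ f g : ℂ, (A : ℂ) * ((Complex.I * f - Complex.I / 2 * (B i / A : ℝ) * g)) =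
        Complex.I * (A * f) - Complex.I / 2 * B i * g := fun f g => by
      push_cast; field_simp
    have e2 : ∀ x1 x2 x3 x4 w : ℂ, (A : ℂ) * ((Complex.I * (x1 * x2) -
        Complex.I / 2 * (B i / A : ℝ) * x3 - (Complex.I * (x2 * x1) -
        Complex.I / 2 * (B i / A : ℝ) * x4)) * w) =
        Complex.I / 2 * B i * (x4 - x3) * w := fun x1 x2 x3 x4 w => by
      linear_combination w * (e1 (x1 * x2) x3 - e1 (x2 * x1) x4)
    rw [e2, e2]
    simp only [Complex.add_re, Complex.neg_re, Complex.mul_re, Complex.mul_im, Complex.sub_re,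
      Complex.sub_im, Complex.div_re, Complex.div_im, Complex.I_re, Complex.I_im, Complex.conj_re,
      Complex.conj_im, Complex.ofReal_re, Complex.ofReal_im]
    norm_num
    ring

/-- Only the diagonal entry at z_k is contracted, where the weighted matrix is 2A; the factor i/2
then leaves i, independently of A and B. -/
theorem traceCoeff_diagMatrix {A : ℝ} (hA : A ≠ 0) {B : Fin s → ℝ} (hB : ∀ i, B i ≠ 0)
    (a : Fin r ⊕ Fin s) : traceCoeff (weight b c) Sum.inl (diagMatrix r A B) a =
      if a.isLeft then Complex.I else 0 := by
  have hinv : (diagMatrix r A B)⁻¹ = diagMatrix r A⁻¹ fun i => (B i)⁻¹ := by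
    refine Matrix.inv_eq_right_inv ?_
    rw [diagMatrix, diagMatrix, Matrix.diagonal_mul_diagonal, ← Matrix.diagonal_one]
    congr 1
    funext d
    rcases d with k | i <;> simp [hA, hB]
  have h1 : ∀ k, ∑ d, weighted (weight b c k) (diagMatrix r A B) a d *
      (diagMatrix r A B)⁻¹ d (.inl k) = if a = .inl k then 2 else 0 := fun k => by
    rw [hinv, Finset.sum_eq_single a]
    · by_cases ha : a = .inl k
      · subst ha
        simp [weighted, diagMatrix, weight_inl, hA]
        norm_num
      · rw [if_neg ha, diagMatrix, diagMatrix, Matrix.diagonal_apply_ne _ ha, mul_zero]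
    · intro d _ hd
      rw [weighted, diagMatrix, Matrix.diagonal_apply_ne _ hd.symm, mul_zero, zero_mul]
    · simp
  rw [traceCoeff]
  simp only [h1]
  rcases a with m | i
  · simp
  · simp

/-- Each z-index contributes 2 from the trace coefficient i and -1/2 from the remaining term. The
result does not depend on A or B, which is why A grows linearly under the flow. -/
theorem HasMatrix.ricciForm11_diagMatrix (e : Fin s ≃ Fin r)
    (hb : ∀ k i, b k i = if k = e i then -1 else 0) {A : ℝ} {B : Fin s → ℝ}
    (hA : A ≠ 0) (hB : ∀ i, B i ≠ 0) (hC : (diagMatrix r A B).PosDef) {ω : Form r s 2}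
    (h : HasMatrix b c (diagMatrix r A B) ω) {Γ : Christoffel r s} (hΓ : IsBismut ω Γ)
    {p : Ambient r s} (hp : p ∈ domain r s) (u v : Ambient r s) :
    ricciForm11 Γ p u v =
      3 / 2 * (∑ k, hat b c p u (.inl k) * conj (hat b c p v (.inl k))).im := by
  rw [hΓ.ricciForm11_eq h hC (sum_weight e hb) hp]
  simp only [traceCoeff_diagMatrix hA hB, Fintype.sum_sum_type, Sum.isLeft_inl, Sum.isLeft_inr,
    if_true, Bool.false_eq_true, if_false, zero_mul, Finset.sum_const_zero, add_zero, weight_inl]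
  rw [Complex.re_sum, Complex.im_sum, Finset.mul_sum, Finset.sum_div, ← Finset.sum_sub_distrib]
  refine Finset.sum_congr rfl fun m _ => ?_
  rw [Finset.sum_eq_single m]
  · simp
    ring
  · intro k _ hk; simp [hk.symm]
  · simp

end

end OeljeklausToma

namespace OeljeklausToma

noncomputable section

open ComplexConjugate
open scoped ComplexOrder

variable {r s : ℕ} {b c : Fin r → Fin s → ℝ}

/-! ### Diagonal metrics are solitons -/

theorem posDef_diagMatrix {A : ℝ} {B : Fin s → ℝ} (hA : 0 < A) (hB : ∀ i, 0 < B i) :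
    (diagMatrix r A B).PosDef := by
  refine Matrix.PosDef.diagonal fun a => ?_
  rcases a with k | i
  · exact Complex.zero_lt_real.2 hA
  · exact Complex.zero_lt_real.2 (hB i)

theorem isHermitian_diagMatrix (A : ℝ) (B : Fin s → ℝ) : (diagMatrix r A B).IsHermitian := by
  refine Matrix.isHermitian_diagonal_of_self_adjoint _ (funext fun a => ?_)
  rcases a with k | i
  · exact Complex.conj_ofReal A
  · exact Complex.conj_ofReal (B i)

theorem HasMatrix.isExpandingAlgebraicSoliton (e : Fin s ≃ Fin r)
    (hb : ∀ k i, b k i = if k = e i then -1 else 0) {A : ℝ} {B : Fin s → ℝ} (hA : 0 < A)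
    (hB : ∀ i, 0 < B i) {ω : Form r s 2} (hω : IsHermitianMetric ω) (hpl : IsPluriclosed ω)
    (h : HasMatrix b c (diagMatrix r A B) ω) (T : EReal) :
    IsExpandingAlgebraicSoliton b c T ω := by
  -- The z-part of ω is -2A Im Z and -ρ is -(3/2) Im Z, so A' = 3/4 and a_t A = A + 3t/4. The
  -- dilation factor a_t^(-1/2) keeps every B_i fixed.
  set a : ℝ → ℝ := fun t => 1 + 3 * t / (4 * A) with ha
  set l : ℝ → ℝ := fun t => (√(a t))⁻¹ with hl
  have hapos : ∀ t, 0 ≤ t → 0 < a t := fun t ht => by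
    have : 0 ≤ 3 * t / (4 * A) := by positivity
    simp only [ha]
    linarith
  have hlne : ∀ t, 0 ≤ t → l t ≠ 0 := fun t ht => inv_ne_zero (Real.sqrt_pos.2 (hapos t ht)).ne'
  have hal : ∀ t, 0 ≤ t → a t * l t ^ 2 = 1 := fun t ht => by
    rw [hl, inv_pow, Real.sq_sqrt (hapos t ht).le, mul_inv_cancel₀ (hapos t ht).ne']
  have hmat : ∀ t, 0 ≤ t → HasMatrix b c (diagMatrix r (a t * A) B)
      fun p => a t • pullback (dilation r s (l t)) ω p := fun t ht =>
    h.smul_pullback_dilation (hal t ht)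
  refine ⟨a, fun t => dilation r s (l t), by simp [ha], fun p _ => ?_,
    fun t ht => ⟨hapos t ht.1, isAutomorphism_dilation (hlne t ht.1)⟩, fun x _ y _ hxy => ?_,
    fun t ht => ⟨?_, ?_, ?_⟩⟩
  · simp [dilation_apply, hl, ha]
  · simp only [ha]
    gcongr
  · refine hω.pullback_linear (fun p hp => dilation_mem _ hp) (fun u hu => ?_) (hapos t ht.1)
    rw [dilation_apply, Prod.mk_eq_zero, smul_eq_zero] at hu
    exact Prod.ext hu.1 (hu.2.resolve_left (by exact_mod_cast hlne t ht.1))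
  · exact hpl.pullback_linear (fun p hp => dilation_mem _ hp) hω _
  · have hAt : 0 < a t * A := mul_pos (hapos t ht.1) hA
    have hΓ := (hmat t ht.1).isBismut e hb hAt.ne'
    refine ⟨_, hΓ, fun p hp u v => ?_⟩
    rw [(hmat t ht.1).ricciForm11_diagMatrix e hb hAt.ne' (fun i => (hB i).ne')
      (posDef_diagMatrix hAt hB) hΓ hp]
    set Z := ∑ k, hat b c p u (.inl k) * conj (hat b c p v (.inl k)) with hZ
    set W := ∑ i, (B i : ℂ) * (hat b c p u (.inr i) * conj (hat b c p v (.inr i))) with hW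
    have hval : ∀ t', 0 ≤ t' → (a t' • pullback (dilation r s (l t')) ω p) ![u, v] =
        -2 * (a t' * A * Z.im + W.im) := fun t' ht' => by
      rw [(hmat t' ht').apply hp, hermForm_diagMatrix, Complex.add_im, Complex.im_ofReal_mul]
    have hda : HasDerivWithinAt a (3 / (4 * A)) (timeInterval T) t := by
      have := (((hasDerivWithinAt_id t (timeInterval T)).const_mul 3).div_const (4 * A)).const_add 1
      rwa [mul_one] at this
    have hd := ((((hda.mul_const A).mul_const Z.im).add_const W.im).const_mul (-2))
    refine (hd.congr (fun t' ht' => hval t' ht'.1) (hval t ht.1)).congr_deriv ?_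
    field_simp
    ring

/-! ### Diagonal metrics in terms of adapted coframes -/

/-- By rigidity an adapted coframe is the standard one up to a permutation and the factors q_i. A
common coefficient A is blind to the permutation, and the B_i are only permuted and divided by
|q_i|². Hence the diagonal condition does not depend on the adapted coframe. -/
theorem IsAdaptedCoframe.isDiagonal_iff (e : Fin s ≃ Fin r)
    (hb : ∀ k i, b k i = if k = e i then -1 else 0) {α γ : Fin s → Form10 r s}
    (h : IsAdaptedCoframe b c α γ) (ω : Form r s 2) :
    IsDiagonalWithCommonCoefficient α γ ω ↔
      ∃ (A : ℝ) (B : Fin s → ℝ), 0 < A ∧ (∀ i, 0 < B i) ∧ HasMatrix b c (diagMatrix r A B) ω := by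
  obtain ⟨π, q, hq, hαγ⟩ := h.rigid e hb
  have hn : ∀ i, 0 < Complex.normSq (q i) := fun i => Complex.normSq_pos.2 (hq i)
  have key : ∀ (A : ℝ) (B : Fin s → ℝ), ∀ p ∈ domain r s, ∀ u v,
      Complex.I * ∑ i, ((A : ℂ) * wedgeConjRight (α i) (α i) p u v +
        ((B (e.symm (π i)) / Complex.normSq (q i) : ℝ) : ℂ) *
          wedgeConjRight (γ i) (γ i) p u v) =
      ((-2 * (hermForm (diagMatrix r A B) (hat b c p u) (hat b c p v)).im : ℝ) : ℂ) := by
    intro A B p hp u v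
    set Z := hermForm (diagMatrix r A B) (hat b c p u) (hat b c p v) with hZ
    have e1 : ∑ i, ((A : ℂ) * wedgeConjRight (α i) (α i) p u v +
        ((B (e.symm (π i)) / Complex.normSq (q i) : ℝ) : ℂ) *
          wedgeConjRight (γ i) (γ i) p u v) = Z - conj Z := by
      rw [hZ, conj_hermForm (isHermitian_diagMatrix A B), hermForm_diagMatrix_equiv e,
        hermForm_diagMatrix_equiv e, ← Finset.sum_sub_distrib]
      refine (Finset.sum_congr rfl fun i _ => ?_).trans (Equiv.sum_comp (π.trans e.symm) _)
      simp only [wedgeConjRight, (hαγ p hp u).1, (hαγ p hp u).2, (hαγ p hp v).1, (hαγ p hp v).2,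
        Equiv.trans_apply, e.apply_symm_apply, hat_apply, map_mul]
      have h0 : (Complex.normSq (q i) : ℂ) ≠ 0 := by exact_mod_cast (hn i).ne'
      have h1 : (Complex.normSq (q i) : ℂ) = q i * conj (q i) := (Complex.mul_conj _).symm
      push_cast
      field_simp
      rw [h1]
      ring
    rw [e1, Complex.sub_conj]
    push_cast
    linear_combination (2 * (Z.im : ℂ)) * Complex.I_sq
  constructor
  · rintro ⟨A, B, hA, hB, hω⟩
    refine ⟨A, fun j => B (π.symm (e j)) * Complex.normSq (q (π.symm (e j))), hA,
      fun j => mul_pos (hB _) (hn _), fun p hp u v => ?_⟩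
    have h1 := key A (fun j => B (π.symm (e j)) * Complex.normSq (q (π.symm (e j)))) p hp u v
    simp only [e.apply_symm_apply, π.symm_apply_apply, mul_div_cancel_right₀ _ (hn _).ne'] at h1
    rw [← hω p hp u v] at h1
    exact_mod_cast h1
  · rintro ⟨A, B, hA, hB, hω⟩
    refine ⟨A, fun i => B (e.symm (π i)) / Complex.normSq (q i), hA,
      fun i => div_pos (hB _) (hn _), fun p hp u v => ?_⟩
    rw [key A B p hp, hω p hp]

end

end OeljeklausToma

namespace OeljeklausToma

noncomputable section

open ComplexConjugate
open scoped ComplexOrder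

variable {r s : ℕ} {b c : Fin r → Fin s → ℝ}

/-! ### Classification of algebraic expanding solitons -/

theorem OTData.soliton_iff {K : Type*} [Field K] [NumberField K] (X : OTData K r s)
    (hbc : X.IsExponents b c) {ω : Form r s 2} (hω : IsHermitianMetric ω)
    (hinv : IsLeftInvariant b c ω) (hpl : IsPluriclosed ω) {T : EReal} (hT : 0 < T) :
    (∃ α γ : Fin s → Form10 r s, IsAdaptedCoframe b c α γ) ∧
    ∀ α γ : Fin s → Form10 r s, IsAdaptedCoframe b c α γ →
      (IsExpandingAlgebraicSoliton b c T ω ↔ IsDiagonalWithCommonCoefficient α γ ω) := by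
  obtain ⟨C, hC, h⟩ := exists_hasMatrix b c hω hinv
  obtain ⟨e, hb⟩ := X.exists_equiv_of_quadratic hbc fun i k l => h.quadratic hω hpl hC i k l
  refine ⟨⟨_, _, isAdaptedCoframe_theta e hb⟩, fun α γ hαγ => ?_⟩
  rw [hαγ.isDiagonal_iff e hb]
  constructor
  · intro hsol
    obtain ⟨A, hA⟩ := hsol.matrix_eq X.one_le_s e hb hω hpl hT h hC
    have hAA : ∀ k, C (.inl k) (.inl k) = A := fun k => by
      rw [hA, Matrix.diagonal_apply_eq, Sum.elim_inl]
    refine ⟨A, fun i => (C (.inr i) (.inr i)).re, ?_, fun i => diag_pos hC _, ?_⟩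
    · have := diag_pos hC (.inl (e ⟨0, X.one_le_s⟩))
      rwa [hAA, Complex.ofReal_re] at this
    · have hre : ∀ i, ((C (.inr i) (.inr i)).re : ℂ) = C (.inr i) (.inr i) := fun i =>
        Complex.conj_eq_iff_re.1 (hC.isHermitian.apply _ _)
      simp only [diagMatrix, hre]
      rwa [← hA]
  · rintro ⟨A, B, hA, hB, hm⟩
    exact hm.isExpandingAlgebraicSoliton e hb hA hB hω hpl T

end

end OeljeklausToma

theorem corollary4p4 {K : Type*} [Field K] [NumberField K] {r s : ℕ}
    (X : OeljeklausToma.OTData K r s)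
    (b c : Fin r → Fin s → ℝ) (hbc : X.IsExponents b c)
    (ω : OeljeklausToma.Form r s 2)
    (hω : OeljeklausToma.IsHermitianMetric ω)
    (hinv : OeljeklausToma.IsLeftInvariant b c ω)
    (hpl : OeljeklausToma.IsPluriclosed ω)
    (T : EReal) (hT : 0 < T) :
    (∃ α γ : Fin s → OeljeklausToma.Form10 r s, OeljeklausToma.IsAdaptedCoframe b c α γ) ∧
    ∀ α γ : Fin s → OeljeklausToma.Form10 r s, OeljeklausToma.IsAdaptedCoframe b c α γ →
      (OeljeklausToma.IsExpandingAlgebraicSoliton b c T ω ↔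
        OeljeklausToma.IsDiagonalWithCommonCoefficient α γ ω) :=
  X.soliton_iff hbc hω hinv hpl hT
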